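/- In the problem Zero Extension with metric cost functions, the input consists of a finite undirected graph $G$ with $n$ vertices and $m$ edges (parallel edges and loops are allowed), a finite nonempty label set $D$, a partial labelling $\tau\colon S\to D$ with $S\subseteq V(G)$, a function $\mu\colon D\times D\to\mathbb{R}_{\ge 0}$ that is symmetric, satisfies $\mu(a,a)=0$ for all $a$ and obeys the triangle inequality (distinct labels may have $\mu(a,b)=0$), a threshold $q\in\mathbb{R}$, and an integer $k\ge 0$. The question is whether there is a labelling $\lambda\colon V(G)\to D$ that agrees with $\tau$ on $S$, has at most $k$ crossing edges (edges $uv$ with $\lambda(u)\ne\lambda(v)$), and has cost $\sum_{uv\in E(G)}\mu(\lambda(u),\lambda(v))\le q$. **Theorem.** This problem can be solved in time $O(|D|^{O(k)}\cdot m)$. Precisely, there are a random access machine program and a constant $c$ such that on every input the program halts with the correct answer after at most $c\cdot|D|^{ck}\cdot(m+1)$ steps. The machine performs unit-cost arithmetic on natural numbers, all of which stay at most $(n+m+|D|+k+2)^c$, so they fit into words of logarithmic length; the costs $\mu(a,b)$ and the threshold $q$ are stored in separate cells for real numbers, which can only be copied, added and compared, each at unit cost. The input is given as the numbers $n,m,|D|,k$,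 a list of the edges, an array for $\tau$, a table of $\mu$ and the number $q$, and all other memory is initially zero. -/

import Mathlib

/-! ## The problem -/

namespace ZeroExt

/-- A metric cost function on the label set `D`: a symmetric nonnegative function, zero on the
diagonal, with the triangle inequality. Distinct labels may be at distance zero. -/
structure IsMetricCost {D : Type*} (μ : D → D → ℝ) : Prop where
  nonneg : ∀ a b, 0 ≤ μ a b
  symm : ∀ a b, μ a b = μ b a
  diag : ∀ a, μ a a = 0
  triangle : ∀ a b c, μ a c ≤ μ a b + μ b c

/-- The labelling `lab` extends the partial labelling `τ` (`none` means unlabelled). -/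
def IsExtension {V D : Type*} (τ : V → Option D) (lab : V → D) : Prop :=
  ∀ v a, τ v = some a → lab v = a

/-- The number of crossing edges of a labelling, where the edge `e` joins `src e` and `tgt e`. -/
def crossing {V E D : Type*} [Fintype E] [DecidableEq D] (src tgt : E → V) (lab : V → D) : ℕ :=
  (Finset.univ.filter fun e => lab (src e) ≠ lab (tgt e)).card

/-- The cost of a labelling: the sum of `μ (lab u) (lab v)` over all edges `uv`. -/
noncomputable def cost {V E D : Type*} [Fintype E] (src tgt : E → V) (μ : D → D → ℝ)
    (lab : V → D) : ℝ :=
  ∑ e, μ (lab (src e)) (lab (tgt e))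

/-- The data of an instance of Zero Extension: a finite undirected graph with vertices
`0, …, n - 1`, given by the list of its `m` edges (parallel edges and loops are allowed, so a
simple graph is a special case), a nonempty label set `{0, …, d - 1}`, a partial labelling, a
function `μ` on pairs of labels and a threshold `q`. -/
structure Instance where
  n : ℕ
  m : ℕ
  d : ℕ
  d_pos : 0 < d
  src : Fin m → Fin n
  tgt : Fin m → Fin n
  τ : Fin n → Option (Fin d)
  μ : Fin d → Fin d → ℝ
  q : ℝ

/-- There is an extension of the partial labelling of cost at most `q` that has at most `k`
crossing edges. -/
def Instance.HasSolution (I : Instance) (k : ℕ) : Prop :=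
  ∃ lab : Fin I.n → Fin I.d,
    IsExtension I.τ lab ∧ crossing I.src I.tgt lab ≤ k ∧ cost I.src I.tgt I.μ lab ≤ I.q

end ZeroExt

/-! ## The machine model

A random access machine with structured control flow. A program uses finitely many variables and
arrays. There are two sorts of cells: cells for natural numbers, which must fit into a machine word
(have value at most `W`), and cells for real costs, on which the only operations are copying,
addition and comparison. -/

namespace RAM

/-- The contents of the memory: variables and arrays of natural numbers, and of real numbers. -/
structure State where
  var : ℕ → ℕ
  arr : ℕ → ℕ → ℕ
  rvar : ℕ → ℝ
  rarr : ℕ → ℕ → ℝ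

/-- Expressions for natural numbers; `arr a i` is the entry of the array `a` at position `i`. -/
inductive NExp where
  | const (c : ℕ)
  | var (x : ℕ)
  | arr (a : ℕ) (i : NExp)
  | add (e f : NExp)
  | sub (e f : NExp)
  | mul (e f : NExp)

namespace NExp

/-- The value of an expression; subtraction is truncated at zero. -/
def eval (s : State) : NExp → ℕ
  | const c => c
  | var x => s.var x
  | arr a i => s.arr a (i.eval s)
  | add e f => e.eval s + f.eval s
  | sub e f => e.eval s - f.eval s
  | mul e f => e.eval s * f.eval s

/-- The time for evaluating an expression: one step for each operation or access. -/
def time : NExp → ℕ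
  | const _ => 1
  | var _ => 1
  | arr _ i => i.time + 1
  | add e f => e.time + f.time + 1
  | sub e f => e.time + f.time + 1
  | mul e f => e.time + f.time + 1

/-- All values (addresses included) that occur in the evaluation are at most `W`. -/
def Fits (W : ℕ) (s : State) : NExp → Prop
  | const c => c ≤ W
  | var x => s.var x ≤ W
  | arr a i => i.Fits W s ∧ s.arr a (i.eval s) ≤ W
  | add e f => e.Fits W s ∧ f.Fits W s ∧ e.eval s + f.eval s ≤ W
  | sub e f => e.Fits W s ∧ f.Fits W s
  | mul e f => e.Fits W s ∧ f.Fits W s ∧ e.eval s * f.eval s ≤ W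

end NExp

/-- Expressions for real numbers. -/
inductive RExp where
  | zero
  | var (x : ℕ)
  | arr (a : ℕ) (i : NExp)
  | add (r t : RExp)

namespace RExp

/-- The value of an expression. -/
noncomputable def eval (s : State) : RExp → ℝ
  | zero => 0
  | var x => s.rvar x
  | arr a i => s.rarr a (i.eval s)
  | add r t => r.eval s + t.eval s

/-- The time for evaluating an expression. -/
def time : RExp → ℕ
  | zero => 1
  | var _ => 1
  | arr _ i => i.time + 1
  | add r t => r.time + t.time + 1

/-- All addresses that occur in the evaluation are at most `W`. -/
def Fits (W : ℕ) (s : State) : RExp → Prop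
  | zero => True
  | var _ => True
  | arr _ i => i.Fits W s
  | add r t => r.Fits W s ∧ t.Fits W s

end RExp

/-- Tests. -/
inductive Test where
  | lt (e f : NExp)
  | eq (e f : NExp)
  | rle (r t : RExp)
  | not (b : Test)

namespace Test

/-- The test succeeds. -/
def Holds (s : State) : Test → Prop
  | lt e f => e.eval s < f.eval s
  | eq e f => e.eval s = f.eval s
  | rle r t => r.eval s ≤ t.eval s
  | not b => ¬ b.Holds s

/-- The time for evaluating a test. -/
def time : Test → ℕ
  | lt e f => e.time + f.time + 1
  | eq e f => e.time + f.time + 1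
  | rle r t => r.time + t.time + 1
  | not b => b.time + 1

/-- All natural numbers that occur in the evaluation are at most `W`. -/
def Fits (W : ℕ) (s : State) : Test → Prop
  | lt e f => e.Fits W s ∧ f.Fits W s
  | eq e f => e.Fits W s ∧ f.Fits W s
  | rle r t => r.Fits W s ∧ t.Fits W s
  | not b => b.Fits W s

end Test

/-- Programs. -/
inductive Program where
  | skip
  | assign (x : ℕ) (e : NExp)
  | store (a : ℕ) (i e : NExp)
  | rassign (x : ℕ) (r : RExp)
  | rstore (a : ℕ) (i : NExp) (r : RExp)
  | seq (p p' : Program)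
  | ite (b : Test) (p p' : Program)
  | loop (b : Test) (p : Program)

open Program in
/-- `Exec W p s t s'`: the program `p`, started in the memory state `s`, halts after `t` steps in
the state `s'`, and all natural numbers in the computation are at most `W`. The program
`loop b p` repeats `p` while the test `b` succeeds. The rules are deterministic. -/
inductive Exec (W : ℕ) : Program → State → ℕ → State → Prop where
  | skip (s : State) : Exec W skip s 1 s
  | assign (s : State) (x : ℕ) (e : NExp) (he : e.Fits W s) :
      Exec W (assign x e) s (e.time + 1)
        { s with var := Function.update s.var x (e.eval s) }
  | store (s : State) (a : ℕ) (i e : NExp) (hi : i.Fits W s) (he : e.Fits W s) :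
      Exec W (store a i e) s (i.time + e.time + 1)
        { s with arr :=
            Function.update s.arr a (Function.update (s.arr a) (i.eval s) (e.eval s)) }
  | rassign (s : State) (x : ℕ) (r : RExp) (hr : r.Fits W s) :
      Exec W (rassign x r) s (r.time + 1)
        { s with rvar := Function.update s.rvar x (r.eval s) }
  | rstore (s : State) (a : ℕ) (i : NExp) (r : RExp) (hi : i.Fits W s) (hr : r.Fits W s) :
      Exec W (rstore a i r) s (i.time + r.time + 1)
        { s with rarr :=
            Function.update s.rarr a (Function.update (s.rarr a) (i.eval s) (r.eval s)) }
  | seq {p p' : Program} {s s' s'' : State} {t t' : ℕ}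
      (h : Exec W p s t s') (h' : Exec W p' s' t' s'') :
      Exec W (seq p p') s (t + t') s''
  | ite_true {b : Test} {p p' : Program} {s s' : State} {t : ℕ}
      (hf : b.Fits W s) (hb : b.Holds s) (h : Exec W p s t s') :
      Exec W (ite b p p') s (b.time + 1 + t) s'
  | ite_false {b : Test} {p p' : Program} {s s' : State} {t : ℕ}
      (hf : b.Fits W s) (hb : ¬ b.Holds s) (h : Exec W p' s t s') :
      Exec W (ite b p p') s (b.time + 1 + t) s'
  | loop_true {b : Test} {p : Program} {s s' s'' : State} {t t' : ℕ}
      (hf : b.Fits W s) (hb : b.Holds s) (h : Exec W p s t s')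
      (h' : Exec W (loop b p) s' t' s'') :
      Exec W (loop b p) s (b.time + 1 + t + t') s''
  | loop_false {b : Test} {p : Program} {s : State}
      (hf : b.Fits W s) (hb : ¬ b.Holds s) :
      Exec W (loop b p) s (b.time + 1) s

end RAM

namespace ZeroExt

/-- The memory at the start of the computation on the instance `I` with parameter `k`.
Variables `0, 1, 2, 3` hold `n, m, d, k`. Arrays `0` and `1` hold the two endpoints of each edge.
Array `2` holds the partial labelling: `0` for an unlabelled vertex, `a + 1` for a vertex of
label `a`. Real variable `0` holds `q`, real array `0` holds `μ a b` at position `a * d + b`.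
All other cells are zero. -/
noncomputable def Instance.input (I : Instance) (k : ℕ) : RAM.State where
  var x :=
    match x with
    | 0 => I.n
    | 1 => I.m
    | 2 => I.d
    | 3 => k
    | _ => 0
  arr a i :=
    match a with
    | 0 => if h : i < I.m then (I.src ⟨i, h⟩ : ℕ) else 0
    | 1 => if h : i < I.m then (I.tgt ⟨i, h⟩ : ℕ) else 0
    | 2 => if h : i < I.n then
        (match I.τ ⟨i, h⟩ with
        | none => 0
        | some a => (a : ℕ) + 1) else 0
    | _ => 0
  rvar x :=
    match x with
    | 0 => I.q
    | _ => 0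
  rarr a i :=
    match a with
    | 0 => if h : i / I.d < I.d then I.μ ⟨i / I.d, h⟩ ⟨i % I.d, Nat.mod_lt i I.d_pos⟩ else 0
    | _ => 0

end ZeroExt

/-!
# Zero Extension with metric costs in time `|D| ^ O(k) * m`

The algorithm is a search tree whose nodes are partial labellings. Fix a label `a` and compute an
integral maximum flow, with unit capacities on the edges, from the vertices that carry another label
to those of label `a`. If its value exceeds `2 * k`, there is no solution. Otherwise let `R` be the
set of vertices that can be reached from the sources in the residual graph. Relabelling everything
outside `R` to `a` turns solutions into solutions (`Net.Sol.relabel`): by the triangle inequality,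
the cost that the relabelling adds on the edges between `R` and its complement is paid for by the
old cost along the flow, and the same holds for the discrete metric, that is, for the number of
crossing edges (`Net.Reach.sum_relabel_le`). So the vertices outside `R` may be labelled `a` for
good. Afterwards the class of `a` is *normal*: every larger set that avoids the other labels has a
strictly larger boundary (`Net.Reach.normal_relabel`). Normality survives the treatment of the
other labels.

When all classes are normal, either all vertices with edges are labelled and the labelling can be
checked directly, or the algorithm branches on the label of an unlabelled vertex. Whatever label the
vertex gets, the sum of the boundaries of the label classes grows (`Net.potential_lt`). In a solution
this sum is at most `2 * k`, since every crossing edge counts twice (`Net.Sol.sum_bdry_le`). Hence the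
depth of the tree is at most `2 * k`, and its size is `|D| ^ O(k)`.

Time linear in `m` leaves no room to touch vertices without edges, nor, for `k = 0`, for a factor
`|D|`, nor, for a single label, for a factor `k`. So the program reaches vertices only through edges,
and in the last two cases, in which solutions have no crossing edges, it propagates labels by one
search (`exists_sol_iff`).

Programs are verified with triples `RAM.Runs` for total correctness within a time bound. Since the
text of a program determines which cells it can write (`RAM.Frame`), loop invariants speak only of
the cells that the loop body writes.
-/

/-! ### A program logic with running times -/

namespace RAM

/-- The state after assigning `v` to the variable `x`. -/
def State.setVar (s : State) (x v : ℕ) : State :=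
  { s with var := Function.update s.var x v }

/-- The state after storing `v` at position `i` of the array `a`. -/
def State.setArr (s : State) (a i v : ℕ) : State :=
  { s with arr := Function.update s.arr a (Function.update (s.arr a) i v) }

/-- The state after assigning `v` to the real variable `x`. -/
def State.setRvar (s : State) (x : ℕ) (v : ℝ) : State :=
  { s with rvar := Function.update s.rvar x v }

section StateSimp

variable (s : State) (x y a b i v : ℕ) (r : ℝ)

@[simp] theorem State.setVar_var :
    (s.setVar x v).var y = if y = x then v else s.var y := by
  simp [State.setVar, Function.update_apply]

@[simp] theorem State.setVar_arr : (s.setVar x v).arr = s.arr := rfl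

@[simp] theorem State.setVar_rvar : (s.setVar x v).rvar = s.rvar := rfl

@[simp] theorem State.setVar_rarr : (s.setVar x v).rarr = s.rarr := rfl

@[simp] theorem State.setArr_var : (s.setArr a i v).var = s.var := rfl

@[simp] theorem State.setArr_arr :
    (s.setArr a i v).arr b = if b = a then Function.update (s.arr a) i v else s.arr b := by
  simp [State.setArr, Function.update_apply]

@[simp] theorem State.setRvar_var : (s.setRvar x r).var = s.var := rfl

@[simp] theorem State.setRvar_rvar :
    (s.setRvar x r).rvar y = if y = x then r else s.rvar y := by
  simp [State.setRvar, Function.update_apply]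

end StateSimp

namespace Program

/-- The variables that a program may assign. -/
def wvars : Program → List ℕ
  | assign x _ => [x]
  | seq p p' => p.wvars ++ p'.wvars
  | ite _ p p' => p.wvars ++ p'.wvars
  | loop _ p => p.wvars
  | _ => []

/-- The arrays into which a program may write. -/
def warrs : Program → List ℕ
  | store a _ _ => [a]
  | seq p p' => p.warrs ++ p'.warrs
  | ite _ p p' => p.warrs ++ p'.warrs
  | loop _ p => p.warrs
  | _ => []

/-- The real variables that a program may assign. -/
def wrvars : Program → List ℕ
  | rassign x _ => [x]
  | seq p p' => p.wrvars ++ p'.wrvars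
  | ite _ p p' => p.wrvars ++ p'.wrvars
  | loop _ p => p.wrvars
  | _ => []

/-- The real arrays into which a program may write. -/
def wrarrs : Program → List ℕ
  | rstore a _ _ => [a]
  | seq p p' => p.wrarrs ++ p'.wrarrs
  | ite _ p p' => p.wrarrs ++ p'.wrarrs
  | loop _ p => p.wrarrs
  | _ => []

end Program

/-- The states `s` and `s'` agree on all cells that the text of `p` does not write. -/
structure Frame (p : Program) (s s' : State) : Prop where
  var : ∀ {x}, x ∉ p.wvars → s'.var x = s.var x
  arr : ∀ {a}, a ∉ p.warrs → s'.arr a = s.arr a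
  rvar : ∀ {x}, x ∉ p.wrvars → s'.rvar x = s.rvar x
  rarr : ∀ {a}, a ∉ p.wrarrs → s'.rarr a = s.rarr a

theorem Frame.refl (p : Program) (s : State) : Frame p s s :=
  ⟨fun _ => rfl, fun _ => rfl, fun _ => rfl, fun _ => rfl⟩

theorem Frame.trans {p : Program} {s s' s'' : State} (h : Frame p s s') (h' : Frame p s' s'') :
    Frame p s s'' :=
  ⟨fun hx => (h'.var hx).trans (h.var hx), fun hx => (h'.arr hx).trans (h.arr hx),
    fun hx => (h'.rvar hx).trans (h.rvar hx), fun hx => (h'.rarr hx).trans (h.rarr hx)⟩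

/-- A frame condition for a program is one for every program that writes at least the same
cells. -/
theorem Frame.weaken {p p' : Program} {s s' : State} (h : Frame p s s')
    (hv : p.wvars ⊆ p'.wvars) (ha : p.warrs ⊆ p'.warrs) (hrv : p.wrvars ⊆ p'.wrvars)
    (hra : p.wrarrs ⊆ p'.wrarrs) : Frame p' s s' :=
  ⟨fun hx => h.var fun h' => hx (hv h'), fun hx => h.arr fun h' => hx (ha h'),
    fun hx => h.rvar fun h' => hx (hrv h'), fun hx => h.rarr fun h' => hx (hra h')⟩

theorem Exec.frame {W : ℕ} {p : Program} {s s' : State} {t : ℕ} (h : Exec W p s t s') :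
    Frame p s s' := by
  induction h with
  | skip s => exact Frame.refl _ _
  | assign s x e he =>
    refine ⟨fun hx => ?_, fun _ => rfl, fun _ => rfl, fun _ => rfl⟩
    simp only [Program.wvars, List.mem_singleton] at hx
    simp [hx]
  | store s a i e hi he =>
    refine ⟨fun _ => rfl, fun hx => ?_, fun _ => rfl, fun _ => rfl⟩
    simp only [Program.warrs, List.mem_singleton] at hx
    simp [hx]
  | rassign s x r hr =>
    refine ⟨fun _ => rfl, fun _ => rfl, fun hx => ?_, fun _ => rfl⟩
    simp only [Program.wrvars, List.mem_singleton] at hx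
    simp [hx]
  | rstore s a i r hi hr =>
    refine ⟨fun _ => rfl, fun _ => rfl, fun _ => rfl, fun hx => ?_⟩
    simp only [Program.wrarrs, List.mem_singleton] at hx
    simp [hx]
  | seq h h' ih ih' =>
    exact (ih.weaken (by simp [Program.wvars]) (by simp [Program.warrs])
      (by simp [Program.wrvars]) (by simp [Program.wrarrs])).trans
      (ih'.weaken (by simp [Program.wvars]) (by simp [Program.warrs])
      (by simp [Program.wrvars]) (by simp [Program.wrarrs]))
  | ite_true hf hb h ih =>
    exact ih.weaken (by simp [Program.wvars]) (by simp [Program.warrs])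
      (by simp [Program.wrvars]) (by simp [Program.wrarrs])
  | ite_false hf hb h ih =>
    exact ih.weaken (by simp [Program.wvars]) (by simp [Program.warrs])
      (by simp [Program.wrvars]) (by simp [Program.wrarrs])
  | loop_true hf hb h h' ih ih' =>
    exact (ih.weaken (by simp [Program.wvars]) (by simp [Program.warrs])
      (by simp [Program.wrvars]) (by simp [Program.wrarrs])).trans ih'
  | loop_false hf hb => exact Frame.refl _ _

/-- Total correctness with a time bound: started in `s`, the program `p` halts within `T` steps in
a state that satisfies `Q`, and all numbers in the computation are at most `W`. -/
def Runs (W : ℕ) (p : Program) (s : State) (T : ℕ) (Q : State → Prop) : Prop :=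
  ∃ t s', Exec W p s t s' ∧ t ≤ T ∧ Q s'

namespace Runs

variable {W T T' : ℕ} {p p' : Program} {s : State} {Q Q' : State → Prop}

theorem conseq (h : Runs W p s T Q) (hT : T ≤ T')
    (hQ : ∀ s', Frame p s s' → Q s' → Q' s') : Runs W p s T' Q' := by
  obtain ⟨t, s', he, ht, hq⟩ := h
  exact ⟨t, s', he, ht.trans hT, hQ s' he.frame hq⟩

theorem seq (h : Runs W p s T Q) (h' : ∀ s', Frame p s s' → Q s' → Runs W p' s' T' Q') :
    Runs W (.seq p p') s (T + T') Q' := by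
  obtain ⟨t, s', he, ht, hq⟩ := h
  obtain ⟨t', s'', he', ht', hq'⟩ := h' s' he.frame hq
  exact ⟨_, s'', .seq he he', by omega, hq'⟩

theorem ite {b : Test} (hf : b.Fits W s) (h : b.Holds s → Runs W p s T Q)
    (h' : ¬ b.Holds s → Runs W p' s T Q) : Runs W (.ite b p p') s (b.time + 1 + T) Q := by
  by_cases hb : b.Holds s
  · obtain ⟨t, s', he, ht, hq⟩ := h hb
    exact ⟨_, s', .ite_true hf hb he, by omega, hq⟩
  · obtain ⟨t, s', he, ht, hq⟩ := h' hb
    exact ⟨_, s', .ite_false hf hb he, by omega, hq⟩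

/-- The rule for loops: `I r` is an invariant for states from which at most `r` iterations remain.
Every state met by the loop agrees with the first one on the cells that the body does not write,
so the invariant has to speak only of the cells that the body writes. -/
theorem loop {b : Test} {I : ℕ → State → Prop} {N : ℕ} (h0 : I N s)
    (hf : ∀ r s', Frame p s s' → I r s' → b.Fits W s')
    (hbody : ∀ r s', Frame p s s' → I r s' → b.Holds s' →
      Runs W p s' T (fun s'' => ∃ r' < r, I r' s'')) :
    Runs W (.loop b p) s ((b.time + 1 + T) * N + (b.time + 1))
      (fun s' => (∃ r, I r s') ∧ ¬ b.Holds s') := by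
  have key : ∀ N s', Frame p s s' → I N s' →
      Runs W (.loop b p) s' ((b.time + 1 + T) * N + (b.time + 1))
        (fun s' => (∃ r, I r s') ∧ ¬ b.Holds s') := by
    intro N
    induction N using Nat.strong_induction_on with
    | _ N ih =>
      intro s' hs hI
      by_cases hb : b.Holds s'
      · obtain ⟨t, s'', he, ht, r', hr, hI'⟩ := hbody N s' hs hI hb
        obtain ⟨t', s3, he', ht', hq⟩ := ih r' hr s'' (hs.trans he.frame) hI'
        refine ⟨_, s3, .loop_true (hf N s' hs hI) hb he he', ?_, hq⟩
        have h1 : (b.time + 1 + T) * (r' + 1) ≤ (b.time + 1 + T) * N := Nat.mul_le_mul_left _ hr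
        rw [Nat.mul_add] at h1
        omega
      · exact ⟨_, s', .loop_false (hf N s' hs hI) hb, by omega, ⟨N, hI⟩, hb⟩
  exact key N s (Frame.refl _ _) h0

end Runs

/-- The weakest precondition of a program without loops. -/
def Program.wp (W : ℕ) : Program → (State → Prop) → State → Prop
  | .skip, Q, s => Q s
  | .assign x e, Q, s => e.Fits W s ∧ Q (s.setVar x (e.eval s))
  | .store a i e, Q, s => i.Fits W s ∧ e.Fits W s ∧ Q (s.setArr a (i.eval s) (e.eval s))
  | .rassign x r, Q, s => r.Fits W s ∧ Q (s.setRvar x (r.eval s))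
  | .rstore _ _ _, _, _ => False
  | .seq p p', Q, s => p.wp W (p'.wp W Q) s
  | .ite b p p', Q, s => b.Fits W s ∧ (b.Holds s → p.wp W Q s) ∧ (¬ b.Holds s → p'.wp W Q s)
  | .loop _ _, _, _ => False

/-- A bound on the running time of a program without loops. -/
def Program.steps : Program → ℕ
  | .skip => 1
  | .assign _ e => e.time + 1
  | .store _ i e => i.time + e.time + 1
  | .rassign _ r => r.time + 1
  | .seq p p' => p.steps + p'.steps
  | .ite b p p' => b.time + 1 + (p.steps + p'.steps)
  | _ => 0

theorem Runs.of_wp {W : ℕ} {p : Program} {s : State} {Q : State → Prop} (h : p.wp W Q s) :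
    Runs W p s p.steps Q := by
  induction p generalizing s Q with
  | skip => exact ⟨_, _, .skip s, le_rfl, h⟩
  | assign x e => exact ⟨_, _, .assign s x e h.1, le_rfl, h.2⟩
  | store a i e => exact ⟨_, _, .store s a i e h.1 h.2.1, le_rfl, h.2.2⟩
  | rassign x r => exact ⟨_, _, .rassign s x r h.1, le_rfl, h.2⟩
  | rstore a i r => exact h.elim
  | seq p p' ih ih' => exact (ih h).seq fun s' _ hs => ih' hs
  | ite b p p' ih ih' =>
    refine Runs.ite h.1 (fun hb => ?_) (fun hb => ?_)
    · exact (ih (h.2.1 hb)).conseq (by omega) fun _ _ h => h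
    · exact (ih' (h.2.2 hb)).conseq (by omega) fun _ _ h => h
  | loop b p ih => exact h.elim

/-- Run `body` for the values `0, 1, …, N - 1` of the variable `x`, where `N` is the value of the
variable `y`. -/
def Program.forLoop (x y : ℕ) (body : Program) : Program :=
  .seq (.assign x (.const 0))
    (.loop (.lt (.var x) (.var y)) (.seq body (.assign x (.add (.var x) (.const 1)))))

theorem Runs.forLoop {W T x y N : ℕ} {body : Program} {s : State} {I : ℕ → State → Prop}
    (hx : x ∉ body.wvars) (hy : y ∉ body.wvars) (hxy : y ≠ x) (hN : s.var y = N)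
    (hW : N + 1 ≤ W) (h0 : I 0 s) (hI : ∀ i s v, I i s → I i (s.setVar x v))
    (hbody : ∀ i s', i < N → Frame (Program.forLoop x y body) s s' → s'.var x = i → I i s' →
      Runs W body s' T (I (i + 1))) :
    Runs W (Program.forLoop x y body) s ((T + 8) * N + 6) (I N) := by
  have h1 : Runs W (.assign x (.const 0)) s 2 fun s' => s' = s.setVar x 0 :=
    ⟨_, _, .assign s x (.const 0) (Nat.zero_le _), le_rfl, rfl⟩
  have hbx : x ∉ body.wvars := hx
  refine (h1.seq (T' := (4 + (T + 4)) * N + 4) (Q' := I N) ?_).conseq ?_ (fun _ _ h => h)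
  · rintro s1 hfr rfl
    refine ((Runs.loop (T := T + 4) (N := N)
      (I := fun r s' => ∃ i, s'.var x = i ∧ i + r = N ∧ I i s') ?_ ?_ ?_).conseq le_rfl ?_)
    · exact ⟨0, by simp, by simp, hI _ _ _ h0⟩
    · rintro r s' hs ⟨i, hi, hir, hI'⟩
      have : s'.var y = N := by
        rw [hs.var (by simp [Program.wvars, hy, hxy])]
        simp [hxy, hN]
      simp only [Test.Fits, NExp.Fits]
      omega
    · rintro r s' hs ⟨i, hi, hir, hI'⟩ hb
      have hyN : s'.var y = N := by
        rw [hs.var (by simp [Program.wvars, hy, hxy])]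
        simp [hxy, hN]
      simp only [Test.Holds, NExp.eval] at hb
      refine (hbody i s' (by omega) ?_ hi hI').seq (T' := 4) ?_
      · have : Frame (Program.forLoop x y body) (s.setVar x 0) s' :=
          hs.weaken (by simp [Program.forLoop, Program.wvars])
            (by simp [Program.forLoop, Program.warrs])
            (by simp [Program.forLoop, Program.wrvars])
            (by simp [Program.forLoop, Program.wrarrs])
        exact (hfr.weaken (by simp [Program.forLoop, Program.wvars])
            (by simp [Program.forLoop, Program.warrs])
            (by simp [Program.forLoop, Program.wrvars])
            (by simp [Program.forLoop, Program.wrarrs])).trans this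
      · intro s2 hf2 hI2
        have h2 : s2.var x = i := by rw [hf2.var hx, hi]
        refine ⟨_, _, .assign s2 x _ ?_, le_rfl, r - 1, by omega, i + 1, ?_, by omega, ?_⟩
        · simp only [NExp.Fits]
          simp only [NExp.eval]
          omega
        · simp [NExp.eval, h2]
        · exact hI _ _ _ hI2
    · rintro s' hs ⟨⟨r, i, hi, hir, hI'⟩, hb⟩
      have hyN : s'.var y = N := by
        rw [hs.var (by simp [Program.wvars, hy, hxy])]
        simp [hxy, hN]
      simp only [Test.Holds, NExp.eval] at hb
      have : i = N := by omega
      exact this ▸ hI'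
  · have : (4 + (T + 4)) * N = (T + 8) * N := by ring
    omega

end RAM

/-! ### Graphs, flows and cuts -/

namespace ZeroExt

open Finset

/-- A finite undirected graph as it is kept in memory: each edge is a pair of opposite arcs, the
arcs are numbered `0, …, M - 1`, the arc `j` leads from `T j` to `H j`, and `rev j` is its reversal.
The arcs that leave a vertex `v` form a linked list in decreasing order, in which `0` stands for
the end and `j + 1` for the arc `j`; its first element is `first v`, and `next j` follows `j`.
Vertices without arcs play no role. -/
structure Net where
  n : ℕ
  M : ℕ
  T : ℕ → ℕ
  H : ℕ → ℕ
  rev : ℕ → ℕ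
  first : ℕ → ℕ
  next : ℕ → ℕ
  T_lt : ∀ {j}, j < M → T j < n
  rev_lt : ∀ {j}, j < M → rev j < M
  rev_rev : ∀ {j}, j < M → rev (rev j) = j
  T_rev : ∀ {j}, j < M → T (rev j) = H j
  H_rev : ∀ {j}, j < M → H (rev j) = T j
  first_le : ∀ v, first v ≤ M
  T_first : ∀ v, first v ≠ 0 → T (first v - 1) = v
  lt_first : ∀ {j}, j < M → j < first (T j)
  next_le : ∀ {j}, j < M → next j ≤ j
  T_next : ∀ {j}, j < M → next j ≠ 0 → T (next j - 1) = T j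
  lt_next : ∀ {j i}, j < M → i < j → T i = T j → i < next j

namespace Net

variable (G : Net)

/-- `v` is an endpoint of some edge. -/
def Vert (v : ℕ) : Prop := ∃ j < G.M, G.T j = v

variable {G}

theorem vert_T {j : ℕ} (h : j < G.M) : G.Vert (G.T j) := ⟨j, h, rfl⟩

theorem vert_H {j : ℕ} (h : j < G.M) : G.Vert (G.H j) := ⟨G.rev j, G.rev_lt h, G.T_rev h⟩

theorem Vert.lt {v : ℕ} (h : G.Vert v) : v < G.n := by
  obtain ⟨j, hj, rfl⟩ := h
  exact G.T_lt hj

theorem H_lt {j : ℕ} (h : j < G.M) : G.H j < G.n := (vert_H h).lt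

theorem sum_rev (g : ℕ → ℝ) : ∑ j ∈ range G.M, g (G.rev j) = ∑ j ∈ range G.M, g j := by
  refine Finset.sum_nbij' G.rev G.rev ?_ ?_ ?_ ?_ ?_ <;> intro j hj <;> rw [mem_range] at hj
  · exact mem_range.2 (G.rev_lt hj)
  · exact mem_range.2 (G.rev_lt hj)
  · exact G.rev_rev hj
  · exact G.rev_rev hj

variable (G)

open Classical in
/-- The number of arcs that enter the vertex set `C`. -/
noncomputable def bdry (C : ℕ → Prop) : ℕ :=
  ((range G.M).filter fun j => ¬ C (G.T j) ∧ C (G.H j)).card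

variable {G}

theorem bdry_congr {C C' : ℕ → Prop} (h : ∀ v, G.Vert v → (C v ↔ C' v)) :
    G.bdry C = G.bdry C' := by
  classical
  unfold bdry
  congr 1
  refine filter_congr fun j hj => ?_
  rw [mem_range] at hj
  rw [h _ (vert_T hj), h _ (vert_H hj)]

variable (G)

/-- The values of `f` are `0` and `1`, and no edge is used in both directions. -/
def IsUnit (f : ℕ → ℕ) : Prop :=
  ∀ j < G.M, f j ≤ 1 ∧ (f j = 1 → f (G.rev j) = 0)

/-- The pairing of a flow with the coboundary of a vertex function `y`. -/
noncomputable def pair (f : ℕ → ℕ) (y : ℕ → ℝ) : ℝ :=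
  ∑ j ∈ range G.M, (f j : ℝ) * (y (G.T j) - y (G.H j))

/-- `f` is an integral flow of value `val` in the graph with unit capacities, from the vertices
with a label other than `a` to the vertices of label `a`. Conservation and the value are expressed
by the pairing with potentials `y` that are constant on the sources and zero on the sinks. -/
structure IsFlow (L : ℕ → ℕ) (a : ℕ) (f : ℕ → ℕ) (val : ℕ) : Prop where
  unit : G.IsUnit f
  pair_eq : ∀ (α : ℝ) (y : ℕ → ℝ), (∀ v, G.Vert v → L v ≠ 0 → L v ≠ a → y v = α) →
    (∀ v, G.Vert v → L v = a → y v = 0) → G.pair f y = val * α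

variable {G}

theorem isFlow_zero {L f : ℕ → ℕ} {a : ℕ} (h : ∀ j < G.M, f j = 0) : G.IsFlow L a f 0 := by
  refine ⟨fun j hj => by simp [h j hj, h _ (G.rev_lt hj)], fun α y _ _ => ?_⟩
  rw [pair, Finset.sum_eq_zero]
  · simp
  · intro j hj
    simp [h j (mem_range.1 hj)]

/-- Sending one unit of flow along the arc `j`, which cancels flow along the reversal of `j` if
there is any. -/
def push (G : Net) (f : ℕ → ℕ) (j : ℕ) : ℕ → ℕ :=
  if f (G.rev j) = 1 then Function.update f (G.rev j) 0 else Function.update f j 1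

theorem push_of_ne {f : ℕ → ℕ} {j i : ℕ} (h : i ≠ j) (h' : i ≠ G.rev j) : G.push f j i = f i := by
  unfold push
  split_ifs <;> simp [h, h']

theorem IsUnit.push {f : ℕ → ℕ} {j : ℕ} (hf : G.IsUnit f) (hj : j < G.M) (h0 : f j = 0)
    (hne : G.T j ≠ G.H j) : G.IsUnit (G.push f j) := by
  have hr : G.rev j ≠ j := fun h => hne (by rw [← G.T_rev hj, h])
  intro i hi
  unfold Net.push
  split_ifs with h1
  · have h3 : ∀ i, Function.update f (G.rev j) 0 i ≤ f i := fun i => by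
      rw [Function.update_apply]
      split_ifs <;> simp
    refine ⟨(h3 i).trans (hf i hi).1, fun h => ?_⟩
    have h4 := h3 i
    have h5 := (hf i hi).1
    have h6 := (hf i hi).2 (by omega)
    have h7 := h3 (G.rev i)
    omega
  · have h2 : f (G.rev j) = 0 := by
      have := (hf _ (G.rev_lt hj)).1
      omega
    by_cases hij : i = j
    · subst hij
      simp [hr, h2]
    · rw [Function.update_of_ne hij]
      refine ⟨(hf i hi).1, fun h => ?_⟩
      have hij' : G.rev i ≠ j := by
        rintro rfl
        rw [G.rev_rev hi] at h2
        omega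
      rw [Function.update_of_ne hij']
      exact (hf i hi).2 h

theorem pair_push {f : ℕ → ℕ} {j : ℕ} (hj : j < G.M) (h0 : f j = 0) (y : ℕ → ℝ) :
    G.pair (G.push f j) y = G.pair f y + (y (G.T j) - y (G.H j)) := by
  have key : ∀ i < G.M, ∀ c : ℕ, G.pair (Function.update f i c) y =
      G.pair f y + ((c : ℝ) - f i) * (y (G.T i) - y (G.H i)) := by
    intro i hi c
    unfold pair
    rw [← Finset.add_sum_erase _ _ (mem_range.2 hi),
      ← Finset.add_sum_erase (range G.M) (fun j => (f j : ℝ) * (y (G.T j) - y (G.H j)))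
        (mem_range.2 hi)]
    have : ∑ x ∈ (range G.M).erase i, ((Function.update f i c x : ℕ) : ℝ) * (y (G.T x) - y (G.H x))
        = ∑ x ∈ (range G.M).erase i, (f x : ℝ) * (y (G.T x) - y (G.H x)) := by
      refine Finset.sum_congr rfl fun x hx => ?_
      rw [Function.update_of_ne (ne_of_mem_erase hx)]
    rw [this]
    simp only [Function.update_self]
    ring
  unfold push
  split_ifs with h
  · rw [key _ (G.rev_lt hj), h, G.T_rev hj, G.H_rev hj]
    push_cast
    ring
  · rw [key _ hj, h0]
    push_cast
    ring

/-- If `y` is the indicator function of the complement of `C`, then an arc that enters `C` counts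
positively and one that leaves `C` negatively. -/
theorem IsFlow.val_add_card_le {L f : ℕ → ℕ} {a val : ℕ} {C : ℕ → Prop} (hf : G.IsFlow L a f val)
    (h1 : ∀ v, G.Vert v → L v = a → C v) (h2 : ∀ v, G.Vert v → L v ≠ 0 → L v ≠ a → ¬ C v) :
    val ≤ G.bdry C ∧ ((∃ j < G.M, f j = 0 ∧ ¬ C (G.T j) ∧ C (G.H j)) → val < G.bdry C) ∧
      ((∀ j < G.M, ¬ C (G.T j) → C (G.H j) → f j = 1) → G.bdry C = val) := by
  classical
  have hp := hf.pair_eq 1 (fun v => if C v then 0 else 1) (fun v hv h h' => by simp [h2 v hv h h'])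
    (fun v hv h => by simp [h1 v hv h])
  rw [mul_one, pair] at hp
  have hb : (G.bdry C : ℝ) = ∑ j ∈ range G.M, if ¬ C (G.T j) ∧ C (G.H j) then (1 : ℝ) else 0 := by
    simp [bdry]
  have hle : ∀ j ∈ range G.M, (f j : ℝ) * ((if C (G.T j) then 0 else 1) -
      (if C (G.H j) then 0 else 1)) ≤ if ¬ C (G.T j) ∧ C (G.H j) then (1 : ℝ) else 0 := by
    intro j hj
    have h3 : (f j : ℝ) ≤ 1 := by exact_mod_cast (hf.unit j (mem_range.1 hj)).1
    by_cases hT : C (G.T j) <;> by_cases hH : C (G.H j) <;> simp [hT, hH, h3]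
  refine ⟨?_, ?_, ?_⟩
  · have := Finset.sum_le_sum hle
    rw [hp, ← hb] at this
    exact_mod_cast this
  · rintro ⟨j, hj, hj0, hT, hH⟩
    have := Finset.sum_lt_sum hle ⟨j, mem_range.2 hj, by simp [hj0, hT, hH]⟩
    rw [hp, ← hb] at this
    exact_mod_cast this
  · intro h
    have : (G.bdry C : ℝ) = val := by
      rw [hb, ← hp]
      refine Finset.sum_congr rfl fun j hj => ?_
      rw [mem_range] at hj
      by_cases hT : C (G.T j) <;> by_cases hH : C (G.H j) <;> simp [hT, hH]
      · -- An arc that leaves `C` carries no flow, as its reversal enters `C`.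
        have := h _ (G.rev_lt hj) (by rwa [G.T_rev hj]) (by rwa [G.H_rev hj])
        have := (hf.unit _ (G.rev_lt hj)).2 this
        rwa [G.rev_rev hj] at this
      · rw [h j hj hT hH]
        simp
    exact_mod_cast this

/-! ### Residual search -/

/-- The reason for which the search has marked the vertex `v`: it is a source, or it has been
reached along a residual arc from a vertex with a smaller number `pos`. Marks are inherited from
the source. -/
def Reason (G : Net) (L : ℕ → ℕ) (a : ℕ) (f mark par pos : ℕ → ℕ) (v : ℕ) : Prop :=
  (par v = 0 ∧ L v ≠ 0 ∧ L v ≠ a ∧ mark v = L v) ∨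
    ∃ j < G.M, par v = j + 1 ∧ f j = 0 ∧ G.H j = v ∧ mark (G.T j) = mark v ∧
      pos (G.T j) < pos v

/-- The marked vertices are those that can be reached in the residual graph of `f` from the vertices
with a label other than `a`. -/
structure Reach (G : Net) (L : ℕ → ℕ) (a : ℕ) (f mark par pos : ℕ → ℕ) : Prop where
  source : ∀ v, G.Vert v → L v ≠ 0 → L v ≠ a → mark v = L v
  closed : ∀ j < G.M, mark (G.T j) ≠ 0 → f j = 0 → mark (G.H j) ≠ 0
  reason : ∀ v, G.Vert v → mark v ≠ 0 → G.Reason L a f mark par pos v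

/-- A set that contains the sources but not all marked vertices is left by a residual arc. -/
theorem Reach.exists_residual {L f mark par pos : ℕ → ℕ} {a : ℕ}
    (h : G.Reach L a f mark par pos) {C : ℕ → Prop}
    (hC : ∀ v, G.Vert v → L v ≠ 0 → L v ≠ a → ¬ C v) {v : ℕ} (hv : G.Vert v) (hvC : C v)
    (hm : mark v ≠ 0) : ∃ j < G.M, f j = 0 ∧ ¬ C (G.T j) ∧ C (G.H j) := by
  induction hp : pos v using Nat.strong_induction_on generalizing v with
  | _ p ih =>
    rcases h.reason v hv hm with ⟨-, h1, h2, -⟩ | ⟨j, hj, -, hf, rfl, hmk, hlt⟩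
    · exact (hC v hv h1 h2 hvC).elim
    · by_cases hT : C (G.T j)
      · exact ih _ (hp ▸ hlt) (vert_T hj) hT (hmk ▸ hm) rfl
      · exact ⟨j, hj, hf, hT, hvC⟩

/-- No search marks a vertex with a label that some solution does not give to it, if the solution
has no crossing edges. -/
theorem Reach.mark_eq {L f mark par pos lab : ℕ → ℕ} {a : ℕ} (h : G.Reach L a f mark par pos)
    (hlab : ∀ v, G.Vert v → L v ≠ 0 → lab v = L v)
    (hcross : ∀ j < G.M, lab (G.T j) = lab (G.H j)) {v : ℕ} (hv : G.Vert v) (hm : mark v ≠ 0) :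
    mark v = lab v := by
  induction hp : pos v using Nat.strong_induction_on generalizing v with
  | _ p ih =>
    rcases h.reason v hv hm with ⟨-, h1, h2, h3⟩ | ⟨j, hj, -, hf, rfl, hmk, hlt⟩
    · rw [h3, hlab v hv h1]
    · rw [← hcross j hj, ← hmk]
      exact ih _ (hp ▸ hlt) (vert_T hj) (hmk ▸ hm) rfl

/-! ### Persistence -/

/-- The result of relabelling the unmarked vertices to `a`. -/
def relabel (mark : ℕ → ℕ) (a : ℕ) (L : ℕ → ℕ) (v : ℕ) : ℕ := if mark v = 0 then a else L v

/-- The label class of `a` is the unique smallest cut that separates it from the other labels, up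
to vertices without edges, among the sets that contain the class. -/
def Normal (G : Net) (L : ℕ → ℕ) (a : ℕ) : Prop :=
  ∀ C : ℕ → Prop, (∀ v, G.Vert v → L v = a → C v) →
    (∀ v, G.Vert v → L v ≠ 0 → L v ≠ a → ¬ C v) → (∃ v, G.Vert v ∧ C v ∧ L v ≠ a) →
    G.bdry (fun v => L v = a) < G.bdry C

section Persistence

variable {L f mark par pos : ℕ → ℕ} {a val : ℕ}

/-- The core of the algorithm: if no sink is reachable in the residual graph, then relabelling all
unreachable vertices to `a` does not increase the cost of a labelling, for any metric. With `y`
the distance to `a` on the unreachable vertices and zero elsewhere, the relabelling of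
an edge is paid for by the flow on the edge times the difference of `y`, and these terms cancel,
since the flow is conserved. -/
theorem Reach.sum_relabel_le (ha : a ≠ 0) (h : G.Reach L a f mark par pos)
    (hf : G.IsFlow L a f val) {lab : ℕ → ℕ}
    (hlab : ∀ v, G.Vert v → L v ≠ 0 → lab v = L v) {μ : ℕ → ℕ → ℝ} (hμ : IsMetricCost μ) :
    ∑ j ∈ range G.M, μ (relabel mark a lab (G.T j)) (relabel mark a lab (G.H j)) ≤
      ∑ j ∈ range G.M, μ (lab (G.T j)) (lab (G.H j)) := by
  set y : ℕ → ℝ := fun v => if mark v = 0 then μ a (lab v) else 0 with hy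
  have hp := hf.pair_eq 0 y
    (fun v hv h1 h2 => by simp [hy, h.source v hv h1 h2, h1])
    (fun v hv h1 => by simp [hy, hlab v hv (by rwa [h1]), h1, hμ.diag])
  rw [mul_zero, pair] at hp
  have hp' := G.sum_rev fun j => (f j : ℝ) * (y (G.T j) - y (G.H j))
  rw [hp] at hp'
  have key : ∀ j ∈ range G.M,
      μ (relabel mark a lab (G.T j)) (relabel mark a lab (G.H j)) ≤ μ (lab (G.T j)) (lab (G.H j))
        - ((f j : ℝ) * (y (G.T j) - y (G.H j)) +
          (f (G.rev j) : ℝ) * (y (G.T (G.rev j)) - y (G.H (G.rev j)))) := by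
    intro j hj
    rw [mem_range] at hj
    rw [G.T_rev hj, G.H_rev hj]
    have hu := hf.unit j hj
    have hu' := hf.unit _ (G.rev_lt hj)
    rw [G.rev_rev hj] at hu'
    have hc := h.closed j hj
    have hc' := h.closed _ (G.rev_lt hj)
    rw [G.T_rev hj, G.H_rev hj] at hc'
    have t1 := hμ.triangle a (lab (G.T j)) (lab (G.H j))
    have t2 := hμ.triangle a (lab (G.H j)) (lab (G.T j))
    rw [hμ.symm (lab (G.H j)) (lab (G.T j))] at t2
    by_cases hT : mark (G.T j) = 0 <;> by_cases hH : mark (G.H j) = 0 <;>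
      simp only [relabel, hy, hT, hH, if_true, if_false]
    · rw [hμ.diag]
      have h1 : f j = 0 ∨ f j = 1 := by omega
      have h2 : f (G.rev j) = 0 ∨ f (G.rev j) = 1 := by omega
      have h0 := hμ.nonneg (lab (G.T j)) (lab (G.H j))
      rcases h1 with h1 | h1 <;> rcases h2 with h2 | h2 <;> simp only [h1, h2] <;> push_cast <;>
        linarith
    · have h2 : f (G.rev j) = 1 := by
        by_contra h3
        exact hc' hH (by omega) hT
      simp only [h2, hu'.2 h2]
      push_cast
      linarith
    · have h2 : f j = 1 := by
        by_contra h3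
        exact hc hT (by omega) hH
      simp only [h2, hu.2 h2]
      rw [hμ.symm _ a]
      push_cast
      linarith
    · simp
  have := Finset.sum_le_sum key
  rw [Finset.sum_sub_distrib, Finset.sum_add_distrib, hp, hp'] at this
  simpa using this

theorem relabel_eq_iff
    (hsink : ∀ v, G.Vert v → L v = a → mark v = 0) {v : ℕ} (hv : G.Vert v) :
    relabel mark a L v = a ↔ mark v = 0 := by
  unfold relabel
  split_ifs with h1
  · simp [h1]
  · exact ⟨fun h2 => hsink v hv h2, fun h2 => (h1 h2).elim⟩

/-- After the relabelling, the label class of `a` is normal: its boundary is saturated, while every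
larger set is entered by a residual arc as well. -/
theorem Reach.normal_relabel (h : G.Reach L a f mark par pos)
    (hf : G.IsFlow L a f val) (hsink : ∀ v, G.Vert v → L v = a → mark v = 0) :
    G.Normal (relabel mark a L) a := by
  have hC : G.bdry (fun v => relabel mark a L v = a) = val := by
    rw [G.bdry_congr (C' := fun v => mark v = 0) fun v hv => relabel_eq_iff hsink hv]
    refine (hf.val_add_card_le (C := fun v => mark v = 0) hsink ?_).2.2 ?_
    · intro v hv h1 h2
      rwa [h.source v hv h1 h2]
    · intro j hj hT hH
      by_contra h3
      have := (hf.unit j hj).1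
      exact h.closed j hj hT (by omega) hH
  intro C h1 h2 ⟨v, hv, hvC, hva⟩
  rw [hC]
  have hm : mark v ≠ 0 := fun h3 => hva ((relabel_eq_iff hsink hv).2 h3)
  have h2' : ∀ v, G.Vert v → L v ≠ 0 → L v ≠ a → ¬ C v := by
    intro w hw h3 h4
    have : relabel mark a L w = L w := by
      unfold relabel
      rw [if_neg]
      rwa [h.source w hw h3 h4]
    exact h2 w hw (by rwa [this]) (by rwa [this])
  refine (hf.val_add_card_le (C := C) ?_ h2').2.1 (h.exists_residual h2' hv hvC hm)
  intro w hw h3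
  exact h1 w hw ((relabel_eq_iff hsink hw).2 (hsink w hw h3))

end Persistence

/-! ### Solutions and the progress of the search -/

/-- `lab` extends the partial labelling `L`, in which `0` means unlabelled. -/
def Ext (G : Net) (L lab : ℕ → ℕ) : Prop := ∀ v, G.Vert v → L v ≠ 0 → lab v = L v

theorem Ext.trans {L L' L'' : ℕ → ℕ} (h : G.Ext L L') (h' : G.Ext L' L'') : G.Ext L L'' :=
  fun v hv hL => by rw [h' v hv (by rwa [h v hv hL]), h v hv hL]

theorem Ext.refl (L : ℕ → ℕ) : G.Ext L L := fun _ _ _ => rfl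

/-- `lab` is a labelling by `1, …, d` with at most `K` crossing arcs and cost at most `q`, where
both arcs of an edge count. -/
structure Sol (G : Net) (d : ℕ) (μ : ℕ → ℕ → ℝ) (K : ℕ) (q : ℝ) (lab : ℕ → ℕ) : Prop where
  range : ∀ v, 1 ≤ lab v ∧ lab v ≤ d
  crossing : ∑ j ∈ Finset.range G.M, (if lab (G.T j) = lab (G.H j) then 0 else 1) ≤ K
  cost : ∑ j ∈ Finset.range G.M, μ (lab (G.T j)) (lab (G.H j)) ≤ q

theorem isMetricCost_discrete : IsMetricCost fun a b : ℕ => if a = b then (0 : ℝ) else 1 where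
  nonneg a b := by split_ifs <;> simp
  symm a b := by simp [eq_comm]
  diag a := by simp
  triangle a b c := by
    by_cases h : a = b
    · simp [h]
    · by_cases h' : b = c
      · simp [h']
      · simp only [h, h', if_false]
        split_ifs <;> norm_num

theorem Sol.relabel {L f mark par pos : ℕ → ℕ} {a val d K : ℕ} {μ : ℕ → ℕ → ℝ} {q : ℝ}
    {lab : ℕ → ℕ} (hs : G.Sol d μ K q lab) (hμ : IsMetricCost μ) (hL : G.Ext L lab)
    (ha : a ≠ 0) (had : a ≤ d) (h : G.Reach L a f mark par pos) (hf : G.IsFlow L a f val) :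
    G.Sol d μ K q (Net.relabel mark a lab) ∧
      G.Ext (Net.relabel mark a L) (Net.relabel mark a lab) := by
  refine ⟨⟨fun v => ?_, ?_, (h.sum_relabel_le ha hf hL hμ).trans hs.cost⟩, ?_⟩
  · unfold Net.relabel
    split_ifs
    · omega
    · exact hs.range v
  · have h1 := h.sum_relabel_le ha hf hL isMetricCost_discrete
    have h2 : (((∑ j ∈ Finset.range G.M, if Net.relabel mark a lab (G.T j) =
        Net.relabel mark a lab (G.H j) then 0 else 1 : ℕ)) : ℝ) ≤
        ((∑ j ∈ Finset.range G.M, if lab (G.T j) = lab (G.H j) then 0 else 1 : ℕ) : ℝ) := by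
      push_cast
      exact h1
    exact (Nat.cast_le.1 h2).trans hs.crossing
  · intro v hv h1
    unfold Net.relabel at h1 ⊢
    split_ifs with h2
    · rfl
    · exact hL v hv (by simpa [h2] using h1)

/-- Every crossing arc enters exactly one label class. -/
theorem Sol.sum_bdry_le {d K : ℕ} {μ : ℕ → ℕ → ℝ} {q : ℝ} {lab : ℕ → ℕ}
    (hs : G.Sol d μ K q lab) : ∑ a ∈ Icc 1 d, G.bdry (fun v => lab v = a) ≤ K := by
  classical
  refine le_trans (le_of_eq ?_) hs.crossing
  simp only [bdry, Finset.card_filter]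
  rw [Finset.sum_comm]
  refine Finset.sum_congr rfl fun j _ => ?_
  rw [Finset.sum_eq_single (lab (G.H j))]
  · simp [ite_not]
  · intro b _ hb
    simp [hb.symm]
  · intro h
    exact (h (mem_Icc.2 (hs.range _))).elim

theorem Sol.flow_le {d K : ℕ} {μ : ℕ → ℕ → ℝ} {q : ℝ} {L lab f : ℕ → ℕ} {a val : ℕ}
    (hs : G.Sol d μ K q lab) (hL : G.Ext L lab) (ha : a ≠ 0) (had : a ≤ d)
    (hf : G.IsFlow L a f val) : val ≤ K := by
  refine (hf.val_add_card_le (C := fun v => lab v = a) ?_ ?_).1.trans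
    (le_trans ?_ hs.sum_bdry_le)
  · intro v hv h
    rw [hL v hv (by rwa [h]), h]
  · intro v hv h1 h2
    rwa [hL v hv h1]
  · exact Finset.single_le_sum (f := fun a => G.bdry fun v => lab v = a)
      (fun _ _ => Nat.zero_le _) (mem_Icc.2 ⟨by omega, had⟩)

theorem Normal.of_ext {L L' : ℕ → ℕ} {a : ℕ} (h : G.Normal L a) (hL : G.Ext L L')
    (ha : ∀ v, G.Vert v → (L' v = a ↔ L v = a)) : G.Normal L' a := by
  intro C h1 h2 ⟨v, hv, hvC, hva⟩
  rw [G.bdry_congr ha]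
  refine h C (fun w hw h3 => h1 w hw ((ha w hw).2 h3)) (fun w hw h3 h4 => ?_)
    ⟨v, hv, hvC, fun h3 => hva ((ha v hv).2 h3)⟩
  have := hL w hw h3
  exact h2 w hw (by rwa [this]) (by rwa [this])

/-- The potential that bounds the depth of the search: the sum of the boundaries of the label
classes. -/
noncomputable def potential (G : Net) (d : ℕ) (L : ℕ → ℕ) : ℕ :=
  ∑ a ∈ Icc 1 d, G.bdry (fun v => L v = a)

/-- Extending a normal labelling increases the potential strictly, if some new vertex with an edge
is labelled. -/
theorem potential_lt {d : ℕ} {L L' : ℕ → ℕ} (h : ∀ a ∈ Icc 1 d, G.Normal L a) (hL : G.Ext L L')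
    {v : ℕ} (hv : G.Vert v) (hLv : L v = 0) (hv1 : 1 ≤ L' v) (hvd : L' v ≤ d) :
    G.potential d L < G.potential d L' := by
  have key : ∀ a ∈ Icc 1 d, (∀ v, G.Vert v → (L' v = a ↔ L v = a)) ∨
      G.bdry (fun v => L v = a) < G.bdry (fun v => L' v = a) := by
    intro a ha
    have ha' := mem_Icc.1 ha
    by_cases hex : ∃ v, G.Vert v ∧ L' v = a ∧ L v ≠ a
    · right
      refine h a ha _ (fun w hw h1 => ?_) (fun w hw h1 h2 => ?_) hex
      · rw [hL w hw (by omega), h1]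
      · rwa [hL w hw h1]
    · left
      push Not at hex
      intro w hw
      refine ⟨hex w hw, fun h1 => ?_⟩
      rw [hL w hw (by omega), h1]
  refine Finset.sum_lt_sum (fun a ha => ?_) ⟨L' v, mem_Icc.2 ⟨hv1, hvd⟩, ?_⟩
  · rcases key a ha with h1 | h1
    · exact (G.bdry_congr h1).ge
    · exact h1.le
  · rcases key _ (mem_Icc.2 ⟨hv1, hvd⟩) with h1 | h1
    · have := (h1 v hv).1 rfl
      omega
    · exact h1

end Net

end ZeroExt

/-! ### The invariants of the residual search -/

namespace ZeroExt

open Finset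

namespace Net

/-- The state of the queue `q` of the residual search: its first `tail` entries are the marked
vertices, `pos` is the inverse of `q`, and `Y` contains the unmarked vertices. -/
structure Queue (G : Net) (L : ℕ → ℕ) (a : ℕ) (f : ℕ → ℕ) (d : ℕ) (mark par pos q : ℕ → ℕ)
    (tail : ℕ) (Y : Finset ℕ) : Prop where
  mem : ∀ i < tail, G.Vert (q i) ∧ mark (q i) ≠ 0 ∧ pos (q i) = i
  marked : ∀ v, G.Vert v → mark v ≠ 0 →
    pos v < tail ∧ q (pos v) = v ∧ mark v ≤ d ∧ G.Reason L a f mark par pos v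
  unmarked : ∀ v, G.Vert v → mark v = 0 → v ∈ Y
  card : tail + Y.card ≤ G.M

/-- The progress of the residual search: the first `head` vertices of the queue have been taken
from it, the arcs of the last of them are being scanned with the list cursor `c`, and `U` contains
all arcs that have not been scanned. -/
structure Scan (G : Net) (f mark pos : ℕ → ℕ) (head tail c : ℕ) (U : Finset ℕ) : Prop where
  head_le : head ≤ tail
  c_le : c ≤ G.M
  cur : c ≠ 0 → mark (G.T (c - 1)) ≠ 0 ∧ pos (G.T (c - 1)) < head
  rest : ∀ j < c, G.T j = G.T (c - 1) → j ∈ U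
  fresh : ∀ j < G.M, (mark (G.T j) = 0 ∨ head ≤ pos (G.T j)) → j ∈ U
  done : ∀ j < G.M, mark (G.T j) ≠ 0 → pos (G.T j) < head → f j = 0 →
    mark (G.H j) ≠ 0 ∨ (j < c ∧ G.T j = G.T (c - 1))

variable {G : Net} {L f mark par pos q : ℕ → ℕ} {a d head tail c : ℕ} {U Y : Finset ℕ}

theorem queue_empty (h : ∀ v, G.Vert v → mark v = 0) :
    G.Queue L a f d mark par pos q 0 (image G.T (range G.M)) where
  mem i hi := (Nat.not_lt_zero i hi).elim
  marked v hv hm := (hm (h v hv)).elim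
  unmarked v hv _ := by
    obtain ⟨j, hj, rfl⟩ := hv
    exact mem_image_of_mem _ (mem_range.2 hj)
  card := by simpa using card_image_le (s := range G.M) (f := G.T)

theorem Queue.enqueue (h : G.Queue L a f d mark par pos q tail Y) {w x p : ℕ} (hw : G.Vert w)
    (hm : mark w = 0) (hx : x ≠ 0) (hxd : x ≤ d)
    (hr : (p = 0 ∧ L w ≠ 0 ∧ L w ≠ a ∧ x = L w) ∨
      ∃ j < G.M, p = j + 1 ∧ f j = 0 ∧ G.H j = w ∧ mark (G.T j) = x) :
    G.Queue L a f d (Function.update mark w x) (Function.update par w p)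
      (Function.update pos w tail) (Function.update q tail w) (tail + 1) (Y.erase w) where
  mem i hi := by
    by_cases hit : i = tail
    · subst hit
      simp [hw, hx]
    · have h1 := h.mem i (by omega)
      have h2 : q i ≠ w := fun h2 => h1.2.1 (h2 ▸ hm)
      simpa [hit, h2] using h1
  marked v hv hmv := by
    by_cases hvw : v = w
    · subst hvw
      refine ⟨by simp, by simp, by simpa using hxd, ?_⟩
      rcases hr with ⟨h1, h2, h3, h4⟩ | ⟨j, hj, h1, h2, h3, h4⟩
      · exact Or.inl ⟨by simpa using h1, h2, h3, by simpa using h4⟩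
      · have h5 : G.T j ≠ v := fun h5 => hx (by rw [← h4, h5, hm])
        refine Or.inr ⟨j, hj, by simpa using h1, h2, h3, by simpa [h5] using h4, ?_⟩
        simpa [h5] using (h.marked _ (vert_T hj) (h4 ▸ hx)).1
    · rw [Function.update_of_ne hvw] at hmv
      obtain ⟨h1, h2, h3, h4⟩ := h.marked v hv hmv
      refine ⟨by simp [hvw]; omega, ?_, by simpa [hvw] using h3, ?_⟩
      · rw [Function.update_of_ne hvw, Function.update_of_ne (by omega), h2]
      · rcases h4 with ⟨h5, h6, h7, h8⟩ | ⟨j, hj, h5, h6, h7, h8, h9⟩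
        · exact Or.inl ⟨by simpa [hvw] using h5, h6, h7, by simpa [hvw] using h8⟩
        · have h10 : G.T j ≠ w := fun h10 => hmv (by rw [← h8, h10, hm])
          exact Or.inr ⟨j, hj, by simpa [hvw] using h5, h6, h7, by simpa [hvw, h10] using h8,
            by simpa [hvw, h10] using h9⟩
  unmarked v hv hmv := by
    have hvw : v ≠ w := by
      rintro rfl
      exact hx (by simpa using hmv)
    rw [Function.update_of_ne hvw] at hmv
    exact mem_erase.2 ⟨hvw, h.unmarked v hv hmv⟩
  card := by
    have h1 := h.card
    have h2 := card_erase_add_one (h.unmarked w hw hm)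
    omega

theorem scan_start : G.Scan f mark pos 0 tail 0 (range G.M) where
  head_le := Nat.zero_le _
  c_le := Nat.zero_le _
  cur h := (h rfl).elim
  rest j hj := (Nat.not_lt_zero j hj).elim
  fresh _ hj _ := mem_range.2 hj
  done _ _ _ h := (Nat.not_lt_zero _ h).elim

theorem Scan.pop (h : G.Scan f mark pos head tail 0 U)
    (hq : G.Queue L a f d mark par pos q tail Y) (hh : head < tail) :
    G.Scan f mark pos (head + 1) tail (G.first (q head)) U := by
  obtain ⟨h1, h2, h3⟩ := hq.mem head hh
  have h4 : G.first (q head) ≠ 0 := by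
    obtain ⟨j, hj, hj'⟩ := h1
    have := G.lt_first hj
    rw [hj'] at this
    omega
  have h5 := G.T_first _ h4
  refine ⟨hh, G.first_le _, fun _ => ?_, fun j hj hT => ?_, fun j hj hT => ?_,
    fun j hj hT hp hf => ?_⟩
  · rw [h5]
    exact ⟨h2, by omega⟩
  · have := G.first_le (q head)
    refine h.fresh j (by omega) (Or.inr ?_)
    rw [hT, h5, h3]
  · refine h.fresh j hj (hT.imp_right fun _ => by omega)
  · by_cases hp' : pos (G.T j) < head
    · rcases h.done j hj hT hp' hf with h6 | h6
      · exact Or.inl h6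
      · exact (Nat.not_lt_zero j h6.1).elim
    · have h6 := (hq.marked _ (vert_T hj) hT).2.1
      have h7 : pos (G.T j) = head := by omega
      rw [h7] at h6
      refine Or.inr ⟨?_, ?_⟩
      · rw [h6]
        exact G.lt_first hj
      · rw [h5, h6]

theorem Scan.enqueue (h : G.Scan f mark pos head tail c U) {w x : ℕ} (hm : mark w = 0)
    (hx : x ≠ 0) :
    G.Scan f (Function.update mark w x) (Function.update pos w tail) head (tail + 1) c U := by
  refine ⟨h.head_le.trans (Nat.le_succ _), h.c_le, fun hc => ?_, h.rest, fun j hj hT => ?_,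
    fun j hj hT hp hf => ?_⟩
  · obtain ⟨h1, h2⟩ := h.cur hc
    have h3 : G.T (c - 1) ≠ w := fun h3 => h1 (h3 ▸ hm)
    simpa [h3] using And.intro h1 h2
  · by_cases hw : G.T j = w
    · exact h.fresh j hj (Or.inl (hw ▸ hm))
    · exact h.fresh j hj (by simpa [hw] using hT)
  · by_cases hw : G.T j = w
    · rw [hw] at hp
      have := h.head_le
      simp at hp
      omega
    · rw [Function.update_of_ne hw] at hT hp
      refine (h.done j hj hT hp hf).imp_left fun h1 => ?_
      rw [Function.update_apply]
      split_ifs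
      · exact hx
      · exact h1

theorem Scan.advance (h : G.Scan f mark pos head tail c U) (hc : c ≠ 0)
    (hf : f (c - 1) = 0 → mark (G.H (c - 1)) ≠ 0) :
    G.Scan f mark pos head tail (G.next (c - 1)) (U.erase (c - 1)) := by
  have hcM : c - 1 < G.M := by have := h.c_le; omega
  have hnext := G.next_le hcM
  have hT := G.T_next hcM
  obtain ⟨h1, h2⟩ := h.cur hc
  refine ⟨h.head_le, by omega, fun h3 => by rw [hT h3]; exact ⟨h1, h2⟩, fun j hj h3 => ?_,
    fun j hj h3 => ?_, fun j hj h3 h4 h5 => ?_⟩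
  · rw [hT (by omega)] at h3
    exact mem_erase.2 ⟨by omega, h.rest j (by omega) h3⟩
  · refine mem_erase.2 ⟨?_, h.fresh j hj h3⟩
    rintro rfl
    omega
  · rcases h.done j hj h3 h4 h5 with h6 | ⟨h6, h7⟩
    · exact Or.inl h6
    · by_cases hjc : j = c - 1
      · subst hjc
        exact Or.inl (hf h5)
      · have := G.lt_next hcM (i := j) (by omega) h7
        exact Or.inr ⟨this, by rw [hT (by omega), h7]⟩

/-- The result of the residual search. -/
structure Searched (G : Net) (L : ℕ → ℕ) (a : ℕ) (f : ℕ → ℕ) (d : ℕ) (mark par pos : ℕ → ℕ) :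
    Prop extends G.Reach L a f mark par pos where
  mark_le : ∀ v, G.Vert v → mark v ≤ d
  pos_lt : ∀ v, G.Vert v → mark v ≠ 0 → pos v < G.M

theorem Scan.searched (h : G.Scan f mark pos tail tail 0 U)
    (hq : G.Queue L a f d mark par pos q tail Y)
    (hs : ∀ v, G.Vert v → L v ≠ 0 → L v ≠ a → mark v = L v) :
    G.Searched L a f d mark par pos where
  source := hs
  closed j hj hm hf := by
    rcases h.done j hj hm (hq.marked _ (vert_T hj) hm).1 hf with h1 | h1
    · exact h1
    · exact (Nat.not_lt_zero j h1.1).elim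
  reason v hv hm := (hq.marked v hv hm).2.2.2
  mark_le v hv := by
    by_cases hm : mark v = 0
    · simp [hm]
    · exact (hq.marked v hv hm).2.2.1
  pos_lt v hv hm := (hq.marked v hv hm).1.trans_le (by have := hq.card; omega)

theorem Searched.par_le (h : G.Searched L a f d mark par pos) {v : ℕ} (hv : G.Vert v)
    (hm : mark v ≠ 0) : par v ≤ G.M := by
  rcases h.reason v hv hm with ⟨h1, -⟩ | ⟨j, hj, h1, -⟩ <;> omega

/-- The invariant of the augmentation, which follows the search tree from the sink `b` back to a
source and has got to `v`: the flow `f'` has been changed only along arcs with an end behind `v`. -/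
structure Augment (G : Net) (f mark pos : ℕ → ℕ) (b : ℕ) (f' : ℕ → ℕ) (v : ℕ) : Prop where
  vert : G.Vert v
  mark_ne : mark v ≠ 0
  unit : G.IsUnit f'
  pair : ∀ y, G.pair f' y = G.pair f y + (y v - y b)
  same : ∀ j < G.M, mark (G.T j) ≠ 0 → mark (G.H j) ≠ 0 → pos (G.T j) ≤ pos v →
    pos (G.H j) ≤ pos v → f' j = f j

theorem Augment.step {f' : ℕ → ℕ} {v b : ℕ} (h : G.Augment f mark pos b f' v)
    (hs : G.Searched L a f d mark par pos) (hp : par v ≠ 0) :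
    par v - 1 < G.M ∧ pos (G.T (par v - 1)) < pos v ∧
      G.Augment f mark pos b (G.push f' (par v - 1)) (G.T (par v - 1)) := by
  rcases hs.reason v h.vert h.mark_ne with ⟨h1, -⟩ | ⟨j, hj, h1, h2, h3, h4, h5⟩
  · exact (hp h1).elim
  · rw [h1, Nat.add_sub_cancel]
    have hT : mark (G.T j) ≠ 0 := by rw [h4]; exact h.mark_ne
    have hf' : f' j = 0 := by
      rw [h.same j hj hT (by rw [h3]; exact h.mark_ne) h5.le (by rw [h3]), h2]
    have hne : G.T j ≠ G.H j := by
      intro h6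
      rw [h6, h3] at h5
      exact lt_irrefl _ h5
    refine ⟨hj, h5, vert_T hj, hT, h.unit.push hj hf' hne, fun y => ?_,
      fun i hi h6 h7 h8 h9 => ?_⟩
    · rw [pair_push hj hf', h.pair, h3]
      ring
    · rw [push_of_ne]
      · exact h.same i hi h6 h7 (by omega) (by omega)
      · rintro rfl
        rw [h3] at h9
        omega
      · rintro rfl
        rw [G.T_rev hj, h3] at h8
        omega

theorem Augment.isFlow {f' : ℕ → ℕ} {v b val : ℕ} (h : G.Augment f mark pos b f' v)
    (hs : G.Searched L a f d mark par pos) (hf : G.IsFlow L a f val) (hb : G.Vert b)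
    (hba : L b = a) (hp : par v = 0) : G.IsFlow L a f' (val + 1) := by
  refine ⟨h.unit, fun α y h1 h2 => ?_⟩
  rw [h.pair, hf.pair_eq α y h1 h2, h2 b hb hba]
  rcases hs.reason v h.vert h.mark_ne with ⟨-, h3, h4, -⟩ | ⟨j, hj, h3, -⟩
  · rw [h1 v h.vert h3 h4]
    push_cast
    ring
  · omega

end Net

end ZeroExt

/-! ### The program for expanding a label class -/

namespace ZeroExt

open RAM RAM.Program

infixr:60 " ;; " => RAM.Program.seq

/-- The number constant `c`. -/
abbrev lit (c : ℕ) : NExp := .const c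

/-- The variable `x`. The variables `0, …, 3` hold `n, m, d, k`, and `4` the answer. The others
hold: `5` the number `2 * m` of arcs, `6` the current label `a`, `7` the number `2 * k`, `8` the
counter of loops over arcs, `9` the list cursor, `10` and `11` the head and the tail of the queue,
`12` a vertex, `13` a flag, `14` a counter, `15` the depth of the search stack, `16` the counter of
loops over labels, `17` an arc. -/
abbrev vr (x : ℕ) : NExp := .var x

/-- The arrays `0` and `1` hold the tails and heads of the arcs (for the arcs `0, …, m - 1`, as in
the input), `2` the partial labelling of the input, `3` the reversals of the arcs, `4` and `5` the
first elements and the links of the lists of arcs, `6` the current partial labelling, `7` the flow,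
`8` the marks, `9` the parent arcs (plus one), `10` the queue positions, `11` the queue; `12`, `13`
and `14` form the search stack. -/
abbrev cell (a : ℕ) (i : NExp) : NExp := .arr a i

/-- A loop over all arcs. -/
abbrev forArcs (body : Program) : Program := forLoop 8 5 body

/-- The tail of the arc that a loop has reached. -/
abbrev tl : NExp := cell 0 (vr 8)

/-- The head of the arc that a loop has reached. -/
abbrev hd : NExp := cell 1 (vr 8)

/-- Mark the vertex `w` with `x`, with the parent `p`, and append it to the queue. -/
def enqueue (w x p : NExp) : Program :=
  store 8 w x ;; store 9 w p ;; store 10 w (vr 11) ;; store 11 (vr 11) w ;;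
    assign 11 (.add (vr 11) (lit 1))

/-- Set the flow to zero. -/
def clearFlow : Program := forArcs (store 7 (vr 8) (lit 0))

/-- Remove all marks. -/
def clearMarks : Program := forArcs (store 8 tl (lit 0))

/-- Mark the vertices with a label other than `a`. -/
def markSources : Program :=
  assign 11 (lit 0) ;;
  forArcs (ite (.eq (cell 8 tl) (lit 0))
    (ite (.eq (cell 6 tl) (lit 0)) skip
      (ite (.eq (cell 6 tl) (vr 6)) skip (enqueue tl (cell 6 tl) (lit 0)))) skip)

/-- One step of the breadth first search in the residual graph: take a vertex from the queue if the
list of arcs is at its end, and follow an arc otherwise. -/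
def scanStep : Program :=
  ite (.eq (vr 9) (lit 0))
    (assign 9 (cell 4 (cell 11 (vr 10))) ;; assign 10 (.add (vr 10) (lit 1)))
    (assign 17 (.sub (vr 9) (lit 1)) ;;
      assign 12 (cell 1 (vr 17)) ;;
      ite (.eq (cell 7 (vr 17)) (lit 0))
        (ite (.eq (cell 8 (vr 12)) (lit 0))
          (enqueue (vr 12) (cell 8 (cell 0 (vr 17))) (vr 9)) skip) skip ;;
      assign 9 (cell 5 (vr 17)))

/-- The search stops when the list of arcs and the queue are empty. -/
def scanAll : Program :=
  assign 10 (lit 0) ;; assign 9 (lit 0) ;;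
    loop (.lt (lit 0) (.add (vr 9) (.sub (vr 11) (vr 10)))) scanStep

/-- Breadth first search in the residual graph. -/
def search : Program := clearMarks ;; markSources ;; scanAll

/-- Look for a marked vertex of label `a`. -/
def findSink : Program :=
  assign 13 (lit 0) ;;
  forArcs (ite (.eq (cell 6 tl) (vr 6))
    (ite (.eq (cell 8 tl) (lit 0)) skip (assign 13 (lit 1) ;; assign 12 tl)) skip)

/-- Augment the flow along the path of parent arcs to the vertex in variable `12`. -/
def augment : Program :=
  loop (.not (.eq (cell 9 (vr 12)) (lit 0)))
    (assign 17 (.sub (cell 9 (vr 12)) (lit 1)) ;;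
      ite (.eq (cell 7 (cell 3 (vr 17))) (lit 1))
        (store 7 (cell 3 (vr 17)) (lit 0)) (store 7 (vr 17) (lit 1)) ;;
      assign 12 (cell 0 (vr 17)))

/-- One round of the flow algorithm; the counter is set to its limit if the flow is maximal. -/
def flowRound : Program :=
  search ;; findSink ;;
    ite (.eq (vr 13) (lit 1))
      (augment ;; assign 14 (.add (vr 14) (lit 1))) (assign 14 (.add (vr 7) (lit 1)))

/-- Compute a maximum flow from the other labels to `a`, or one of value `2 * k + 1`. -/
def maxFlow : Program :=
  clearFlow ;; assign 14 (lit 0) ;; assign 13 (lit 1) ;;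
    loop (.lt (vr 14) (.add (vr 7) (lit 1))) flowRound

/-- Give the label `a` to all unmarked vertices. -/
def relabelUnmarked : Program :=
  forArcs (ite (.eq (cell 8 tl) (lit 0)) (store 6 tl (vr 6)) skip)

/-- Enlarge the class of label `a` to the largest minimum cut. -/
def expand : Program := maxFlow ;; ite (.eq (vr 13) (lit 0)) relabelUnmarked skip

/-! ### Correctness of the expansion -/

/-- The word length `W` is large enough for all numbers in the computation. -/
structure Fit (W : ℕ) (G : Net) (d K : ℕ) : Prop where
  arcs : 2 * G.M + 4 ≤ W
  label : d * d + d + 2 ≤ W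
  depth : K + 2 ≤ W
  stack : (K + 1) * G.n + G.n ≤ W

theorem Fit.n_le {W : ℕ} {G : Net} {d K : ℕ} (h : Fit W G d K) : G.n ≤ W := by
  have := h.stack
  omega

theorem Fit.d_le {W : ℕ} {G : Net} {d K : ℕ} (h : Fit W G d K) : d + 2 ≤ W := by
  have := h.label
  have : 0 ≤ d * d := Nat.zero_le _
  omega

/-- The graph is stored in memory. -/
structure Ready (G : Net) (d K : ℕ) (s : State) : Prop where
  n : s.var 0 = G.n
  d : s.var 2 = d
  M : s.var 5 = G.M
  K : s.var 7 = K
  T : s.arr 0 = G.T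
  H : s.arr 1 = G.H
  rev : s.arr 3 = G.rev
  first : s.arr 4 = G.first
  next : s.arr 5 = G.next

theorem Ready.frame {G : Net} {d K : ℕ} {s s' : State} {p : Program} (h : Ready G d K s)
    (hp : Frame p s s')
    (hv : 0 ∉ p.wvars ∧ 2 ∉ p.wvars ∧ 5 ∉ p.wvars ∧ 7 ∉ p.wvars := by decide)
    (ha : 0 ∉ p.warrs ∧ 1 ∉ p.warrs ∧ 3 ∉ p.warrs ∧ 4 ∉ p.warrs ∧ 5 ∉ p.warrs := by decide) :
    Ready G d K s' where
  n := (hp.var hv.1).trans h.n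
  d := (hp.var hv.2.1).trans h.d
  M := (hp.var hv.2.2.1).trans h.M
  K := (hp.var hv.2.2.2).trans h.K
  T := (hp.arr ha.1).trans h.T
  H := (hp.arr ha.2.1).trans h.H
  rev := (hp.arr ha.2.2.1).trans h.rev
  first := (hp.arr ha.2.2.2.1).trans h.first
  next := (hp.arr ha.2.2.2.2).trans h.next

section

variable {W : ℕ} {G : Net} {d K : ℕ} {s : State}

theorem clearFlow_runs (hW : Fit W G d K) (hs : Ready G d K s) :
    Runs W clearFlow s (20 * G.M + 10) (fun s' => ∀ j < G.M, s'.arr 7 j = 0) := by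
  have := hW.arcs
  refine (Runs.forLoop (T := 10) (I := fun i s' => ∀ j < i, s'.arr 7 j = 0) (by decide) (by decide)
    (by decide) hs.M (by omega) (by simp) (fun i s v h => by simpa using h) ?_).conseq (by omega)
    (fun _ _ h => h)
  intro i s' hi hf hx hI
  refine (Runs.of_wp ?_).conseq (by decide) (fun _ _ h => h)
  simp only [wp, NExp.Fits, NExp.eval, hx, State.setArr_arr, if_true]
  refine ⟨by omega, by omega, fun j hj => ?_⟩
  rw [Function.update_apply]
  split_ifs with h
  · rfl
  · exact hI j (by omega)

theorem clearMarks_runs (hW : Fit W G d K) (hs : Ready G d K s) :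
    Runs W clearMarks s (20 * G.M + 10) (fun s' => ∀ v, G.Vert v → s'.arr 8 v = 0) := by
  have := hW.arcs
  have := hW.n_le
  refine (Runs.forLoop (T := 10) (I := fun i s' => ∀ j < i, s'.arr 8 (G.T j) = 0) (by decide)
    (by decide) (by decide) hs.M (by omega) (by simp) (fun i s v h => by simpa using h)
    ?_).conseq (by omega) (fun _ _ h => ?_)
  · intro i s' hi hf hx hI
    have hR := hs.frame hf
    have := G.T_lt hi
    refine (Runs.of_wp ?_).conseq (by decide) (fun _ _ h => h)
    simp only [wp, NExp.Fits, NExp.eval, hx, State.setArr_arr, if_true, hR.T]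
    refine ⟨by omega, by omega, fun j hj => ?_⟩
    rw [Function.update_apply]
    split_ifs with h
    · rfl
    · exact hI j (by rcases Nat.lt_succ_iff_lt_or_eq.1 hj with h1 | rfl; exact h1; exact (h rfl).elim)
  · rintro v ⟨j, hj, rfl⟩
    exact h j hj

/-- The queue invariant for the contents of the memory. -/
def QueueIn (G : Net) (d : ℕ) (s : State) (Y : Finset ℕ) : Prop :=
  G.Queue (s.arr 6) (s.var 6) (s.arr 7) d (s.arr 8) (s.arr 9) (s.arr 10) (s.arr 11) (s.var 11) Y

theorem markSources_runs (hW : Fit W G d K) (hs : Ready G d K s)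
    (hL : ∀ v, G.Vert v → s.arr 6 v ≤ d) (ha : s.var 6 ≤ d)
    (hm : ∀ v, G.Vert v → s.arr 8 v = 0) :
    Runs W markSources s (80 * G.M + 10) (fun s' => (∃ Y, QueueIn G d s' Y) ∧
      ∀ v, G.Vert v → s'.arr 6 v ≠ 0 → s'.arr 6 v ≠ s'.var 6 → s'.arr 8 v = s'.arr 6 v) := by
  have := hW.arcs
  have := hW.n_le
  have := hW.d_le
  have h1 : Runs W (assign 11 (lit 0)) s 2 (fun s' => s' = s.setVar 11 0) :=
    (Runs.of_wp (by simp [wp, NExp.Fits, NExp.eval])).conseq le_rfl fun _ _ h => h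
  refine (h1.seq (T' := 80 * G.M + 6) ?_).conseq (by omega) fun _ _ h => h
  rintro s1 - rfl
  refine (Runs.forLoop (T := 72) (I := fun i s' => (∃ Y, QueueIn G d s' Y) ∧
    (∀ v, G.Vert v → s'.arr 8 v ≠ 0 → s'.arr 9 v = 0) ∧
    ∀ j < i, s.arr 6 (G.T j) ≠ 0 → s.arr 6 (G.T j) ≠ s.var 6 → s'.arr 8 (G.T j) ≠ 0)
    (by decide) (by decide) (by decide) (by simpa using hs.M) (by omega) ?_
    (fun i s v h => by simpa [QueueIn] using h) ?_).conseq (by omega) (fun s' hf h => ?_)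
  · refine ⟨⟨_, Net.queue_empty hm⟩, fun v hv hv' => (hv' (hm v hv)).elim, by simp⟩
  · rintro i s' hi hf hx ⟨⟨Y, hq⟩, hpar, hdone⟩
    have hR : Ready G d K s' := Ready.frame (s := s.setVar 11 0) ⟨hs.n, hs.d, hs.M, hs.K, hs.T, hs.H,
      hs.rev, hs.first, hs.next⟩ hf
    have := G.T_lt hi
    have h6 : s'.arr 6 = s.arr 6 := hf.arr (by decide)
    have h6' : s'.var 6 = s.var 6 := hf.var (by decide)
    have hv : G.Vert (G.T i) := Net.vert_T hi
    have hLi := hL _ hv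
    have hmi : s'.arr 8 (G.T i) ≤ d := by
      by_cases h0 : s'.arr 8 (G.T i) = 0
      · omega
      · exact (hq.marked _ hv h0).2.2.1
    have hc := hq.card
    refine (Runs.of_wp ?_).conseq (T' := 72) (by decide) (fun _ _ h => h)
    simp only [wp, enqueue, NExp.Fits, NExp.eval, Test.Fits, Test.Holds, hx, h6, h6',
      State.setArr_arr, State.setVar_arr, State.setArr_var, hR.T]
    have hdone' : (s.arr 6 (G.T i) ≠ 0 → s.arr 6 (G.T i) ≠ s.var 6 → s'.arr 8 (G.T i) ≠ 0) →
        ∀ j < i + 1, s.arr 6 (G.T j) ≠ 0 → s.arr 6 (G.T j) ≠ s.var 6 → s'.arr 8 (G.T j) ≠ 0 := by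
      intro h j hj
      rcases Nat.lt_succ_iff_lt_or_eq.1 hj with h2 | rfl
      · exact hdone j h2
      · exact h
    refine ⟨by omega, fun h0 => ⟨by omega, fun h2 => ?_, fun h2 => ⟨by omega, fun h3 => ?_,
      fun h3 => ?_⟩⟩, fun h0 => ?_⟩
    · exact ⟨⟨Y, hq⟩, hpar, hdone' fun h => (h h2).elim⟩
    · exact ⟨⟨Y, hq⟩, hpar, hdone' fun _ h => (h h3).elim⟩
    · simp only [QueueIn, State.setArr_arr, State.setVar_arr, State.setArr_var, State.setVar_var,
        Nat.reduceEqDiff, if_true, if_false, h6, h6'] at hq ⊢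
      refine ⟨by omega, by omega, by omega, by omega, by omega, by omega, by omega, by omega,
        by omega, ⟨_, hq.enqueue hv h0 h2 hLi (Or.inl ⟨rfl, h2, h3, rfl⟩)⟩, fun v hv' h4 => ?_,
        fun j hj h4 h5 => ?_⟩
      · rw [Function.update_apply] at h4 ⊢
        split_ifs with h5
        · rfl
        · rw [if_neg h5] at h4
          exact hpar v hv' h4
      · rw [Function.update_apply]
        split_ifs with h7
        · exact h2
        · refine hdone j ?_ h4 h5
          rcases Nat.lt_succ_iff_lt_or_eq.1 hj with h8 | rfl
          · exact h8
          · exact (h7 rfl).elim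
    · exact ⟨⟨Y, hq⟩, hpar, hdone' fun _ _ => h0⟩
  · obtain ⟨⟨Y, hq⟩, hpar, hdone⟩ := h
    have h6 : s'.arr 6 = s.arr 6 := hf.arr (by decide)
    have h6' : s'.var 6 = s.var 6 := hf.var (by decide)
    refine ⟨⟨Y, hq⟩, ?_⟩
    rintro v ⟨j, hj, rfl⟩ h2 h3
    rw [h6] at h2 h3
    rw [h6'] at h3
    have h4 := hdone j hj h2 h3
    have hv : G.Vert (G.T j) := Net.vert_T hj
    rcases (hq.marked _ hv h4).2.2.2 with ⟨-, -, -, h5⟩ | ⟨i, -, h5, -⟩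
    · exact h5
    · rw [hpar _ hv h4] at h5
      omega

/-- The outcome of the residual search, for the contents of the memory. -/
def SearchedIn (G : Net) (d : ℕ) (s : State) : Prop :=
  G.Searched (s.arr 6) (s.var 6) (s.arr 7) d (s.arr 8) (s.arr 9) (s.arr 10)

theorem scanAll_runs (hW : Fit W G d K) (hs : Ready G d K s)
    (hf : ∀ j < G.M, s.arr 7 j ≤ 1) {Y : Finset ℕ} (hq : QueueIn G d s Y)
    (hL : ∀ v, G.Vert v → s.arr 6 v ≠ 0 → s.arr 6 v ≠ s.var 6 → s.arr 8 v = s.arr 6 v) :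
    Runs W scanAll s (300 * G.M + 20) (SearchedIn G d) := by
  have := hW.arcs
  have := hW.n_le
  have := hW.d_le
  have h1 : Runs W (assign 10 (lit 0)) s 2 (fun s' => s' = s.setVar 10 0) :=
    (Runs.of_wp (by simp [wp, NExp.Fits, NExp.eval])).conseq le_rfl fun _ _ h => h
  have h2 : Runs W (assign 9 (lit 0)) (s.setVar 10 0) 2
      (fun s' => s' = (s.setVar 10 0).setVar 9 0) :=
    (Runs.of_wp (by simp [wp, NExp.Fits, NExp.eval])).conseq le_rfl fun _ _ h => h
  have hcard := hq.card
  refine (h1.seq (T' := 2 + (300 * G.M + 8)) ?_).conseq (by omega) fun _ _ h => h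
  rintro s1 - rfl
  refine h2.seq ?_
  rintro s2 - rfl
  refine (Runs.loop (T := 120) (N := G.M + Y.card + s.var 11) (I := fun r s' => ∃ U Y,
    QueueIn G d s' Y ∧ G.Scan (s'.arr 7) (s'.arr 8) (s'.arr 10) (s'.var 10) (s'.var 11) (s'.var 9) U
    ∧ r = U.card + Y.card + (s'.var 11 - s'.var 10) ∧
    ∀ v, G.Vert v → s'.arr 6 v ≠ 0 → s'.arr 6 v ≠ s'.var 6 → s'.arr 8 v = s'.arr 6 v)
    ?_ ?_ ?_).conseq ?_ ?_
  · refine ⟨Finset.range G.M, Y, hq, ?_, ?_, ?_⟩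
    · simpa using Net.scan_start
    · simp
    · simpa using hL
  · rintro r s' hfr ⟨U, Y', hq', hsc, -⟩
    have := hq'.card
    have := hsc.c_le
    have := hsc.head_le
    simp only [Test.Fits, NExp.Fits, NExp.eval]
    omega
  · rintro r s' hfr ⟨U, Y', hq', hsc, hr, hL'⟩ hb
    have hc := hq'.card
    have hc' := hsc.c_le
    have hR : Ready G d K s' := Ready.frame (s := (s.setVar 10 0).setVar 9 0)
      ⟨hs.n, hs.d, hs.M, hs.K, hs.T, hs.H, hs.rev, hs.first, hs.next⟩ hfr
    have h7 : s'.arr 7 = s.arr 7 := hfr.arr (by decide)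
    have hh := hsc.head_le
    simp only [Test.Holds, NExp.eval] at hb
    refine (Runs.of_wp ?_).conseq (T' := 120) (by decide) (fun _ _ h => h)
    simp only [wp, scanStep, enqueue, NExp.Fits, NExp.eval, Test.Fits, Test.Holds,
      State.setArr_arr, State.setVar_arr, State.setArr_var, State.setVar_var, hR.T, hR.H, hR.first,
      hR.next, Nat.reduceEqDiff, if_true, if_false]
    refine ⟨by omega, fun h0 => ?_, fun h0 => ?_⟩
    · have hlt : s'.var 10 < s'.var 11 := by omega
      have hv := (hq'.mem _ hlt).1
      have := hv.lt
      have := G.first_le (s'.arr 11 (s'.var 10))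
      refine ⟨by omega, by omega, _, ?_, U, Y', by simpa [QueueIn] using hq',
        (h0 ▸ hsc).pop hq' hlt, rfl, hL'⟩
      omega
    · have hcM : s'.var 9 - 1 < G.M := by omega
      have hcur := hsc.cur h0
      have hH := Net.H_lt hcM
      have hT := G.T_lt hcM
      have hnext := G.next_le hcM
      have hrest : s'.var 9 - 1 ∈ U := hsc.rest _ (by omega) rfl
      have hU := Finset.card_erase_add_one hrest
      have hfc := hf _ hcM
      rw [← h7] at hfc
      have hTm := (hq'.marked _ (Net.vert_T hcM) hcur.1).2.2.1
      have hHm : s'.arr 8 (G.H (s'.var 9 - 1)) ≤ d := by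
        by_cases h3 : s'.arr 8 (G.H (s'.var 9 - 1)) = 0
        · omega
        · exact (hq'.marked _ (Net.vert_H hcM) h3).2.2.1
      have hold : (s'.arr 7 (s'.var 9 - 1) = 0 → s'.arr 8 (G.H (s'.var 9 - 1)) ≠ 0) →
          ∃ r' < r, ∃ U Y, QueueIn G d s' Y ∧ G.Scan (s'.arr 7) (s'.arr 8) (s'.arr 10) (s'.var 10)
            (s'.var 11) (G.next (s'.var 9 - 1)) U ∧
            r' = U.card + Y.card + (s'.var 11 - s'.var 10) ∧ ∀ v, G.Vert v → s'.arr 6 v ≠ 0 →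
              s'.arr 6 v ≠ s'.var 6 → s'.arr 8 v = s'.arr 6 v :=
        fun h3 => ⟨_, by omega, _, Y', hq', hsc.advance h0 h3, rfl, hL'⟩
      simp only [QueueIn] at hold hq' ⊢
      simp only [State.setArr_arr, State.setVar_arr, State.setArr_var, State.setVar_var,
        Nat.reduceEqDiff, if_true, if_false]
      refine ⟨by clear hold; omega, by clear hold; omega, by clear hold; omega,
        fun h3 => ⟨by clear hold; omega, fun h4 => ?_, fun h4 => ?_⟩, fun h3 => ?_⟩
      · have hY := Finset.card_erase_add_one (hq'.unmarked _ (Net.vert_H hcM) h4)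
        clear hold
        refine ⟨by omega, by omega, by omega, by omega, by omega, by omega, by omega, by omega,
          by omega, by omega, (U.erase (s'.var 9 - 1)).card +
          (Y'.erase (G.H (s'.var 9 - 1))).card + (s'.var 11 + 1 - s'.var 10), ?_, _, _,
          hq'.enqueue (Net.vert_H hcM) h4 hcur.1 hTm
          (Or.inr ⟨s'.var 9 - 1, hcM, by omega, h3, rfl, rfl⟩),
          (hsc.enqueue h4 hcur.1).advance h0 (fun _ => by simpa using hcur.1), rfl, ?_⟩
        · omega
        · intro v hv h5 h6
          rw [Function.update_of_ne]
          · exact hL' v hv h5 h6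
          · rintro rfl
            exact h5 ((hL' _ hv h5 h6).symm.trans h4)
      · exact ⟨by clear hold; omega, hold fun _ => h4⟩
      · exact ⟨by clear hold; omega, hold fun h => (h3 h).elim⟩
  · simp only [Test.time, NExp.time]
    omega
  · rintro s' hfr ⟨⟨r, U, Y', hq', hsc, -, hL'⟩, hb⟩
    simp only [Test.Holds, NExp.eval] at hb
    have := hsc.head_le
    have h10 : s'.var 10 = s'.var 11 := by omega
    have h9 : s'.var 9 = 0 := by omega
    rw [h10, h9] at hsc
    exact hsc.searched hq' hL'

theorem search_runs (hW : Fit W G d K) (hs : Ready G d K s)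
    (hL : ∀ v, G.Vert v → s.arr 6 v ≤ d) (ha : s.var 6 ≤ d) (hf : ∀ j < G.M, s.arr 7 j ≤ 1) :
    Runs W search s (400 * G.M + 40) (SearchedIn G d) := by
  refine ((clearMarks_runs hW hs).seq (T' := (80 * G.M + 10) + (300 * G.M + 20)) ?_).conseq
    (by omega) fun _ _ h => h
  intro s1 hf1 h1
  have hR1 := hs.frame hf1
  have h6 : s1.arr 6 = s.arr 6 := hf1.arr (by decide)
  have h6' : s1.var 6 = s.var 6 := hf1.var (by decide)
  have h7 : s1.arr 7 = s.arr 7 := hf1.arr (by decide)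
  refine (markSources_runs hW hR1 (by rwa [h6]) (by rwa [h6']) h1).seq ?_
  rintro s2 hf2 ⟨⟨Y, hq⟩, h2⟩
  have h7' : s2.arr 7 = s1.arr 7 := hf2.arr (by decide)
  exact scanAll_runs hW (hR1.frame hf2) (by rwa [h7', h7]) hq h2

end

end ZeroExt

/-! ### Maximum flows and the expansion of all labels -/

namespace ZeroExt

open RAM RAM.Program

section

variable {W : ℕ} {G : Net} {d K : ℕ} {s : State}

theorem findSink_runs (hW : Fit W G d K) (hs : Ready G d K s)
    (hL : ∀ v, G.Vert v → s.arr 6 v ≤ d) (ha : s.var 6 ≤ d) (hS : SearchedIn G d s) :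
    Runs W findSink s (40 * G.M + 10) (fun s' =>
      (s'.var 13 = 1 ∧ G.Vert (s'.var 12) ∧ s.arr 6 (s'.var 12) = s.var 6 ∧
        s.arr 8 (s'.var 12) ≠ 0) ∨
      (s'.var 13 = 0 ∧ ∀ v, G.Vert v → s.arr 6 v = s.var 6 → s.arr 8 v = 0)) := by
  have := hW.arcs
  have := hW.n_le
  have := hW.d_le
  have h1 : Runs W (assign 13 (lit 0)) s 2 (fun s' => s' = s.setVar 13 0) :=
    (Runs.of_wp (by simp [wp, NExp.Fits, NExp.eval])).conseq le_rfl fun _ _ h => h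
  refine (h1.seq (T' := 40 * G.M + 6) ?_).conseq (by omega) fun _ _ h => h
  rintro s1 - rfl
  refine (Runs.forLoop (T := 32) (I := fun i s' =>
      (s'.var 13 = 1 ∧ G.Vert (s'.var 12) ∧ s.arr 6 (s'.var 12) = s.var 6 ∧
        s.arr 8 (s'.var 12) ≠ 0) ∨
      (s'.var 13 = 0 ∧ ∀ j < i, s.arr 6 (G.T j) = s.var 6 → s.arr 8 (G.T j) = 0))
    (by decide) (by decide) (by decide) (by simpa using hs.M) (by omega) ?_
    ?_ ?_).conseq (by omega) (fun s' hf h => ?_)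
  · right
    simp
  · intro i s' v h
    exact h
  · intro i s' hi hf hx hI
    have hR : Ready G d K s' := Ready.frame (s := s.setVar 13 0) ⟨hs.n, hs.d, hs.M, hs.K, hs.T,
      hs.H, hs.rev, hs.first, hs.next⟩ hf
    have h6 : s'.arr 6 = s.arr 6 := hf.arr (by decide)
    have h8 : s'.arr 8 = s.arr 8 := hf.arr (by decide)
    have h6' : s'.var 6 = s.var 6 := hf.var (by decide)
    have := G.T_lt hi
    have hv : G.Vert (G.T i) := Net.vert_T hi
    have h3 := hL _ hv
    have h4 := hS.mark_le _ hv
    have hold : (s.arr 6 (G.T i) = s.var 6 → s.arr 8 (G.T i) = 0) →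
        (s'.var 13 = 1 ∧ G.Vert (s'.var 12) ∧ s.arr 6 (s'.var 12) = s.var 6 ∧
        s.arr 8 (s'.var 12) ≠ 0) ∨
        (s'.var 13 = 0 ∧ ∀ j < i + 1, s.arr 6 (G.T j) = s.var 6 → s.arr 8 (G.T j) = 0) := by
      refine fun h => hI.imp_right fun h5 => ⟨h5.1, fun j hj => ?_⟩
      rcases Nat.lt_succ_iff_lt_or_eq.1 hj with h2 | rfl
      · exact h5.2 j h2
      · exact h
    refine (Runs.of_wp ?_).conseq (T' := 32) (by decide) (fun _ _ h => h)
    simp only [wp, NExp.Fits, NExp.eval, Test.Fits, Test.Holds, hx, h6, h6', h8,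
      State.setVar_arr, State.setVar_var, hR.T, Nat.reduceEqDiff, if_true, if_false]
    clear hI
    refine ⟨by clear hold; omega, fun h => ⟨by clear hold; omega, fun h' => ?_, fun h' => ?_⟩,
      fun h => hold fun h' => (h h').elim⟩
    · exact hold fun _ => h'
    · exact ⟨by clear hold; omega, by clear hold; omega, Or.inl ⟨trivial, hv, h, h'⟩⟩
  · refine h.imp_right fun h => ⟨h.1, ?_⟩
    rintro v ⟨j, hj, rfl⟩
    exact h.2 j hj

theorem augment_runs (hW : Fit W G d K) (hs : Ready G d K s) {val : ℕ} (hS : SearchedIn G d s)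
    (hf : G.IsFlow (s.arr 6) (s.var 6) (s.arr 7) val) (hb : G.Vert (s.var 12))
    (hba : s.arr 6 (s.var 12) = s.var 6) (hbm : s.arr 8 (s.var 12) ≠ 0) :
    Runs W augment s (60 * G.M + 10)
      (fun s' => G.IsFlow (s.arr 6) (s.var 6) (s'.arr 7) (val + 1)) := by
  have := hW.arcs
  have := hW.n_le
  have := hS.pos_lt _ hb hbm
  refine (Runs.loop (T := 40) (N := s.arr 10 (s.var 12)) (I := fun r s' =>
    r = s.arr 10 (s'.var 12) ∧ G.Augment (s.arr 7) (s.arr 8) (s.arr 10) (s.var 12) (s'.arr 7)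
      (s'.var 12)) ?_ ?_ ?_).conseq ?_ ?_
  · exact ⟨rfl, hb, hbm, hf.unit, by simp, fun _ _ _ _ _ _ => rfl⟩
  · rintro r s' hfr ⟨-, hA⟩
    have h9 : s'.arr 9 = s.arr 9 := hfr.arr (by decide)
    have := hA.vert.lt
    have := hS.par_le hA.vert hA.mark_ne
    simp only [Test.Fits, NExp.Fits, NExp.eval, h9]
    omega
  · rintro r s' hfr ⟨rfl, hA⟩ hp
    have h9 : s'.arr 9 = s.arr 9 := hfr.arr (by decide)
    have hR : Ready G d K s' := hs.frame hfr
    have := hA.vert.lt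
    have := hS.par_le hA.vert hA.mark_ne
    simp only [Test.Holds, NExp.eval, h9] at hp
    obtain ⟨hj, hlt, hA'⟩ := hA.step hS hp
    have := G.rev_lt hj
    have := G.T_lt hj
    have := (hA.unit _ hj).1
    have := (hA.unit _ (G.rev_lt hj)).1
    refine (Runs.of_wp ?_).conseq (T' := 40) (by decide) (fun _ _ h => h)
    simp only [wp, NExp.Fits, NExp.eval, Test.Fits, Test.Holds, h9, hR.T, hR.rev,
      State.setArr_arr, State.setVar_arr, State.setArr_var, State.setVar_var,
      Nat.reduceEqDiff, if_true, if_false]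
    refine ⟨by omega, by omega, fun h => ⟨by omega, by omega, by omega, _, hlt, rfl, ?_⟩,
      fun h => ⟨by omega, by omega, by omega, _, hlt, rfl, ?_⟩⟩
    · rwa [Net.push, if_pos h] at hA'
    · rwa [Net.push, if_neg h] at hA'
  · have h : (45 : ℕ) * s.arr 10 (s.var 12) ≤ 45 * G.M := by omega
    simp only [Test.time, NExp.time]
    omega
  · rintro s' hfr ⟨⟨r, -, hA⟩, hp⟩
    have h9 : s'.arr 9 = s.arr 9 := hfr.arr (by decide)
    simp only [Test.Holds, NExp.eval, h9, not_not] at hp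
    exact hA.isFlow hS hf hb hba hp

/-- The unmarked vertices contain those of label `a`. -/
def SinksUnmarked (G : Net) (s : State) : Prop :=
  ∀ v, G.Vert v → s.arr 6 v = s.var 6 → s.arr 8 v = 0

/-- The invariant of the flow algorithm: the flow has the value of the counter in variable `14`,
until the flag in variable `13` says that it is maximal. -/
def FlowInv (G : Net) (d K : ℕ) (s : State) : Prop :=
  ∃ val, G.IsFlow (s.arr 6) (s.var 6) (s.arr 7) val ∧ s.var 14 ≤ K + 1 ∧
    ((s.var 13 = 1 ∧ val = s.var 14) ∨
      (s.var 13 = 0 ∧ s.var 14 = K + 1 ∧ SearchedIn G d s ∧ SinksUnmarked G s))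

theorem flowRound_runs (hW : Fit W G d K) (hs : Ready G d K s)
    (hL : ∀ v, G.Vert v → s.arr 6 v ≤ d) (ha : s.var 6 ≤ d) (hI : FlowInv G d K s)
    (hlt : s.var 14 < K + 1) :
    Runs W flowRound s (500 * G.M + 80)
      (fun s' => FlowInv G d K s' ∧ s.var 14 < s'.var 14) := by
  have := hW.arcs
  have := hW.depth
  obtain ⟨val, hf, -, h13⟩ := hI
  have hval : val = s.var 14 := by
    rcases h13 with h | h
    · exact h.2
    · omega
  subst hval
  refine ((search_runs hW hs hL ha fun j hj => (hf.unit j hj).1).seq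
    (T' := (40 * G.M + 10) + (4 + (60 * G.M + 16))) ?_).conseq (by omega) fun _ _ h => h
  intro s1 hf1 hS
  have hR1 := hs.frame hf1
  have h6 : s1.arr 6 = s.arr 6 := hf1.arr (by decide)
  have h6' : s1.var 6 = s.var 6 := hf1.var (by decide)
  have h7 : s1.arr 7 = s.arr 7 := hf1.arr (by decide)
  have h14 : s1.var 14 = s.var 14 := hf1.var (by decide)
  refine (findSink_runs hW hR1 (by rwa [h6]) (by rwa [h6']) hS).seq ?_
  intro s2 hf2 hP
  have hR2 := hR1.frame hf2
  have g6 : s2.arr 6 = s1.arr 6 := hf2.arr (by decide)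
  have g6' : s2.var 6 = s1.var 6 := hf2.var (by decide)
  have g7 : s2.arr 7 = s1.arr 7 := hf2.arr (by decide)
  have g8 : s2.arr 8 = s1.arr 8 := hf2.arr (by decide)
  have g9 : s2.arr 9 = s1.arr 9 := hf2.arr (by decide)
  have g10 : s2.arr 10 = s1.arr 10 := hf2.arr (by decide)
  have g14 : s2.var 14 = s1.var 14 := hf2.var (by decide)
  have hS2 : SearchedIn G d s2 := by
    unfold SearchedIn
    rw [g6, g6', g7, g8, g9, g10]
    exact hS
  have hf2' : G.IsFlow (s2.arr 6) (s2.var 6) (s2.arr 7) (s.var 14) := by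
    rw [g6, g6', g7, h6, h6', h7]
    exact hf
  rw [← g6, ← g6', ← g8] at hP
  refine Runs.ite ?_ (fun hb => ?_) (fun hb => ?_)
  · simp only [Test.Fits, NExp.Fits]
    omega
  · simp only [Test.Holds, NExp.eval] at hb
    have hP' : G.Vert (s2.var 12) ∧ s2.arr 6 (s2.var 12) = s2.var 6 ∧
        s2.arr 8 (s2.var 12) ≠ 0 := by
      rcases hP with h | h
      · exact h.2
      · omega
    refine ((augment_runs hW hR2 hS2 hf2' hP'.1 hP'.2.1 hP'.2.2).seq (T' := 4) ?_).conseq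
      (by omega) fun _ _ h => h
    intro s3 hf3 hflow
    have k6 : s3.arr 6 = s2.arr 6 := hf3.arr (by decide)
    have k6' : s3.var 6 = s2.var 6 := hf3.var (by decide)
    have k14 : s3.var 14 = s2.var 14 := hf3.var (by decide)
    have k13 : s3.var 13 = s2.var 13 := hf3.var (by decide)
    refine (Runs.of_wp ?_).conseq (T' := 4) (by decide) (fun _ _ h => h)
    simp only [wp, NExp.Fits, NExp.eval, FlowInv, State.setVar_arr, State.setVar_var,
      Nat.reduceEqDiff, if_true, if_false]
    rw [← k6, ← k6'] at hflow
    exact ⟨by omega, ⟨_, hflow, by omega, Or.inl ⟨by omega, by omega⟩⟩, by omega⟩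
  · simp only [Test.Holds, NExp.eval] at hb
    have hP' : s2.var 13 = 0 ∧ SinksUnmarked G s2 := by
      rcases hP with h | h
      · exact (hb h.1).elim
      · exact h
    have h7 := hR2.K
    refine (Runs.of_wp ?_).conseq (T' := 60 * G.M + 16) ?_ (fun _ _ h => h)
    · simp only [wp, NExp.Fits, NExp.eval, FlowInv, SearchedIn, SinksUnmarked, State.setVar_arr,
        State.setVar_var, Nat.reduceEqDiff, if_true, if_false]
      exact ⟨by omega, ⟨_, hf2', by omega, Or.inr ⟨hP'.1, by omega, hS2, hP'.2⟩⟩, by omega⟩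
    · simp only [steps, NExp.time]
      omega

theorem maxFlow_runs (hW : Fit W G d K) (hs : Ready G d K s)
    (hL : ∀ v, G.Vert v → s.arr 6 v ≤ d) (ha : s.var 6 ≤ d) :
    Runs W maxFlow s ((K + 1) * (600 * G.M + 120))
      (fun s' => FlowInv G d K s' ∧ s'.var 14 = K + 1) := by
  have := hW.arcs
  have := hW.depth
  have htime : (20 * G.M + 10) + (2 + (2 + (6 + (500 * G.M + 80)) * (K + 1) + 6)) ≤
      (K + 1) * (600 * G.M + 120) := by
    nlinarith [Nat.zero_le (K * G.M)]
  refine ((clearFlow_runs hW hs).seq (T' := 2 + (2 + (6 + (500 * G.M + 80)) * (K + 1) + 6))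
    ?_).conseq htime fun _ _ h => h
  intro s1 hf1 h0
  have hR1 := hs.frame hf1
  have h6 : s1.arr 6 = s.arr 6 := hf1.arr (by decide)
  have h6' : s1.var 6 = s.var 6 := hf1.var (by decide)
  refine (Runs.conseq (T := 2) (T' := 2) (Q := fun s' => s' = s1.setVar 14 0)
    (Runs.of_wp (by simp [wp, NExp.Fits, NExp.eval])) le_rfl fun _ _ h => h).seq ?_
  rintro s2 - rfl
  refine ((Runs.conseq (T := 2) (T' := 2) (Q := fun s' => s' = (s1.setVar 14 0).setVar 13 1)
    (Runs.of_wp ?_) le_rfl fun _ _ h => h).seq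
    (T' := (6 + (500 * G.M + 80)) * (K + 1) + 6) ?_).conseq (by omega) fun _ _ h => h
  · simp [wp, NExp.Fits, NExp.eval]
    omega
  rintro s3 - rfl
  refine (Runs.loop (T := 500 * G.M + 80) (N := K + 1) (I := fun r s' => FlowInv G d K s' ∧
    r = K + 1 - s'.var 14) ?_ ?_ ?_).conseq ?_ ?_
  · refine ⟨⟨0, by simpa using Net.isFlow_zero h0, by simp, Or.inl (by simp)⟩, by simp⟩
  · rintro r s' hfr ⟨⟨val, -, h14, -⟩, -⟩
    have hR := Ready.frame (s := (s1.setVar 14 0).setVar 13 1) ⟨hR1.n, hR1.d, hR1.M, hR1.K, hR1.T,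
      hR1.H, hR1.rev, hR1.first, hR1.next⟩ hfr
    have := hR.K
    simp only [Test.Fits, NExp.Fits, NExp.eval]
    omega
  · rintro r s' hfr ⟨hI, rfl⟩ hb
    have hR := Ready.frame (s := (s1.setVar 14 0).setVar 13 1) ⟨hR1.n, hR1.d, hR1.M, hR1.K, hR1.T,
      hR1.H, hR1.rev, hR1.first, hR1.next⟩ hfr
    have g6 : s'.arr 6 = s1.arr 6 := hfr.arr (by decide)
    have g6' : s'.var 6 = s1.var 6 := hfr.var (by decide)
    simp only [Test.Holds, NExp.eval, hR.K] at hb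
    refine (flowRound_runs hW hR (by rwa [g6, h6]) (by rwa [g6', h6']) hI hb).conseq le_rfl ?_
    rintro s'' - ⟨hI', hlt⟩
    exact ⟨_, by omega, hI', rfl⟩
  · exact le_of_eq rfl
  · rintro s' hfr ⟨⟨r, hI, -⟩, hb⟩
    have hR := Ready.frame (s := (s1.setVar 14 0).setVar 13 1) ⟨hR1.n, hR1.d, hR1.M, hR1.K, hR1.T,
      hR1.H, hR1.rev, hR1.first, hR1.next⟩ hfr
    simp only [Test.Holds, NExp.eval, hR.K] at hb
    obtain ⟨val, h1, h2, h3⟩ := hI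
    exact ⟨⟨val, h1, h2, h3⟩, by omega⟩

theorem relabelUnmarked_runs (hW : Fit W G d K) (hs : Ready G d K s)
    (ha : s.var 6 ≤ d) (hm : ∀ v, G.Vert v → s.arr 8 v ≤ d) :
    Runs W relabelUnmarked s (30 * G.M + 10) (fun s' => ∀ v, G.Vert v →
      s'.arr 6 v = Net.relabel (s.arr 8) (s.var 6) (s.arr 6) v) := by
  have := hW.arcs
  have := hW.n_le
  have := hW.d_le
  refine (Runs.forLoop (T := 22) (I := fun i s' =>
      (∀ j < i, s'.arr 6 (G.T j) = Net.relabel (s.arr 8) (s.var 6) (s.arr 6) (G.T j)) ∧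
      ∀ w, s'.arr 6 w = s.arr 6 w ∨ s'.arr 6 w = Net.relabel (s.arr 8) (s.var 6) (s.arr 6) w)
    (by decide) (by decide) (by decide) hs.M (by omega) (by simp)
    (fun i s v h => h) ?_).conseq (by omega) (fun s' hf h => ?_)
  · rintro i s' hi hf hx ⟨hI, hI'⟩
    have hR := hs.frame hf
    have h8 : s'.arr 8 = s.arr 8 := hf.arr (by decide)
    have h6' : s'.var 6 = s.var 6 := hf.var (by decide)
    have := G.T_lt hi
    have := hm _ (Net.vert_T hi)
    refine (Runs.of_wp ?_).conseq (T' := 22) (by decide) (fun _ _ h => h)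
    simp only [wp, NExp.Fits, NExp.eval, Test.Fits, Test.Holds, hx, h8, h6', hR.T,
      State.setArr_arr, if_true]
    refine ⟨by omega, fun h => ⟨by omega, by omega, fun j hj => ?_, fun w => ?_⟩,
      fun h => ⟨fun j hj => ?_, hI'⟩⟩
    · rw [Function.update_apply]
      split_ifs with h1
      · rw [h1, Net.relabel, if_pos h]
      · refine hI j ?_
        rcases Nat.lt_succ_iff_lt_or_eq.1 hj with h2 | rfl
        · exact h2
        · exact (h1 rfl).elim
    · rw [Function.update_apply]
      split_ifs with h1
      · rw [h1, Net.relabel, if_pos h]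
        exact Or.inr rfl
      · exact hI' w
    · rcases Nat.lt_succ_iff_lt_or_eq.1 hj with h2 | rfl
      · exact hI j h2
      · rcases hI' (G.T j) with h3 | h3
        · rw [h3, Net.relabel, if_neg h]
        · exact h3
  · rintro v ⟨j, hj, rfl⟩
    exact h.1 j hj

/-- What the expansion of the label `a` achieves: solutions persist, the class of `a` becomes
normal, and the other classes do not change. -/
structure Expanded (G : Net) (d : ℕ) (μ : ℕ → ℕ → ℝ) (K : ℕ) (q : ℝ) (a : ℕ) (L L' : ℕ → ℕ) :
    Prop where
  ext : G.Ext L L'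
  le : ∀ v, G.Vert v → L' v ≤ d
  sol : ∀ lab, G.Sol d μ K q lab → G.Ext L lab →
    G.Normal L' a ∧ (∀ b, b ≠ 0 → b ≠ a → ∀ v, G.Vert v → (L' v = b ↔ L v = b)) ∧
      ∃ lab', G.Sol d μ K q lab' ∧ G.Ext L' lab'

theorem Net.Normal.congr {L L' : ℕ → ℕ} {a : ℕ} (h : G.Normal L a)
    (hL : ∀ v, G.Vert v → L' v = L v) : G.Normal L' a :=
  h.of_ext (fun v hv _ => hL v hv) fun v hv => by rw [hL v hv]

variable {μ : ℕ → ℕ → ℝ} {q : ℝ}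

theorem expand_runs (hμ : IsMetricCost μ) (hW : Fit W G d K) (hs : Ready G d K s)
    (hL : ∀ v, G.Vert v → s.arr 6 v ≤ d) (ha0 : s.var 6 ≠ 0) (ha : s.var 6 ≤ d) :
    Runs W expand s ((K + 1) * (700 * G.M + 200))
      (fun s' => Expanded G d μ K q (s.var 6) (s.arr 6) (s'.arr 6)) := by
  have := hW.arcs
  have htime : (K + 1) * (600 * G.M + 120) + (4 + (30 * G.M + 10)) ≤
      (K + 1) * (700 * G.M + 200) := by
    nlinarith [Nat.zero_le (K * G.M)]
  refine ((maxFlow_runs hW hs hL ha).seq (T' := 4 + (30 * G.M + 10)) ?_).conseq htime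
    fun _ _ h => h
  rintro s1 hf1 ⟨⟨val, hflow, -, h13⟩, h14⟩
  have hR1 := hs.frame hf1
  have h6 : s1.arr 6 = s.arr 6 := hf1.arr (by decide)
  have h6' : s1.var 6 = s.var 6 := hf1.var (by decide)
  rw [h6, h6'] at hflow
  have hle : s1.var 13 ≤ 1 := by
    rcases h13 with h | h <;> omega
  refine Runs.ite ?_ (fun hb => ?_) (fun hb => ?_)
  · simp only [Test.Fits, NExp.Fits]
    omega
  · simp only [Test.Holds, NExp.eval] at hb
    obtain ⟨hS, hsink⟩ : SearchedIn G d s1 ∧ SinksUnmarked G s1 := by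
      rcases h13 with h | h
      · omega
      · exact h.2.2
    refine (relabelUnmarked_runs hW hR1 (by rwa [h6']) hS.mark_le).conseq le_rfl ?_
    intro s2 hf2 h2
    unfold SearchedIn at hS
    unfold SinksUnmarked at hsink
    rw [h6, h6'] at h2 hS hsink
    have hext : G.Ext (s.arr 6) (s2.arr 6) := by
      intro v hv hLv
      rw [h2 v hv, Net.relabel]
      split_ifs with h
      · by_contra h3
        have := hS.source v hv hLv (Ne.symm h3)
        omega
      · rfl
    refine ⟨hext, fun v hv => ?_, fun lab hlab hLlab => ⟨?_, fun b hb0 hba v hv => ?_, ?_⟩⟩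
    · rw [h2 v hv, Net.relabel]
      split_ifs
      · exact ha
      · exact hL v hv
    · exact (hS.toReach.normal_relabel hflow hsink).congr h2
    · refine ⟨fun h => ?_, fun h => by rw [hext v hv (by omega), h]⟩
      rw [h2 v hv, Net.relabel] at h
      split_ifs at h with h3
      · exact (hba h.symm).elim
      · exact h
    · obtain ⟨h3, h4⟩ := hlab.relabel hμ hLlab ha0 ha hS.toReach hflow
      exact ⟨_, h3, fun v hv h5 => by rw [h2 v hv] at h5 ⊢; exact h4 v hv h5⟩
  · simp only [Test.Holds, NExp.eval] at hb
    have hval : val = K + 1 := by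
      rcases h13 with h | h <;> omega
    refine (Runs.of_wp (p := skip) (Q := fun s' => s' = s1) rfl).conseq
      (T' := 30 * G.M + 10) ?_ ?_
    · simp only [steps]
      omega
    · rintro s2 - rfl
      rw [h6]
      refine ⟨Net.Ext.refl _, hL, fun lab hlab hLlab => ?_⟩
      -- A flow of value greater than `2 * k` excludes a solution.
      have := hlab.flow_le hLlab ha0 ha hflow
      omega

/-- Enlarge all label classes, one after the other. -/
def expandAll : Program := forLoop 16 2 (assign 6 (.add (vr 16) (lit 1)) ;; expand)

/-- What the expansion of all labels achieves. -/
structure AllExpanded (G : Net) (d : ℕ) (μ : ℕ → ℕ → ℝ) (K : ℕ) (q : ℝ) (i : ℕ) (L L' : ℕ → ℕ) :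
    Prop where
  ext : G.Ext L L'
  le : ∀ v, G.Vert v → L' v ≤ d
  sol : ∀ lab, G.Sol d μ K q lab → G.Ext L lab →
    (∀ a ∈ Finset.Icc 1 i, G.Normal L' a) ∧ ∃ lab', G.Sol d μ K q lab' ∧ G.Ext L' lab'

theorem AllExpanded.step {i : ℕ} {L L' L'' : ℕ → ℕ} (h : AllExpanded G d μ K q i L L')
    (h' : Expanded G d μ K q (i + 1) L' L'') : AllExpanded G d μ K q (i + 1) L L'' where
  ext := h.ext.trans h'.ext
  le := h'.le
  sol lab hlab hL := by
    obtain ⟨h1, lab', h2, h3⟩ := h.sol lab hlab hL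
    obtain ⟨h4, h5, h6⟩ := h'.sol lab' h2 h3
    refine ⟨fun a ha => ?_, h6⟩
    rw [Finset.mem_Icc] at ha
    by_cases hai : a = i + 1
    · exact hai ▸ h4
    · exact (h1 a (Finset.mem_Icc.2 (by omega))).of_ext h'.ext (h5 a (by omega) hai)

theorem expandAll_runs (hμ : IsMetricCost μ) (hW : Fit W G d K) (hs : Ready G d K s)
    (hL : ∀ v, G.Vert v → s.arr 6 v ≤ d) :
    Runs W expandAll s (((K + 1) * (700 * G.M + 200) + 12) * d + 6)
      (fun s' => AllExpanded G d μ K q d (s.arr 6) (s'.arr 6)) := by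
  have := hW.d_le
  refine (Runs.forLoop (T := 4 + (K + 1) * (700 * G.M + 200))
    (I := fun i s' => AllExpanded G d μ K q i (s.arr 6) (s'.arr 6))
    (by decide) (by decide) (by decide) hs.d (by omega) ?_ (fun i s v h => h) ?_).conseq
    (le_of_eq (by ring)) (fun _ _ h => h)
  · exact ⟨Net.Ext.refl _, hL, fun lab hlab hL => ⟨by simp, lab, hlab, hL⟩⟩
  · intro i s' hi hf hx hI
    have hR := hs.frame hf
    refine (Runs.conseq (T' := 4) (Q := fun s1 => s1 = s'.setVar 6 (i + 1))
      (Runs.of_wp ?_) (by decide) (fun _ _ h => h)).seq ?_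
    · simp only [wp, NExp.Fits, NExp.eval, hx, and_true]
      omega
    · rintro s1 hf1 rfl
      refine (expand_runs (q := q) hμ hW (hR.frame hf1) ?_ ?_ ?_).conseq le_rfl
        fun s2 _ h => hI.step ?_
      · simpa using hI.le
      · simp
      · simpa using hi
      · simpa using h

end

end ZeroExt

/-! ### One node of the search tree -/

namespace ZeroExt

open RAM RAM.Program

/-- Look for an unlabelled vertex. -/
def findFree : Program :=
  assign 13 (lit 0) ;;
  forArcs (ite (.eq (cell 6 tl) (lit 0)) (assign 13 (lit 1) ;; assign 12 tl) skip)

/-- Check the number of crossing arcs and the cost of a complete labelling. -/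
def evaluate : Program :=
  assign 14 (lit 0) ;; rassign 1 .zero ;;
  forArcs (ite (.eq (cell 6 tl) (cell 6 hd)) skip (assign 14 (.add (vr 14) (lit 1))) ;;
    rassign 1 (.add (.var 1) (.arr 0 (.add (.mul (.sub (cell 6 tl) (lit 1)) (vr 2))
      (.sub (cell 6 hd) (lit 1)))))) ;;
  ite (.lt (vr 7) (vr 14)) skip
    (ite (.rle (.var 1) (.add (.var 0) (.var 0))) (assign 4 (lit 1)) skip)

/-- Push the current labelling onto the stack, for branching on the vertex in variable `12`. -/
def pushNode : Program :=
  forArcs (store 12 (.add (.mul (vr 15) (vr 0)) tl) (cell 6 tl)) ;;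
  store 13 (vr 15) (vr 12) ;; store 14 (vr 15) (lit 0) ;; assign 15 (.add (vr 15) (lit 1))

/-- Expand all labels, and evaluate the result if it is complete; otherwise push it onto the stack,
unless the stack is full. -/
def processNode : Program :=
  expandAll ;; findFree ;;
    ite (.eq (vr 13) (lit 0)) evaluate (ite (.lt (vr 15) (vr 7)) pushNode skip)

/-- The table of the costs is stored in memory, and half of the threshold `q`. -/
structure Costs (d : ℕ) (μ : ℕ → ℕ → ℝ) (q : ℝ) (s : State) : Prop where
  table : ∀ a b, 1 ≤ a → a ≤ d → 1 ≤ b → b ≤ d → s.rarr 0 ((a - 1) * d + (b - 1)) = μ a b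
  threshold : s.rvar 0 + s.rvar 0 = q

section

variable {W : ℕ} {G : Net} {d K : ℕ} {s : State} {μ : ℕ → ℕ → ℝ} {q : ℝ}

theorem Costs.frame {s' : State} {p : Program} (h : Costs d μ q s) (hp : Frame p s s')
    (hv : 0 ∉ p.wrvars := by decide) (ha : 0 ∉ p.wrarrs := by decide) : Costs d μ q s' where
  table a b := by
    rw [hp.rarr ha]
    exact h.table a b
  threshold := by
    rw [hp.rvar hv]
    exact h.threshold

theorem findFree_runs (hW : Fit W G d K) (hs : Ready G d K s)
    (hL : ∀ v, G.Vert v → s.arr 6 v ≤ d) :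
    Runs W findFree s (40 * G.M + 10) (fun s' =>
      (s'.var 13 = 1 ∧ G.Vert (s'.var 12) ∧ s.arr 6 (s'.var 12) = 0) ∨
      (s'.var 13 = 0 ∧ ∀ v, G.Vert v → s.arr 6 v ≠ 0)) := by
  have := hW.arcs
  have := hW.n_le
  have := hW.d_le
  have h1 : Runs W (assign 13 (lit 0)) s 2 (fun s' => s' = s.setVar 13 0) :=
    (Runs.of_wp (by simp [wp, NExp.Fits, NExp.eval])).conseq le_rfl fun _ _ h => h
  refine (h1.seq (T' := 40 * G.M + 6) ?_).conseq (by omega) fun _ _ h => h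
  rintro s1 - rfl
  refine (Runs.forLoop (T := 32) (I := fun i s' =>
      (s'.var 13 = 1 ∧ G.Vert (s'.var 12) ∧ s.arr 6 (s'.var 12) = 0) ∨
      (s'.var 13 = 0 ∧ ∀ j < i, s.arr 6 (G.T j) ≠ 0))
    (by decide) (by decide) (by decide) (by simpa using hs.M) (by omega) ?_
    ?_ ?_).conseq (by omega) (fun s' hf h => ?_)
  · right
    simp
  · intro i s' v h
    exact h
  · intro i s' hi hf hx hI
    have hR : Ready G d K s' := Ready.frame (s := s.setVar 13 0) ⟨hs.n, hs.d, hs.M, hs.K, hs.T,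
      hs.H, hs.rev, hs.first, hs.next⟩ hf
    have h6 : s'.arr 6 = s.arr 6 := hf.arr (by decide)
    have := G.T_lt hi
    have hv : G.Vert (G.T i) := Net.vert_T hi
    have h3 := hL _ hv
    refine (Runs.of_wp ?_).conseq (T' := 32) (by decide) (fun _ _ h => h)
    simp only [wp, NExp.Fits, NExp.eval, Test.Fits, Test.Holds, hx, h6,
      State.setVar_arr, State.setVar_var, hR.T, Nat.reduceEqDiff, if_true, if_false]
    refine ⟨by clear hI; omega, fun h => ?_, fun h => ?_⟩
    · exact ⟨by clear hI; omega, by clear hI; omega, Or.inl ⟨trivial, hv, h⟩⟩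
    · refine hI.imp_right fun h5 => ⟨h5.1, fun j hj => ?_⟩
      rcases Nat.lt_succ_iff_lt_or_eq.1 hj with h2 | rfl
      · exact h5.2 j h2
      · exact h
  · refine h.imp_right fun h => ⟨h.1, ?_⟩
    rintro v ⟨j, hj, rfl⟩
    exact h.2 j hj

/-- The number of crossing arcs and the cost of `L` are small enough. -/
def Good (G : Net) (μ : ℕ → ℕ → ℝ) (K : ℕ) (q : ℝ) (L : ℕ → ℕ) : Prop :=
  ∑ j ∈ Finset.range G.M, (if L (G.T j) = L (G.H j) then 0 else 1) ≤ K ∧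
    ∑ j ∈ Finset.range G.M, μ (L (G.T j)) (L (G.H j)) ≤ q

theorem good_congr {L L' : ℕ → ℕ} (h : ∀ v, G.Vert v → L v = L' v) :
    Good G μ K q L ↔ Good G μ K q L' := by
  unfold Good
  have h1 : ∀ j ∈ Finset.range G.M, L (G.T j) = L' (G.T j) ∧ L (G.H j) = L' (G.H j) :=
    fun j hj => ⟨h _ (Net.vert_T (Finset.mem_range.1 hj)), h _ (Net.vert_H (Finset.mem_range.1 hj))⟩
  rw [Finset.sum_congr rfl fun j hj => by rw [(h1 j hj).1, (h1 j hj).2],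
    Finset.sum_congr (g := fun j => μ (L' (G.T j)) (L' (G.H j))) rfl
      fun j hj => by rw [(h1 j hj).1, (h1 j hj).2]]

/-- A complete labelling is a solution when it passes the check. -/
theorem good_iff {L : ℕ → ℕ} (hd : 1 ≤ d) (hL : ∀ v, G.Vert v → L v ≠ 0)
    (hLd : ∀ v, G.Vert v → L v ≤ d) :
    Good G μ K q L ↔ ∃ lab, G.Sol d μ K q lab ∧ G.Ext L lab := by
  classical
  constructor
  · intro h
    have hlab : ∀ v, G.Vert v → L v = if G.Vert v then L v else 1 := fun v hv => by simp [hv]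
    rw [good_congr hlab] at h
    refine ⟨fun v => if G.Vert v then L v else 1, ⟨fun v => ?_, h.1, h.2⟩,
      fun v hv _ => (hlab v hv).symm⟩
    split_ifs with hv
    · have := hL v hv
      have := hLd v hv
      omega
    · omega
  · rintro ⟨lab, h, h'⟩
    rw [good_congr (L' := lab) fun v hv => (h' v hv (hL v hv)).symm]
    exact ⟨h.crossing, h.cost⟩

theorem evaluate_runs (hW : Fit W G d K) (hs : Ready G d K s) (hc : Costs d μ q s)
    (hL : ∀ v, G.Vert v → s.arr 6 v ≠ 0) (hLd : ∀ v, G.Vert v → s.arr 6 v ≤ d) :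
    Runs W evaluate s (80 * G.M + 50) (fun s' =>
      (Good G μ K q (s.arr 6) ∧ s'.var 4 = 1) ∨
        (¬ Good G μ K q (s.arr 6) ∧ s'.var 4 = s.var 4)) := by
  have := hW.arcs
  have := hW.n_le
  have hlabel := hW.label
  have := hW.depth
  set s2 := (s.setVar 14 0).setRvar 1 0 with hs2
  have h1 : Runs W (assign 14 (lit 0)) s 2 (fun s' => s' = s.setVar 14 0) :=
    (Runs.of_wp (by simp [wp, NExp.Fits, NExp.eval])).conseq le_rfl fun _ _ h => h
  have h2 : Runs W (rassign 1 .zero) (s.setVar 14 0) 2 (fun s' => s' = s2) :=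
    (Runs.of_wp (by simp [wp, RExp.Fits, RExp.eval, hs2])).conseq le_rfl fun _ _ h => h
  refine (h1.seq (T' := 2 + ((80 * G.M + 6) + 40)) ?_).conseq (by omega) fun _ _ h => h
  rintro s1 - rfl
  refine h2.seq ?_
  rintro s1 - rfl
  have hR2 : Ready G d K s2 := ⟨hs.n, hs.d, hs.M, hs.K, hs.T, hs.H, hs.rev, hs.first, hs.next⟩
  have hloop := Runs.forLoop (W := W) (s := s2) (x := 8) (y := 5) (T := 72) (N := G.M)
    (body := ite (.eq (cell 6 tl) (cell 6 hd)) skip (assign 14 (.add (vr 14) (lit 1))) ;;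
      rassign 1 (.add (.var 1) (.arr 0 (.add (.mul (.sub (cell 6 tl) (lit 1)) (vr 2))
      (.sub (cell 6 hd) (lit 1))))))
    (I := fun i s' =>
      s'.var 14 = ∑ j ∈ Finset.range i, (if s.arr 6 (G.T j) = s.arr 6 (G.H j) then 0 else 1) ∧
      s'.rvar 1 = ∑ j ∈ Finset.range i, μ (s.arr 6 (G.T j)) (s.arr 6 (G.H j)) ∧ s'.var 14 ≤ i)
    (by decide) (by decide) (by decide) hR2.M (by omega) (by simp [hs2]) (fun i s v h => h)
    (by
      rintro i s' hi hf hx ⟨hI1, hI2, hI3⟩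
      have hR := hR2.frame hf
      have h6 : s'.arr 6 = s.arr 6 := hf.arr (by decide)
      have hr : s'.rarr 0 = s.rarr 0 := hf.rarr (by decide)
      have := G.T_lt hi
      have := Net.H_lt hi
      have h7 := hL _ (Net.vert_T hi)
      have h8 := hLd _ (Net.vert_T hi)
      have h9 := hL _ (Net.vert_H hi)
      have h10 := hLd _ (Net.vert_H hi)
      have hmul : (s.arr 6 (G.T i) - 1) * d ≤ d * d := Nat.mul_le_mul_right _ (by omega)
      have htab := hc.table _ _ (by omega) h8 (by omega) h10
      refine (Runs.of_wp ?_).conseq (T' := 72) (by decide) (fun _ _ h => h)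
      simp only [wp, NExp.Fits, NExp.eval, RExp.Fits, RExp.eval, Test.Fits, Test.Holds, hx, h6,
        State.setVar_arr, State.setVar_var, State.setVar_rvar, State.setVar_rarr, hr,
        State.setRvar_var, State.setRvar_rvar, hR.T, hR.H, hR.d, Nat.reduceEqDiff, if_true,
        if_false, htab, hI2, Finset.sum_range_succ, true_and]
      refine ⟨by omega, fun h => ⟨by omega, ?_, by omega⟩,
        fun h => ⟨by omega, by omega, ?_, by omega⟩⟩
      · rw [if_pos h, hI1, add_zero]
      · rw [if_neg h, hI1])
  refine (hloop.conseq (T' := 80 * G.M + 6) (by omega) fun _ _ h => h).seq (T' := 40) ?_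
  rintro s3 hf3 ⟨hI1, hI2, hI3⟩
  have hR3 := hR2.frame hf3
  have hq : s3.rvar 0 + s3.rvar 0 = q := by
    rw [hf3.rvar (by decide)]
    exact hc.threshold
  have h4 : s3.var 4 = s.var 4 := hf3.var (by decide)
  refine (Runs.of_wp ?_).conseq (T' := 40) (by decide) (fun _ _ h => h)
  simp only [wp, NExp.Fits, NExp.eval, RExp.Fits, RExp.eval, Test.Fits, Test.Holds, hR3.K,
    State.setVar_var, if_true, hq, hI2, h4, and_self, true_and]
  refine ⟨by omega, fun h => Or.inr ⟨fun hg => ?_, trivial⟩, fun h => ⟨fun h' => ⟨by omega,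
    Or.inl ⟨⟨by omega, h'⟩, trivial⟩⟩, fun h' => Or.inr ⟨fun hg => h' hg.2, trivial⟩⟩⟩
  have := hg.1
  omega

/-- The labelling in level `l` of the stack. -/
def saved (G : Net) (s : State) (l w : ℕ) : ℕ := s.arr 12 (l * G.n + w)

theorem pushNode_runs (hW : Fit W G d K) (hs : Ready G d K s)
    (hLd : ∀ v, G.Vert v → s.arr 6 v ≤ d) (hv : G.Vert (s.var 12)) (hK : s.var 15 < K) :
    Runs W pushNode s (40 * G.M + 30) (fun s' =>
      (∀ w, G.Vert w → saved G s' (s.var 15) w = s.arr 6 w) ∧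
      (∀ l < s.var 15, ∀ w, G.Vert w → saved G s' l w = saved G s l w) ∧
      s'.arr 13 = Function.update (s.arr 13) (s.var 15) (s.var 12) ∧
      s'.arr 14 = Function.update (s.arr 14) (s.var 15) 0 ∧ s'.var 15 = s.var 15 + 1) := by
  have := hW.arcs
  have := hW.n_le
  have := hW.d_le
  have := hW.depth
  have hst := hW.stack
  have hmul : s.var 15 * G.n ≤ (K + 1) * G.n := Nat.mul_le_mul_right _ (by omega)
  have hloop := Runs.forLoop (W := W) (s := s) (x := 8) (y := 5) (T := 26) (N := G.M)
    (body := store 12 (.add (.mul (vr 15) (vr 0)) tl) (cell 6 tl))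
    (I := fun i s' => (∀ j < i, saved G s' (s.var 15) (G.T j) = s.arr 6 (G.T j)) ∧
      ∀ x < s.var 15 * G.n, s'.arr 12 x = s.arr 12 x)
    (by decide) (by decide) (by decide) hs.M (by omega) (by simp) (fun i s v h => h)
    (by
      rintro i s' hi hf hx ⟨hI, hI'⟩
      have hR := hs.frame hf
      have h6 : s'.arr 6 = s.arr 6 := hf.arr (by decide)
      have h15 : s'.var 15 = s.var 15 := hf.var (by decide)
      have := G.T_lt hi
      have h8 := hLd _ (Net.vert_T hi)
      refine (Runs.of_wp ?_).conseq (T' := 26) (by decide) (fun _ _ h => h)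
      simp only [wp, NExp.Fits, NExp.eval, hx, h6, h15, hR.T, hR.n, saved, State.setArr_arr,
        if_true]
      refine ⟨by omega, by omega, fun j hj => ?_, fun x hx => ?_⟩
      · rw [Function.update_apply]
        split_ifs with h
        · rw [Nat.add_left_cancel h]
        · refine hI j ?_
          rcases Nat.lt_succ_iff_lt_or_eq.1 hj with h2 | rfl
          · exact h2
          · exact (h rfl).elim
      · rw [Function.update_of_ne (by omega)]
        exact hI' x hx)
  refine (hloop.seq (T' := 24) ?_).conseq (by omega) fun _ _ h => h
  rintro s1 hf1 ⟨hI, hI'⟩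
  have h15 : s1.var 15 = s.var 15 := hf1.var (by decide)
  have h12 : s1.var 12 = s.var 12 := hf1.var (by decide)
  have h13 : s1.arr 13 = s.arr 13 := hf1.arr (by decide)
  have h14 : s1.arr 14 = s.arr 14 := hf1.arr (by decide)
  have := hv.lt
  refine (Runs.of_wp ?_).conseq (T' := 24) (by decide) (fun _ _ h => h)
  simp only [wp, NExp.Fits, NExp.eval, State.setArr_arr, State.setArr_var, State.setVar_arr,
    State.setVar_var, Nat.reduceEqDiff, if_true, if_false, h15, h12, h13, h14, saved, and_true]
  refine ⟨by omega, by omega, by omega, by omega, by omega, ?_, fun l hl w hw => ?_⟩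
  · rintro w ⟨j, hj, rfl⟩
    exact hI j hj
  · refine hI' _ ?_
    have h1 : (l + 1) * G.n ≤ s.var 15 * G.n := Nat.mul_le_mul_right _ hl
    have h2 := hw.lt
    rw [Nat.add_mul] at h1
    omega

/-- The level `l` of the stack holds an extension `saved` of the partial labelling `L`, an
unlabelled vertex, and the number of labels that have been tried for this vertex. -/
structure Entry (G : Net) (d : ℕ) (L : ℕ → ℕ) (s : State) (l : ℕ) : Prop where
  ext : G.Ext L (saved G s l)
  le : ∀ w, G.Vert w → saved G s l w ≤ d
  vert : G.Vert (s.arr 13 l)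
  free : saved G s l (s.arr 13 l) = 0
  tried : s.arr 14 l ≤ d

/-- There is a solution that extends the labelling on level `l` of the stack and gives to the
vertex there a label that has not yet been tried. -/
structure Live (G : Net) (d : ℕ) (μ : ℕ → ℕ → ℝ) (K : ℕ) (q : ℝ) (s : State) (l : ℕ) : Prop where
  sol : ∃ lab, G.Sol d μ K q lab ∧ G.Ext (saved G s l) lab ∧ s.arr 14 l < lab (s.arr 13 l)
  normal : ∀ a ∈ Finset.Icc 1 d, G.Normal (saved G s l) a
  potential : l ≤ G.potential d (saved G s l)

theorem Net.Ext.congr_left {L L' lab : ℕ → ℕ} (h : G.Ext L lab)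
    (hL : ∀ v, G.Vert v → L' v = L v) : G.Ext L' lab :=
  fun v hv h1 => by
    rw [hL v hv] at h1 ⊢
    exact h v hv h1

theorem Net.Ext.congr_right {L L' lab : ℕ → ℕ} (h : G.Ext lab L)
    (hL : ∀ v, G.Vert v → L' v = L v) : G.Ext lab L' :=
  fun v hv h1 => by
    rw [hL v hv]
    exact h v hv h1

theorem Net.potential_congr {L L' : ℕ → ℕ} (hL : ∀ v, G.Vert v → L' v = L v) :
    G.potential d L' = G.potential d L :=
  Finset.sum_congr rfl fun a _ => G.bdry_congr fun v hv => by rw [hL v hv]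

/-- The levels `l` of the stacks in two states are the same. -/
structure SameLevel (G : Net) (s s' : State) (l : ℕ) : Prop where
  saved : ∀ w, G.Vert w → saved G s' l w = saved G s l w
  vertex : s'.arr 13 l = s.arr 13 l
  tried : s'.arr 14 l = s.arr 14 l

theorem SameLevel.trans {s' s'' : State} {l : ℕ} (h : SameLevel G s s' l)
    (h' : SameLevel G s' s'' l) : SameLevel G s s'' l :=
  ⟨fun w hw => (h'.saved w hw).trans (h.saved w hw), h'.vertex.trans h.vertex,
    h'.tried.trans h.tried⟩

theorem SameLevel.of_arr {s' : State} (h12 : s'.arr 12 = s.arr 12)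
    (h13 : s'.arr 13 = s.arr 13) (h14 : s'.arr 14 = s.arr 14) (l : ℕ) : SameLevel G s s' l :=
  ⟨fun w _ => by rw [ZeroExt.saved, h12, ZeroExt.saved], by rw [h13], by rw [h14]⟩

theorem SameLevel.entry {s' : State} {l : ℕ} {L : ℕ → ℕ} (h : SameLevel G s s' l)
    (he : Entry G d L s l) : Entry G d L s' l where
  ext := he.ext.congr_right h.saved
  le w hw := by
    rw [h.saved w hw]
    exact he.le w hw
  vert := by
    rw [h.vertex]
    exact he.vert
  free := by
    rw [h.vertex, h.saved _ he.vert]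
    exact he.free
  tried := by
    rw [h.tried]
    exact he.tried

theorem SameLevel.live {s' : State} {l : ℕ} (h : SameLevel G s s' l)
    (hl : Live G d μ K q s l) : Live G d μ K q s' l where
  sol := by
    obtain ⟨lab, h1, h2, h3⟩ := hl.sol
    refine ⟨lab, h1, h2.congr_left h.saved, ?_⟩
    rwa [h.vertex, h.tried]
  normal a ha := (hl.normal a ha).congr h.saved
  potential := by
    rw [Net.potential_congr h.saved]
    exact hl.potential

/-- What the processing of a node achieves, for the labelling `L` at the node. -/
structure Processed (G : Net) (d : ℕ) (μ : ℕ → ℕ → ℝ) (K : ℕ) (q : ℝ) (L : ℕ → ℕ)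
    (s s' : State) : Prop where
  same : ∀ l < s.var 15, SameLevel G s s' l
  stack : s'.var 15 = s.var 15 ∨ (s.var 15 < K ∧ s'.var 15 = s.var 15 + 1 ∧
    Entry G d L s' (s.var 15) ∧ s'.arr 14 (s.var 15) = 0)
  sound : s'.var 4 = s.var 4 ∨ (s'.var 4 = 1 ∧ ∃ lab, G.Sol d μ K q lab ∧ G.Ext L lab)
  complete : (∃ lab, G.Sol d μ K q lab ∧ G.Ext L lab) →
    (∀ L', G.Ext L L' → s.var 15 ≤ G.potential d L') →
    s'.var 4 = 1 ∨ (s'.var 15 = s.var 15 + 1 ∧ Live G d μ K q s' (s.var 15))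

theorem processNode_runs (hμ : IsMetricCost μ) (hd : 1 ≤ d) (hW : Fit W G d K)
    (hs : Ready G d K s) (hc : Costs d μ q s) (hL : ∀ v, G.Vert v → s.arr 6 v ≤ d)
    (hK : s.var 15 ≤ K) :
    Runs W processNode s ((K + 1) * (900 * G.M + 300) * d)
      (fun s' => Processed G d μ K q (s.arr 6) s s') := by
  have := hW.arcs
  have := hW.depth
  have htime : (((K + 1) * (700 * G.M + 200) + 12) * d + 6) +
      ((40 * G.M + 10) + (4 + (80 * G.M + 60))) ≤ (K + 1) * (900 * G.M + 300) * d := by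
    have h1 : 1 * d ≤ (K + 1) * d := Nat.mul_le_mul_right _ (by omega)
    have h2 : 1 * G.M ≤ (K + 1) * d * G.M := Nat.mul_le_mul_right _ (by omega)
    have h3 : (((K + 1) * (700 * G.M + 200) + 12) * d + 6) =
      700 * ((K + 1) * d * G.M) + 200 * ((K + 1) * d) + 12 * d + 6 := by ring
    have h4 : (K + 1) * (900 * G.M + 300) * d =
      900 * ((K + 1) * d * G.M) + 300 * ((K + 1) * d) := by ring
    omega
  refine ((expandAll_runs (q := q) hμ hW hs hL).seq
    (T' := (40 * G.M + 10) + (4 + (80 * G.M + 60))) ?_).conseq htime fun _ _ h => h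
  rintro s1 hf1 hE
  have hR1 := hs.frame hf1
  have hc1 := hc.frame hf1
  refine (findFree_runs hW hR1 hE.le).seq ?_
  rintro s2 hf2 hP
  have hR2 := hR1.frame hf2
  have hc2 := hc1.frame hf2
  have h6 : s2.arr 6 = s1.arr 6 := hf2.arr (by decide)
  have h15 : s2.var 15 = s.var 15 := (hf2.var (by decide)).trans (hf1.var (by decide))
  have h4 : s2.var 4 = s.var 4 := (hf2.var (by decide)).trans (hf1.var (by decide))
  have h12 : s2.arr 12 = s.arr 12 := (hf2.arr (by decide)).trans (hf1.arr (by decide))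
  have h13 : s2.arr 13 = s.arr 13 := (hf2.arr (by decide)).trans (hf1.arr (by decide))
  have h14 : s2.arr 14 = s.arr 14 := (hf2.arr (by decide)).trans (hf1.arr (by decide))
  have hle : s2.var 13 ≤ 1 := by
    rcases hP with h | h <;> omega
  rw [← h6] at hE hP
  refine Runs.ite ?_ (fun hb => ?_) (fun hb => ?_)
  · simp only [Test.Fits, NExp.Fits]
    clear hP
    omega
  · simp only [Test.Holds, NExp.eval] at hb
    have hfull : ∀ v, G.Vert v → s2.arr 6 v ≠ 0 := by
      rcases hP with h | h
      · omega
      · exact h.2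
    refine (evaluate_runs hW hR2 hc2 hfull hE.le).conseq (by omega) fun s3 hf3 hG => ?_
    have g15 : s3.var 15 = s2.var 15 := hf3.var (by decide)
    have g12 : s3.arr 12 = s2.arr 12 := hf3.arr (by decide)
    have g13 : s3.arr 13 = s2.arr 13 := hf3.arr (by decide)
    have g14 : s3.arr 14 = s2.arr 14 := hf3.arr (by decide)
    rw [good_iff hd hfull hE.le] at hG
    refine ⟨fun l _ => .of_arr (g12.trans h12) (g13.trans h13) (g14.trans h14) l,
      Or.inl (g15.trans h15), ?_, ?_⟩
    · rcases hG with ⟨⟨lab, h1, h2⟩, h3⟩ | ⟨-, h3⟩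
      · exact Or.inr ⟨h3, lab, h1, hE.ext.trans h2⟩
      · exact Or.inl (h3.trans h4)
    · rintro ⟨lab, h1, h2⟩ -
      obtain ⟨-, h3⟩ := hE.sol lab h1 h2
      rcases hG with h | h
      · exact Or.inl h.2
      · exact (h.1 h3).elim
  · simp only [Test.Holds, NExp.eval] at hb
    obtain ⟨hv, hv0⟩ : G.Vert (s2.var 12) ∧ s2.arr 6 (s2.var 12) = 0 := by
      rcases hP with h | h
      · exact h.2
      · exact (hb h.1).elim
    refine (Runs.ite (T := 40 * G.M + 30) (Q := fun s' => Processed G d μ K q (s.arr 6) s s')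
      ?_ (fun hb => ?_) (fun hb => ?_)).conseq ?_ fun _ _ h => h
    · have := hR2.K
      simp only [Test.Fits, NExp.Fits]
      omega
    · simp only [Test.Holds, NExp.eval, hR2.K] at hb
      refine (pushNode_runs hW hR2 hE.le hv hb).conseq le_rfl fun s3 hf3 h => ?_
      obtain ⟨k1, k2, k3, k4, k5⟩ := h
      have g4 : s3.var 4 = s2.var 4 := hf3.var (by decide)
      rw [h15] at k1 k2 k3 k4 k5 hb
      have hv3 : s3.arr 13 (s.var 15) = s2.var 12 := by rw [k3, Function.update_self]
      refine ⟨fun l hl => (SameLevel.of_arr h12 h13 h14 l).trans ⟨k2 l hl, ?_, ?_⟩,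
        Or.inr ⟨hb, k5, ⟨hE.ext.congr_right k1, fun w hw => ?_, ?_, ?_, ?_⟩, ?_⟩,
        Or.inl (g4.trans h4), ?_⟩
      · rw [k3, Function.update_of_ne (by omega)]
      · rw [k4, Function.update_of_ne (by omega)]
      · rw [k1 w hw]
        exact hE.le w hw
      · rwa [hv3]
      · rwa [hv3, k1 _ hv]
      · rw [k4, Function.update_self]
        exact Nat.zero_le _
      · rw [k4, Function.update_self]
      · rintro ⟨lab, h1, h2⟩ hpot
        obtain ⟨h3, lab', h5, h7⟩ := hE.sol lab h1 h2
        refine Or.inr ⟨k5, ⟨lab', h5, h7.congr_left k1, ?_⟩, fun a ha => (h3 a ha).congr k1, ?_⟩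
        · rw [k4, Function.update_self]
          exact (h5.range _).1
        · exact hpot _ (hE.ext.congr_right k1)
    · simp only [Test.Holds, NExp.eval, hR2.K] at hb
      refine (Runs.of_wp (p := skip) (Q := fun s' => s' = s2) rfl).conseq ?_ ?_
      · simp only [steps]
        omega
      · rintro s3 - rfl
        refine ⟨fun l _ => .of_arr h12 h13 h14 l, Or.inl h15, Or.inl h4, ?_⟩
        rintro ⟨lab, h1, h2⟩ hpot
        -- A solution would raise the potential beyond the number of its crossing arcs.
        obtain ⟨h3, lab', h5, h7⟩ := hE.sol lab h1 h2
        have h8 := Net.potential_lt h3 h7 hv hv0 (h5.range _).1 (h5.range _).2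
        have h9 := hpot _ hE.ext
        have h10 : G.potential d lab' ≤ K := h5.sum_bdry_le
        omega
    · have : (Test.lt (vr 15) (vr 7)).time = 3 := rfl
      omega

end

end ZeroExt

/-! ### The search tree -/

namespace ZeroExt

open RAM RAM.Program

/-- Copy the labels of the vertices, given by the expression `e` for the vertex `tl`. -/
def fill (e : NExp) : Program := forArcs (store 6 tl e)

/-- The top level of the stack. -/
abbrev top : NExp := .sub (vr 15) (lit 1)

/-- Give the next label to the vertex on the top level of the stack, and process the resulting
node. -/
def nextChild : Program :=
  store 14 top (.add (cell 14 top) (lit 1)) ;;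
    fill (cell 12 (.add (.mul top (vr 0)) tl)) ;;
    store 6 (cell 13 top) (cell 14 top) ;; processNode

/-- Remove the top level of the stack if all its labels have been tried, and try the next label
otherwise. -/
def treeStep : Program :=
  ite (.eq (cell 14 top) (vr 2)) (assign 15 top) nextChild

/-- The algorithm for at least two labels and `0 < k`. -/
def branch : Program :=
  fill (cell 2 tl) ;; processNode ;; loop (.lt (lit 0) (vr 15)) treeStep

/-- A bound on the number of steps in the search tree below a node with `h` free levels above it in
the stack. -/
def budget (d : ℕ) : ℕ → ℕ
  | 0 => 0
  | h + 1 => 1 + d * (1 + budget d h)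

theorem budget_le {d : ℕ} (hd : 1 ≤ d) (h : ℕ) : budget d h + 2 ≤ 2 * (2 * d) ^ h := by
  induction h with
  | zero => simp [budget]
  | succ h ih =>
    have h1 : d * (budget d h + 2) ≤ d * (2 * (2 * d) ^ h) := Nat.mul_le_mul_left _ ih
    have h2 : d * (2 * (2 * d) ^ h) = (2 * d) ^ (h + 1) := by ring
    have h3 : 1 ≤ (2 * d) ^ h := Nat.one_le_pow _ _ (by omega)
    have h4 : (2 * d) ^ (h + 1) = (2 * d) ^ h * (2 * d) := pow_succ _ _
    have h5 : 1 * (2 * d) ≤ (2 * d) ^ h * (2 * d) := Nat.mul_le_mul_right _ h3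
    have h6 : d * (budget d h + 2) = d * budget d h + 2 * d := by ring
    have h7 : d * (1 + budget d h) = d * budget d h + d := by ring
    simp only [budget]
    omega

/-- The number of steps that the levels of the stack may still cause. -/
def pending (d K : ℕ) (s : State) : ℕ :=
  ∑ l ∈ Finset.range (s.var 15), (1 + (d - s.arr 14 l) * (1 + budget d (K - (l + 1))))

section

variable {W : ℕ} {G : Net} {d K : ℕ} {s : State} {μ : ℕ → ℕ → ℝ} {q : ℝ}

theorem fill_runs (hW : Fit W G d K) (hs : Ready G d K s) {e : NExp} {g : ℕ → ℕ}
    (ht : e.time ≤ 10)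
    (he : ∀ i s', i < G.M → Frame (fill e) s s' → Ready G d K s' → s'.var 8 = i →
      e.Fits W s' ∧ e.eval s' = g (G.T i)) :
    Runs W (fill e) s (30 * G.M + 10) (fun s' => ∀ v, G.Vert v → s'.arr 6 v = g v) := by
  have := hW.arcs
  have := hW.n_le
  refine (Runs.forLoop (T := 16) (I := fun i s' => ∀ j < i, s'.arr 6 (G.T j) = g (G.T j))
    (by simp [wvars]) (by simp [wvars]) (by simp) hs.M (by omega) (by simp) (fun i s v h => h)
    ?_).conseq (by omega) fun s' _ h => ?_
  · intro i s' hi hf hx hI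
    have hR : Ready G d K s' := hs.frame hf (by simp [wvars, forLoop])
      (by simp [warrs, forLoop])
    obtain ⟨h1, h2⟩ := he i s' hi hf hR hx
    have := G.T_lt hi
    refine (Runs.of_wp ?_).conseq (T' := 16) ?_ (fun _ _ h => h)
    · simp only [wp, NExp.Fits, NExp.eval, hx, hR.T, h2, State.setArr_arr, if_true]
      refine ⟨by omega, h1, fun j hj => ?_⟩
      rw [Function.update_apply]
      split_ifs with h
      · rw [h]
      · refine hI j ?_
        rcases Nat.lt_succ_iff_lt_or_eq.1 hj with h2 | rfl
        · exact h2
        · exact (h rfl).elim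
    · simp only [steps, NExp.time]
      omega
  · rintro v ⟨j, hj, rfl⟩
    exact h j hj

/-- The invariant of the search: the answer is sound, and while it is negative, any solution that
extends the partial labelling `L` gives rise to one below a live level of the stack. -/
structure SearchInv (G : Net) (d : ℕ) (μ : ℕ → ℕ → ℝ) (K : ℕ) (q : ℝ) (L : ℕ → ℕ)
    (s : State) : Prop where
  depth : s.var 15 ≤ K
  entry : ∀ l < s.var 15, Entry G d L s l
  sound : s.var 4 = 0 ∨ (s.var 4 = 1 ∧ ∃ lab, G.Sol d μ K q lab ∧ G.Ext L lab)
  complete : (∃ lab, G.Sol d μ K q lab ∧ G.Ext L lab) →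
    s.var 4 = 1 ∨ ∃ l < s.var 15, Live G d μ K q s l

theorem Processed.searchInv {L L' : ℕ → ℕ} {s' : State} (h : Processed G d μ K q L' s s')
    (hdepth : s.var 15 ≤ K) (hentry : ∀ l < s.var 15, Entry G d L s l)
    (hsound : s.var 4 = 0 ∨ (s.var 4 = 1 ∧ ∃ lab, G.Sol d μ K q lab ∧ G.Ext L lab))
    (hL : G.Ext L L')
    (hcomplete : (∃ lab, G.Sol d μ K q lab ∧ G.Ext L lab) →
      s.var 4 = 1 ∨ (∃ l < s.var 15, Live G d μ K q s l) ∨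
      ((∃ lab, G.Sol d μ K q lab ∧ G.Ext L' lab) ∧
        ∀ L'', G.Ext L' L'' → s.var 15 ≤ G.potential d L'')) :
    SearchInv G d μ K q L s' ∧ pending d K s' ≤ pending d K s + budget d (K - s.var 15) := by
  have hsum : ∑ l ∈ Finset.range (s.var 15),
      (1 + (d - s'.arr 14 l) * (1 + budget d (K - (l + 1)))) = pending d K s :=
    Finset.sum_congr rfl fun l hl => by rw [(h.same l (Finset.mem_range.1 hl)).tried]
  refine ⟨⟨?_, fun l hl => ?_, ?_, fun hsol => ?_⟩, ?_⟩
  · rcases h.stack with h1 | h1 <;> omega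
  · by_cases hl' : l < s.var 15
    · exact (h.same l hl').entry (hentry l hl')
    · rcases h.stack with h1 | ⟨-, h1, h2, -⟩
      · omega
      · have : l = s.var 15 := by omega
        subst this
        exact ⟨hL.trans h2.ext, h2.le, h2.vert, h2.free, h2.tried⟩
  · rcases h.sound with h1 | ⟨h1, lab, h2, h3⟩
    · rwa [h1]
    · exact Or.inr ⟨h1, lab, h2, hL.trans h3⟩
  · have hdepth' : s.var 15 ≤ s'.var 15 := by
      rcases h.stack with h1 | h1 <;> omega
    rcases hcomplete hsol with h1 | ⟨l, hl, h1⟩ | ⟨h1, h2⟩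
    · left
      rcases h.sound with h2 | h2
      · exact h2.trans h1
      · exact h2.1
    · exact Or.inr ⟨l, by omega, (h.same l hl).live h1⟩
    · refine (h.complete h1 h2).imp_right fun h3 => ⟨_, by omega, h3.2⟩
  · rcases h.stack with h1 | ⟨h1, h2, -, h3⟩
    · rw [pending, h1, hsum]
      exact Nat.le_add_right _ _
    · rw [pending, h2, Finset.sum_range_succ, hsum, h3]
      obtain ⟨e, he⟩ : ∃ e, K - s.var 15 = e + 1 := ⟨K - s.var 15 - 1, by omega⟩
      have he' : K - (s.var 15 + 1) = e := by omega
      rw [he, he', budget, Nat.sub_zero]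

theorem nextChild_runs (hμ : IsMetricCost μ) (hd : 1 ≤ d) (hW : Fit W G d K)
    (hs : Ready G d K s) (hc : Costs d μ q s) {L : ℕ → ℕ} (hI : SearchInv G d μ K q L s)
    (hpos : 0 < s.var 15) (hlt : s.arr 14 (s.var 15 - 1) ≠ d) :
    Runs W nextChild s ((K + 1) * (1000 * G.M + 400) * d)
      (fun s' => SearchInv G d μ K q L s' ∧ pending d K s' < pending d K s) := by
  have := hW.arcs
  have := hW.n_le
  have := hW.d_le
  have := hW.depth
  have := hW.stack
  obtain ⟨t, ht⟩ : ∃ t, s.var 15 = t + 1 := ⟨s.var 15 - 1, by omega⟩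
  rw [ht, Nat.add_sub_cancel] at hlt
  have hEt := hI.entry t (by omega)
  have htried : s.arr 14 t < d := lt_of_le_of_ne hEt.tried hlt
  have hdepth := hI.depth
  have hmul : t * G.n ≤ (K + 1) * G.n := Nat.mul_le_mul_right _ (by omega)
  have htime : 12 + ((30 * G.M + 10) + (12 + (K + 1) * (900 * G.M + 300) * d)) ≤
      (K + 1) * (1000 * G.M + 400) * d := by
    have h1 : 1 * 1 ≤ (K + 1) * d := Nat.mul_le_mul (by omega) hd
    have h2 : 1 * G.M ≤ (K + 1) * d * G.M := Nat.mul_le_mul_right _ (by omega)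
    have h3 : (K + 1) * (1000 * G.M + 400) * d = (K + 1) * (900 * G.M + 300) * d +
      100 * ((K + 1) * d * G.M) + 100 * ((K + 1) * d) := by ring
    omega
  set s1 := s.setArr 14 t (s.arr 14 t + 1) with hs1
  refine (Runs.seq (T := 12) (T' := (30 * G.M + 10) + (12 + (K + 1) * (900 * G.M + 300) * d))
    (Q := fun s' => s' = s1) ?_ ?_).conseq htime fun _ _ h => h
  · refine (Runs.of_wp ?_).conseq (by decide) fun _ _ h => h
    simp only [wp, NExp.Fits, NExp.eval, ht, Nat.add_sub_cancel, hs1, and_true]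
    omega
  rintro _ hf1 rfl
  have hR1 := hs.frame hf1
  have hc1 := hc.frame hf1
  have f15 : s1.var 15 = t + 1 := ht
  have f4 : s1.var 4 = s.var 4 := rfl
  have f12 : s1.arr 12 = s.arr 12 := by simp [hs1]
  have f13 : s1.arr 13 = s.arr 13 := by simp [hs1]
  have f14 : s1.arr 14 = Function.update (s.arr 14) t (s.arr 14 t + 1) := by simp [hs1]
  refine (fill_runs hW hR1 (g := saved G s t) (by decide) ?_).seq ?_
  · intro i s' hi hf hR hx
    have g15 : s'.var 15 = t + 1 := (hf.var (by decide)).trans f15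
    have g12 : s'.arr 12 = s.arr 12 := (hf.arr (by decide)).trans f12
    have h1 := G.T_lt hi
    have h2 := hEt.le _ (Net.vert_T hi)
    simp only [saved] at h2
    simp only [NExp.Fits, NExp.eval, g15, g12, hR.n, hR.T, hx, Nat.add_sub_cancel, saved, and_true]
    omega
  intro s2 hf2 hfill
  have hR2 := hR1.frame hf2
  have hc2 := hc1.frame hf2
  have g15 : s2.var 15 = t + 1 := (hf2.var (by decide)).trans f15
  have g4 : s2.var 4 = s.var 4 := (hf2.var (by decide)).trans f4
  have g12 : s2.arr 12 = s.arr 12 := (hf2.arr (by decide)).trans f12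
  have g13 : s2.arr 13 = s.arr 13 := (hf2.arr (by decide)).trans f13
  have g14 : s2.arr 14 = _ := (hf2.arr (by decide)).trans f14
  set v := s.arr 13 t with hv
  set s3 := s2.setArr 6 v (s.arr 14 t + 1) with hs3
  have hvlt := hEt.vert.lt
  refine (Runs.seq (T := 12) (Q := fun s' => s' = s3) ?_ ?_)
  · refine (Runs.of_wp ?_).conseq (by decide) fun _ _ h => h
    simp only [wp, NExp.Fits, NExp.eval, g15, Nat.add_sub_cancel, g13, g14,
      Function.update_self, ← hv, hs3, and_true]
    omega
  rintro _ hf3 rfl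
  have hR3 := hR2.frame hf3
  have hc3 := hc2.frame hf3
  have k6 : ∀ w, G.Vert w → s3.arr 6 w = if w = v then s.arr 14 t + 1 else saved G s t w := by
    intro w hw
    simp only [hs3, State.setArr_arr, if_true, Function.update_apply, hfill w hw]
  have k15 : s3.var 15 = t + 1 := g15
  have k4 : s3.var 4 = s.var 4 := g4
  have k12 : s3.arr 12 = s.arr 12 := by simp [hs3, g12]
  have k13 : s3.arr 13 = s.arr 13 := by simp [hs3, g13]
  have k14 : s3.arr 14 = Function.update (s.arr 14) t (s.arr 14 t + 1) := by simp [hs3, g14]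
  have hsaved : ∀ l, saved G s3 l = saved G s l := fun l => by
    funext w
    rw [saved, k12, saved]
  have hext : G.Ext (saved G s t) (s3.arr 6) := by
    intro w hw hw0
    rw [k6 w hw, if_neg]
    rintro rfl
    exact hw0 hEt.free
  have hsame : ∀ l < t, SameLevel G s s3 l := fun l hl =>
    ⟨fun w _ => by rw [hsaved], by rw [k13], by rw [k14, Function.update_of_ne (by omega)]⟩
  refine (processNode_runs (q := q) hμ hd hW hR3 hc3 (fun w hw => ?_) (by omega)).conseq le_rfl
    fun s4 _ hP => ?_
  · rw [k6 w hw]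
    split_ifs
    · omega
    · exact hEt.le w hw
  have hpend : pending d K s3 + (1 + budget d (K - (t + 1))) = pending d K s := by
    rw [pending, pending, k15, ht, Finset.sum_range_succ, Finset.sum_range_succ,
      Finset.sum_congr rfl fun l hl => by rw [(hsame l (Finset.mem_range.1 hl)).tried], k14,
      Function.update_self]
    obtain ⟨e, he⟩ : ∃ e, d - s.arr 14 t = e + 1 := ⟨d - s.arr 14 t - 1, by omega⟩
    have he' : d - (s.arr 14 t + 1) = e := by omega
    rw [he, he']
    ring
  have hentry : ∀ l < s3.var 15, Entry G d L s3 l := by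
    intro l hl
    by_cases hl' : l < t
    · exact (hsame l hl').entry (hI.entry l (by omega))
    · have : l = t := by omega
      subst this
      refine ⟨by rw [hsaved]; exact hEt.ext, by rw [hsaved]; exact hEt.le, by rw [k13]; exact hEt.vert,
        by rw [hsaved, k13]; exact hEt.free, ?_⟩
      rw [k14, Function.update_self]
      exact htried
  have hcomplete : (∃ lab, G.Sol d μ K q lab ∧ G.Ext L lab) → s3.var 4 = 1 ∨
      (∃ l < s3.var 15, Live G d μ K q s3 l) ∨
      ((∃ lab, G.Sol d μ K q lab ∧ G.Ext (s3.arr 6) lab) ∧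
        ∀ L'', G.Ext (s3.arr 6) L'' → s3.var 15 ≤ G.potential d L'') := by
    intro hsol
    rcases hI.complete hsol with h1 | ⟨l, hl, h1⟩
    · exact Or.inl (k4.trans h1)
    · refine Or.inr ?_
      by_cases hl' : l < t
      · exact Or.inl ⟨l, by omega, (hsame l hl').live h1⟩
      · have : l = t := by omega
        subst this
        obtain ⟨lab, hlab, hlabL, hlablt⟩ := h1.sol
        rw [← hv] at hlablt
        have hvert : G.Vert v := hEt.vert
        have hfree : saved G s l v = 0 := hEt.free
        by_cases heq : lab v = s.arr 14 l + 1
        · -- The solution gives the next label to the vertex, so it extends the new labelling.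
          refine Or.inr ⟨⟨lab, hlab, fun w hw hw0 => ?_⟩, fun L'' hL'' => ?_⟩
          · rw [k6 w hw] at hw0 ⊢
            split_ifs at hw0 ⊢ with hwv
            · rw [hwv, heq]
            · exact hlabL w hw hw0
          · have hL''v : L'' v = s.arr 14 l + 1 := by
              have := k6 v hvert
              rw [if_pos rfl] at this
              rw [hL'' v hvert (by omega), this]
            have h3 := Net.potential_lt h1.normal (hext.trans hL'') hvert hfree (by omega)
              (by omega)
            have := h1.potential
            omega
        · refine Or.inl ⟨l, by omega, ⟨lab, hlab, by rwa [hsaved], ?_⟩, by rw [hsaved]; exact h1.normal,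
            by rw [hsaved]; exact h1.potential⟩
          rw [k14, k13, Function.update_self, ← hv]
          omega
  obtain ⟨h1, h2⟩ := hP.searchInv (by omega) hentry (by rw [k4]; exact hI.sound)
    (hEt.ext.trans hext) hcomplete
  refine ⟨h1, ?_⟩
  rw [k15] at h2
  omega

theorem treeStep_runs (hμ : IsMetricCost μ) (hd : 1 ≤ d) (hW : Fit W G d K)
    (hs : Ready G d K s) (hc : Costs d μ q s) {L : ℕ → ℕ} (hI : SearchInv G d μ K q L s)
    (hpos : 0 < s.var 15) :
    Runs W treeStep s (7 + (K + 1) * (1000 * G.M + 400) * d)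
      (fun s' => SearchInv G d μ K q L s' ∧ pending d K s' < pending d K s) := by
  have := hW.d_le
  have := hW.depth
  have hdepth := hI.depth
  obtain ⟨t, ht⟩ : ∃ t, s.var 15 = t + 1 := ⟨s.var 15 - 1, by omega⟩
  have hEt := hI.entry t (by omega)
  have htried := hEt.tried
  refine (Runs.ite (T := (K + 1) * (1000 * G.M + 400) * d) ?_ (fun hb => ?_)
    (fun hb => ?_)).conseq le_rfl fun _ _ h => h
  · simp only [Test.Fits, NExp.Fits, NExp.eval, ht, Nat.add_sub_cancel, hs.d]
    omega
  · simp only [Test.Holds, NExp.eval, ht, Nat.add_sub_cancel, hs.d] at hb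
    refine (Runs.of_wp (Q := fun s' => s' = s.setVar 15 t) ?_).conseq ?_ ?_
    · simp only [wp, NExp.Fits, NExp.eval, ht, Nat.add_sub_cancel, and_true]
      omega
    · have h1 : 1 * 1 ≤ (K + 1) * d := Nat.mul_le_mul (by omega) hd
      have h3 : (K + 1) * (1000 * G.M + 400) * d =
        1000 * ((K + 1) * d * G.M) + 400 * ((K + 1) * d) := by ring
      simp only [steps, NExp.time]
      omega
    · rintro s' - rfl
      have hsame : ∀ l, SameLevel G s (s.setVar 15 t) l := SameLevel.of_arr rfl rfl rfl
      refine ⟨⟨by simp; omega, fun l hl => (hsame l).entry (hI.entry l ?_), by simpa using hI.sound,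
        fun hsol => ?_⟩, ?_⟩
      · simp at hl
        omega
      · refine (hI.complete hsol).imp (by simp) ?_
        rintro ⟨l, hl, hlive⟩
        refine ⟨l, ?_, (hsame l).live hlive⟩
        -- A level on which all labels have been tried is not live.
        obtain ⟨lab, h1, -, h3⟩ := hlive.sol
        have := (h1.range (s.arr 13 l)).2
        have : l ≠ t := by
          rintro rfl
          omega
        simp
        omega
      · rw [pending, pending, ht, Finset.sum_range_succ]
        simp
  · simp only [Test.Holds, NExp.eval, hs.d] at hb
    exact nextChild_runs hμ hd hW hs hc hI hpos hb

theorem branch_runs (hμ : IsMetricCost μ) (hd : 1 ≤ d) (hW : Fit W G d K)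
    (hs : Ready G d K s) (hc : Costs d μ q s) (hτ : ∀ v, G.Vert v → s.arr 2 v ≤ d)
    (h4 : s.var 4 = 0) (h15 : s.var 15 = 0) :
    Runs W branch s ((K + 1) * (1100 * G.M + 500) * d * (budget d K + 2)) (fun s' =>
      ((∃ lab, G.Sol d μ K q lab ∧ G.Ext (s.arr 2) lab) → s'.var 4 = 1) ∧
      (¬ (∃ lab, G.Sol d μ K q lab ∧ G.Ext (s.arr 2) lab) → s'.var 4 = 0)) := by
  have := hW.arcs
  have := hW.n_le
  have := hW.d_le
  have := hW.depth
  have htime : (30 * G.M + 10) + ((K + 1) * (900 * G.M + 300) * d +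
      ((3 + 1 + (7 + (K + 1) * (1000 * G.M + 400) * d)) * budget d K + 4)) ≤
      (K + 1) * (1100 * G.M + 500) * d * (budget d K + 2) := by
    have h1 : 1 * 1 ≤ (K + 1) * d := Nat.mul_le_mul (by omega) hd
    have h2 : 1 * G.M ≤ (K + 1) * d * G.M := Nat.mul_le_mul_right _ (by omega)
    have h3 : 11 + (K + 1) * (1000 * G.M + 400) * d ≤ (K + 1) * (1100 * G.M + 500) * d := by
      have h4 : (K + 1) * (1100 * G.M + 500) * d = (K + 1) * (1000 * G.M + 400) * d +
        100 * ((K + 1) * d * G.M) + 100 * ((K + 1) * d) := by ring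
      omega
    have h5 := Nat.mul_le_mul_right (budget d K) h3
    have h6 : (K + 1) * (1100 * G.M + 500) * d * (budget d K + 2) =
      (K + 1) * (1100 * G.M + 500) * d * budget d K + (K + 1) * (900 * G.M + 300) * d +
        1300 * ((K + 1) * d * G.M) + 700 * ((K + 1) * d) := by ring
    have h7 : 3 + 1 + (7 + (K + 1) * (1000 * G.M + 400) * d) =
      11 + (K + 1) * (1000 * G.M + 400) * d := by ring
    rw [h7]
    omega
  refine ((fill_runs hW hs (g := s.arr 2) (by decide) ?_).seq
    (T' := (K + 1) * (900 * G.M + 300) * d +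
      ((3 + 1 + (7 + (K + 1) * (1000 * G.M + 400) * d)) * budget d K + 4)) ?_).conseq htime
    fun _ _ h => h
  · intro i s' hi hf hR hx
    have g2 : s'.arr 2 = s.arr 2 := hf.arr (by decide)
    have h1 := G.T_lt hi
    have h2 := hτ _ (Net.vert_T hi)
    simp only [NExp.Fits, NExp.eval, g2, hR.T, hx, and_true]
    omega
  intro s1 hf1 h6
  have hR1 := hs.frame hf1
  have hc1 := hc.frame hf1
  have g15 : s1.var 15 = 0 := (hf1.var (by decide)).trans h15
  have g4 : s1.var 4 = 0 := (hf1.var (by decide)).trans h4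
  refine (processNode_runs (q := q) hμ hd hW hR1 hc1
    (fun v hv => by rw [h6 v hv]; exact hτ v hv) (by omega)).seq ?_
  intro s2 hf2 hP
  have hR2 := hR1.frame hf2
  have hc2 := hc1.frame hf2
  obtain ⟨hI, hpend⟩ := hP.searchInv (L := s.arr 2) (by omega) (fun l hl => by omega) (Or.inl g4)
    (fun v hv _ => h6 v hv) (fun ⟨lab, h1, h2⟩ => Or.inr (Or.inr
      ⟨⟨lab, h1, h2.congr_left h6⟩, fun _ _ => by omega⟩))
  have hp0 : pending d K s1 = 0 := by rw [pending, g15, Finset.sum_range_zero]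
  rw [hp0, g15, zero_add, Nat.sub_zero] at hpend
  refine (Runs.loop (T := 7 + (K + 1) * (1000 * G.M + 400) * d) (N := pending d K s2)
    (I := fun r s' => SearchInv G d μ K q (s.arr 2) s' ∧ r = pending d K s') ⟨hI, rfl⟩
    ?_ ?_).conseq ?_ ?_
  · rintro r s' - ⟨hI', -⟩
    have := hI'.depth
    simp only [Test.Fits, NExp.Fits]
    omega
  · rintro r s' hfr ⟨hI', rfl⟩ hb
    simp only [Test.Holds, NExp.eval] at hb
    refine (treeStep_runs hμ hd hW (hR2.frame hfr) (hc2.frame hfr) hI' hb).conseq le_rfl ?_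
    rintro s'' - ⟨h1, h2⟩
    exact ⟨_, h2, h1, rfl⟩
  · exact Nat.add_le_add_right (Nat.mul_le_mul_left _ hpend) _
  · rintro s' - ⟨⟨r, hI', -⟩, hb⟩
    simp only [Test.Holds, NExp.eval, not_lt] at hb
    refine ⟨fun hsol => ?_, fun hsol => ?_⟩
    · rcases hI'.complete hsol with h | ⟨l, hl, -⟩
      · exact h
      · omega
    · rcases hI'.sound with h | h
      · exact h
      · exact (hsol h.2).elim

end

end ZeroExt

/-! ### The case of one label, and the case without crossing edges -/

namespace ZeroExt

open RAM RAM.Program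

/-- Accept if the marks agree along all arcs and the threshold is nonnegative. -/
def checkMarks : Program :=
  assign 13 (lit 0) ;;
  forArcs (ite (.eq (cell 8 tl) (cell 8 hd)) skip (assign 13 (lit 1))) ;;
  ite (.eq (vr 13) (lit 0)) (ite (.rle .zero (.var 0)) (assign 4 (lit 1)) skip) skip

/-- The algorithm for the case in which solutions have no crossing edges: labels are propagated
along edges, by the residual search with the zero flow in which all labelled vertices are
sources. -/
def propagate : Program := fill (cell 2 tl) ;; clearFlow ;; search ;; checkMarks

section

variable {W : ℕ} {G : Net} {d K : ℕ} {s : State} {μ : ℕ → ℕ → ℝ} {q : ℝ}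

theorem checkMarks_runs (hW : Fit W G d K) (hs : Ready G d K s)
    (hm : ∀ v, G.Vert v → s.arr 8 v ≤ d) (h4 : s.var 4 = 0) :
    Runs W checkMarks s (40 * G.M + 40) (fun s' =>
      (((∀ j < G.M, s.arr 8 (G.T j) = s.arr 8 (G.H j)) ∧ 0 ≤ s.rvar 0) → s'.var 4 = 1) ∧
      (¬ ((∀ j < G.M, s.arr 8 (G.T j) = s.arr 8 (G.H j)) ∧ 0 ≤ s.rvar 0) → s'.var 4 = 0)) := by
  have := hW.arcs
  have := hW.n_le
  have := hW.d_le
  have h1 : Runs W (assign 13 (lit 0)) s 2 (fun s' => s' = s.setVar 13 0) :=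
    (Runs.of_wp (by simp [wp, NExp.Fits, NExp.eval])).conseq le_rfl fun _ _ h => h
  refine (h1.seq (T' := (40 * G.M + 6) + 30) ?_).conseq (by omega) fun _ _ h => h
  rintro s1 - rfl
  have hR1 : Ready G d K (s.setVar 13 0) :=
    ⟨hs.n, hs.d, hs.M, hs.K, hs.T, hs.H, hs.rev, hs.first, hs.next⟩
  have hloop := Runs.forLoop (W := W) (s := s.setVar 13 0) (x := 8) (y := 5) (T := 32) (N := G.M)
    (body := ite (.eq (cell 8 tl) (cell 8 hd)) skip (assign 13 (lit 1)))
    (I := fun i s' => (s'.var 13 = 0 ∧ ∀ j < i, s.arr 8 (G.T j) = s.arr 8 (G.H j)) ∨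
      (s'.var 13 = 1 ∧ ∃ j < G.M, s.arr 8 (G.T j) ≠ s.arr 8 (G.H j)))
    (by decide) (by decide) (by decide) hR1.M (by omega) (by left; simp) (fun i s v h => h)
    (by
      rintro i s' hi hf hx hI
      have hR := hR1.frame hf
      have h8 : s'.arr 8 = s.arr 8 := hf.arr (by decide)
      have := G.T_lt hi
      have := Net.H_lt hi
      have := hm _ (Net.vert_T hi)
      have := hm _ (Net.vert_H hi)
      refine (Runs.of_wp ?_).conseq (T' := 32) (by decide) (fun _ _ h => h)
      simp only [wp, NExp.Fits, NExp.eval, Test.Fits, Test.Holds, hx, h8, hR.T, hR.H,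
        State.setVar_var, if_true]
      refine ⟨by clear hI; omega, fun h => ?_, fun h => ⟨by clear hI; omega,
        Or.inr ⟨trivial, i, hi, h⟩⟩⟩
      refine hI.imp_left fun h5 => ⟨h5.1, fun j hj => ?_⟩
      rcases Nat.lt_succ_iff_lt_or_eq.1 hj with h2 | rfl
      · exact h5.2 j h2
      · exact h)
  refine (hloop.conseq (T' := 40 * G.M + 6) (by omega) fun _ _ h => h).seq ?_
  intro s3 hf3 hI
  have h4' : s3.var 4 = 0 := (hf3.var (by decide)).trans h4
  have hr : s3.rvar 0 = s.rvar 0 := hf3.rvar (by decide)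
  have h13 : s3.var 13 ≤ 1 := by
    rcases hI with h | h <;> omega
  have hcond : s3.var 13 = 0 ↔ ∀ j < G.M, s.arr 8 (G.T j) = s.arr 8 (G.H j) := by
    rcases hI with ⟨h, h'⟩ | ⟨h, j, hj, h'⟩
    · exact ⟨fun _ => h', fun _ => h⟩
    · exact ⟨fun h2 => by omega, fun h2 => (h' (h2 j hj)).elim⟩
  refine (Runs.of_wp ?_).conseq (T' := 30) (by decide) (fun _ _ h => h)
  simp only [wp, NExp.Fits, NExp.eval, RExp.Fits, RExp.eval, Test.Fits, Test.Holds,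
    State.setVar_var, if_true, hr, hcond, h4']
  refine ⟨by clear hI hcond; omega, fun h => ⟨⟨trivial, trivial⟩, fun h' => ⟨by clear hI hcond; omega,
    fun _ => trivial, fun h2 => (h2 ⟨h, h'⟩).elim⟩, fun h' => ⟨fun h2 => (h' h2.2).elim,
    fun _ => trivial⟩⟩, fun h => ⟨fun h2 => (h h2.1).elim, fun _ => trivial⟩⟩

/-- If solutions have no crossing edges, then one exists if and only if no edge joins vertices with
different marks, since all vertices that are connected to labelled ones are marked. -/
theorem exists_sol_iff (hμ : IsMetricCost μ) (hd : 1 ≤ d) (hdK : d = 1 ∨ K = 0)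
    {L f mark par pos : ℕ → ℕ} (hS : G.Searched L 0 f d mark par pos)
    (hf : ∀ j < G.M, f j = 0) :
    (∃ lab, G.Sol d μ K q lab ∧ G.Ext L lab) ↔
      (∀ j < G.M, mark (G.T j) = mark (G.H j)) ∧ 0 ≤ q := by
  classical
  constructor
  · rintro ⟨lab, h, hL⟩
    have hcross : ∀ j < G.M, lab (G.T j) = lab (G.H j) := by
      intro j hj
      rcases hdK with h1 | h1
      · have h2 := h.range (G.T j)
        have h3 := h.range (G.H j)
        omega
      · by_contra h2
        have h3 := h.crossing
        rw [h1, Nat.le_zero, Finset.sum_eq_zero_iff] at h3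
        have := h3 j (Finset.mem_range.2 hj)
        simp [h2] at this
    refine ⟨fun j hj => ?_, (Finset.sum_nonneg fun j _ => hμ.nonneg _ _).trans h.cost⟩
    have h1 := hS.closed j hj
    have h2 := hS.closed _ (G.rev_lt hj)
    rw [G.T_rev hj, G.H_rev hj] at h2
    by_cases hT : mark (G.T j) = 0
    · rw [hT]
      by_contra hH
      exact h2 (Ne.symm hH) (hf _ (G.rev_lt hj)) hT
    · rw [hS.mark_eq hL hcross (Net.vert_T hj) hT,
        hS.mark_eq hL hcross (Net.vert_H hj) (h1 hT (hf j hj)), hcross j hj]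
  · rintro ⟨h, hq⟩
    set lab : ℕ → ℕ := fun v => if mark v = 0 ∨ ¬ G.Vert v then 1 else mark v with hlab
    have heq : ∀ j ∈ Finset.range G.M, lab (G.T j) = lab (G.H j) := by
      intro j hj
      rw [Finset.mem_range] at hj
      simp only [hlab, h j hj, Net.vert_T hj, Net.vert_H hj]
    refine ⟨lab, ⟨fun v => ?_, ?_, ?_⟩, fun v hv hLv => ?_⟩
    · simp only [hlab]
      split_ifs with h1
      · omega
      · push Not at h1
        have := hS.mark_le v h1.2
        omega
    · rw [Finset.sum_eq_zero fun j hj => by rw [if_pos (heq j hj)]]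
      exact Nat.zero_le _
    · rw [Finset.sum_eq_zero fun j hj => by rw [heq j hj, hμ.diag]]
      exact hq
    · have h1 := hS.source v hv hLv hLv
      simp [hlab, h1, hLv, hv]

theorem propagate_runs (hμ : IsMetricCost μ) (hd : 1 ≤ d) (hdK : d = 1 ∨ K = 0) (hW : Fit W G d K)
    (hs : Ready G d K s) (hc : Costs d μ q s) (hτ : ∀ v, G.Vert v → s.arr 2 v ≤ d)
    (h4 : s.var 4 = 0) (h6 : s.var 6 = 0) :
    Runs W propagate s (500 * G.M + 100) (fun s' =>
      ((∃ lab, G.Sol d μ K q lab ∧ G.Ext (s.arr 2) lab) → s'.var 4 = 1) ∧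
      (¬ (∃ lab, G.Sol d μ K q lab ∧ G.Ext (s.arr 2) lab) → s'.var 4 = 0)) := by
  have := hW.arcs
  have := hW.n_le
  have := hW.d_le
  refine ((fill_runs hW hs (g := s.arr 2) (by decide) ?_).seq
    (T' := (20 * G.M + 10) + ((400 * G.M + 40) + (40 * G.M + 40))) ?_).conseq (by omega)
    fun _ _ h => h
  · intro i s' hi hf hR hx
    have g2 : s'.arr 2 = s.arr 2 := hf.arr (by decide)
    have h1 := G.T_lt hi
    have h2 := hτ _ (Net.vert_T hi)
    simp only [NExp.Fits, NExp.eval, g2, hR.T, hx, and_true]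
    omega
  intro s1 hf1 hL
  have hR1 := hs.frame hf1
  refine (clearFlow_runs hW hR1).seq ?_
  intro s2 hf2 h7
  have hR2 := hR1.frame hf2
  have k6 : s2.arr 6 = s1.arr 6 := hf2.arr (by decide)
  have k6' : s2.var 6 = 0 := (hf2.var (by decide)).trans ((hf1.var (by decide)).trans h6)
  refine (search_runs hW hR2 (fun v hv => by rw [k6, hL v hv]; exact hτ v hv) (by omega)
    (fun j hj => by rw [h7 j hj]; omega)).seq ?_
  intro s3 hf3 hS
  have hR3 := hR2.frame hf3
  have g6 : s3.arr 6 = s1.arr 6 := (hf3.arr (by decide)).trans k6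
  have g6' : s3.var 6 = 0 := (hf3.var (by decide)).trans k6'
  have g7 : s3.arr 7 = s2.arr 7 := hf3.arr (by decide)
  have g4 : s3.var 4 = 0 := (hf3.var (by decide)).trans
    ((hf2.var (by decide)).trans ((hf1.var (by decide)).trans h4))
  have hc3 := ((hc.frame hf1).frame hf2).frame hf3
  refine (checkMarks_runs hW hR3 hS.mark_le g4).conseq le_rfl fun s4 _ h => ?_
  have hq : 0 ≤ s3.rvar 0 ↔ 0 ≤ q := by
    rw [← hc3.threshold]
    constructor <;> intro h <;> linarith
  have hex : (∃ lab, G.Sol d μ K q lab ∧ G.Ext (s.arr 2) lab) ↔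
      ∃ lab, G.Sol d μ K q lab ∧ G.Ext (s1.arr 6) lab := by
    refine exists_congr fun lab => and_congr_right fun _ => ⟨fun h => h.congr_left hL,
      fun h => h.congr_left fun v hv => (hL v hv).symm⟩
  unfold SearchedIn at hS
  rw [g6, g6'] at hS
  rw [hq, ← exists_sol_iff (q := q) hμ hd hdK hS (by rwa [g7]), ← hex] at h
  exact h

end

/-! ### Reading the input -/

/-- Append the reversals of the arcs, and build the lists of arcs. -/
def setup : Program :=
  assign 5 (.add (vr 1) (vr 1)) ;; assign 7 (.add (vr 3) (vr 3)) ;;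
    forLoop 8 1 (store 0 (.add (vr 1) (vr 8)) (cell 1 (vr 8)) ;;
      store 1 (.add (vr 1) (vr 8)) (cell 0 (vr 8)) ;;
      store 3 (vr 8) (.add (vr 1) (vr 8)) ;; store 3 (.add (vr 1) (vr 8)) (vr 8)) ;;
    forArcs (store 5 (vr 8) (cell 4 tl) ;; store 4 tl (.add (vr 8) (lit 1)))

/-- The program that solves Zero Extension. -/
def solver : Program :=
  setup ;; ite (.lt (vr 2) (lit 2)) propagate (ite (.eq (vr 3) (lit 0)) propagate branch)

section

variable {W : ℕ} {s : State}

/-- The arcs of the graph after the setup, for `m` edges with the ends given by `S` and `D`. -/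
structure Arcs (m : ℕ) (S D T H rev : ℕ → ℕ) : Prop where
  T_left : ∀ j < m, T j = S j
  T_right : ∀ j < m, T (m + j) = D j
  H_left : ∀ j < m, H j = D j
  H_right : ∀ j < m, H (m + j) = S j
  rev_left : ∀ j < m, rev j = m + j
  rev_right : ∀ j < m, rev (m + j) = j

/-- The linked lists of the first `i` arcs. -/
structure Lists (T first next : ℕ → ℕ) (i : ℕ) : Prop where
  first_le : ∀ v, first v ≤ i
  T_first : ∀ v, first v ≠ 0 → T (first v - 1) = v
  lt_first : ∀ j < i, j < first (T j)
  next_le : ∀ j < i, next j ≤ j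
  T_next : ∀ j < i, next j ≠ 0 → T (next j - 1) = T j
  lt_next : ∀ j < i, ∀ l < j, T l = T j → l < next j

theorem Lists.step {T first next : ℕ → ℕ} {i : ℕ} (h : Lists T first next i) :
    Lists T (Function.update first (T i) (i + 1)) (Function.update next i (first (T i)))
      (i + 1) := by
  have hlt : ∀ {j}, j < i + 1 → j ≠ i → j < i := fun h1 h2 => by omega
  refine ⟨fun v => ?_, fun v hv => ?_, fun j hj => ?_, fun j hj => ?_, fun j hj hj0 => ?_,
    fun j hj l hl hT => ?_⟩
  · rw [Function.update_apply]
    split_ifs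
    · exact le_rfl
    · exact (h.first_le v).trans (Nat.le_succ i)
  · by_cases hv' : v = T i
    · rw [hv', Function.update_self, Nat.add_sub_cancel]
    · rw [Function.update_of_ne hv'] at hv ⊢
      exact h.T_first v hv
  · by_cases hv' : T j = T i
    · rw [hv', Function.update_self]
      exact hj
    · rw [Function.update_of_ne hv']
      exact h.lt_first j (hlt hj fun h => hv' (by rw [h]))
  · by_cases hji : j = i
    · rw [hji, Function.update_self]
      exact h.first_le _
    · rw [Function.update_of_ne hji]
      exact h.next_le j (hlt hj hji)
  · by_cases hji : j = i
    · rw [hji, Function.update_self] at hj0 ⊢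
      exact h.T_first _ hj0
    · rw [Function.update_of_ne hji] at hj0 ⊢
      exact h.T_next j (hlt hj hji) hj0
  · by_cases hji : j = i
    · rw [hji, Function.update_self]
      rw [hji] at hl hT
      rw [← hT]
      exact h.lt_first l hl
    · rw [Function.update_of_ne hji]
      exact h.lt_next j (hlt hj hji) l hl hT

theorem setup_runs {n m d k : ℕ} (h0 : s.var 0 = n) (h1 : s.var 1 = m) (h2 : s.var 2 = d)
    (h3 : s.var 3 = k) (hS : ∀ j < m, s.arr 0 j < n) (hD : ∀ j < m, s.arr 1 j < n)
    (h4 : ∀ v, s.arr 4 v = 0) (hWm : 2 * m + 2 ≤ W) (hWn : n ≤ W) (hWk : 2 * k ≤ W) :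
    Runs W setup s (100 * m + 50) (fun s' => ∃ G : Net, G.n = n ∧ G.M = m + m ∧
      Ready G d (k + k) s' ∧ Arcs m (s.arr 0) (s.arr 1) G.T G.H G.rev) := by
  set s2 := (s.setVar 5 (m + m)).setVar 7 (k + k) with hs2
  refine (Runs.seq (T := 4) (T' := 4 + ((40 * m + 6) + (60 * m + 6)))
    (Q := fun s' => s' = s.setVar 5 (m + m)) ?_ ?_).conseq (by omega) fun _ _ h => h
  · refine (Runs.of_wp ?_).conseq (by decide) fun _ _ h => h
    simp only [wp, NExp.Fits, NExp.eval, h1, and_true]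
    omega
  rintro _ - rfl
  refine Runs.seq (T := 4) (Q := fun s' => s' = s2) ?_ ?_
  · refine (Runs.of_wp ?_).conseq (by decide) fun _ _ h => h
    simp only [wp, NExp.Fits, NExp.eval, State.setVar_var, Nat.reduceEqDiff, if_false, h3, hs2,
      and_true]
    omega
  rintro _ - rfl
  have k1 : s2.var 1 = m := h1
  have hloop := Runs.forLoop (W := W) (s := s2) (x := 8) (y := 1) (T := 32) (N := m)
    (body := store 0 (.add (vr 1) (vr 8)) (cell 1 (vr 8)) ;;
      store 1 (.add (vr 1) (vr 8)) (cell 0 (vr 8)) ;;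
      store 3 (vr 8) (.add (vr 1) (vr 8)) ;; store 3 (.add (vr 1) (vr 8)) (vr 8))
    (I := fun i s' => (∀ j < m, s'.arr 0 j = s.arr 0 j) ∧ (∀ j < m, s'.arr 1 j = s.arr 1 j) ∧
      ∀ j < i, s'.arr 0 (m + j) = s.arr 1 j ∧ s'.arr 1 (m + j) = s.arr 0 j ∧
        s'.arr 3 j = m + j ∧ s'.arr 3 (m + j) = j)
    (by decide) (by decide) (by decide) k1 (by omega)
    ⟨fun _ _ => rfl, fun _ _ => rfl, fun j hj => (Nat.not_lt_zero j hj).elim⟩ (fun i s v h => h)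
    (by
      rintro i s' hi hf hx ⟨hI1, hI2, hI3⟩
      have g1 : s'.var 1 = m := (hf.var (by decide)).trans k1
      have e1 := hI1 i hi
      have e2 := hI2 i hi
      have b1 := hS i hi
      have b2 := hD i hi
      refine (Runs.of_wp ?_).conseq (T' := 32) (by decide) (fun _ _ h => h)
      simp only [wp, NExp.Fits, NExp.eval, hx, g1, State.setArr_arr, State.setArr_var,
        Nat.reduceEqDiff, if_true, if_false, Function.update_apply, zero_ne_one, one_ne_zero]
      rw [if_neg (show i ≠ m + i by omega)]
      refine ⟨by omega, by omega, by omega, by omega, by omega, by omega, by omega, by omega,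
        fun j hj => ?_, fun j hj => ?_, fun j hj => ?_⟩
      · rw [if_neg (by omega), hI1 j hj]
      · rw [if_neg (by omega), hI2 j hj]
      · by_cases hji : j = i
        · subst hji
          simp [e1, e2]
        · have := hI3 j (by omega)
          rw [if_neg (by omega), if_neg (by omega), if_neg (by omega), if_neg hji,
            if_neg (by omega), if_neg (by omega)]
          exact this)
  refine (hloop.conseq (T' := 40 * m + 6) (by omega) fun _ _ h => h).seq ?_
  rintro s3 hf3 ⟨hI1, hI2, hI3⟩
  have f5 : s3.var 5 = m + m := hf3.var (by decide)
  have f4 : s3.arr 4 = s.arr 4 := hf3.arr (by decide)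
  have hA : Arcs m (s.arr 0) (s.arr 1) (s3.arr 0) (s3.arr 1) (s3.arr 3) :=
    ⟨hI1, fun j hj => (hI3 j hj).1, hI2, fun j hj => (hI3 j hj).2.1,
      fun j hj => (hI3 j hj).2.2.1, fun j hj => (hI3 j hj).2.2.2⟩
  have hT : ∀ j < m + m, s3.arr 0 j < n := by
    intro j hj
    by_cases hjm : j < m
    · rw [hA.T_left j hjm]
      exact hS j hjm
    · obtain ⟨i, rfl⟩ := Nat.exists_eq_add_of_le (not_lt.1 hjm)
      rw [hA.T_right i (by omega)]
      exact hD i (by omega)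
  refine (Runs.forLoop (T := 22) (I := fun i s' => Lists (s3.arr 0) (s'.arr 4) (s'.arr 5) i)
    (by decide) (by decide) (by decide) f5 (by omega) ?_ (fun i s v h => h) ?_).conseq (by omega)
    fun s' hf hL => ?_
  · refine ⟨fun v => by rw [f4, h4], fun v hv => (hv (by rw [f4, h4])).elim, ?_, ?_, ?_, ?_⟩ <;>
      exact fun j hj => (Nat.not_lt_zero j hj).elim
  · intro i s' hi hf hx hI
    have g0 : s'.arr 0 = s3.arr 0 := hf.arr (by decide)
    have := hT i hi
    have := hI.first_le (s3.arr 0 i)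
    refine (Runs.of_wp ?_).conseq (T' := 22) (by decide) (fun _ _ h => h)
    simp only [wp, NExp.Fits, NExp.eval, hx, g0, State.setArr_arr, State.setArr_var,
      Nat.reduceEqDiff, if_true, if_false]
    exact ⟨by omega, by omega, by omega, by omega, hI.step⟩
  · have g0 : s'.arr 0 = s3.arr 0 := hf.arr (by decide)
    have g1 : s'.arr 1 = s3.arr 1 := hf.arr (by decide)
    have g3 : s'.arr 3 = s3.arr 3 := hf.arr (by decide)
    have v5 : s'.var 5 = m + m := (hf.var (by decide)).trans f5
    have v0 : s'.var 0 = n := (hf.var (by decide)).trans ((hf3.var (by decide)).trans h0)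
    have v2 : s'.var 2 = d := (hf.var (by decide)).trans ((hf3.var (by decide)).trans h2)
    have v7 : s'.var 7 = k + k := (hf.var (by decide)).trans (hf3.var (by decide))
    rw [← g0] at hL hT
    rw [← g0, ← g1, ← g3] at hA
    have hcases : ∀ {P : ℕ → Prop}, (∀ j < m, P j) → (∀ j < m, P (m + j)) →
        ∀ {j}, j < m + m → P j := by
      intro P hl hr j hj
      by_cases hjm : j < m
      · exact hl j hjm
      · obtain ⟨i, rfl⟩ := Nat.exists_eq_add_of_le (not_lt.1 hjm)
        exact hr i (by omega)
    refine ⟨{ n := n, M := m + m, T := s'.arr 0, H := s'.arr 1, rev := s'.arr 3,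
              first := s'.arr 4, next := s'.arr 5
              T_lt := fun hj => hT _ hj
              rev_lt := ?_, rev_rev := ?_, T_rev := ?_, H_rev := ?_
              first_le := hL.first_le, T_first := hL.T_first, lt_first := fun hj => hL.lt_first _ hj
              next_le := fun hj => hL.next_le _ hj, T_next := fun hj => hL.T_next _ hj
              lt_next := fun hj hl => hL.lt_next _ hj _ hl },
      rfl, rfl, ⟨v0, v2, v5, v7, rfl, rfl, rfl, rfl, rfl⟩, hA⟩
    · refine hcases (P := fun j => s'.arr 3 j < m + m) (fun j hj => ?_) fun j hj => ?_
      · rw [hA.rev_left j hj]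
        omega
      · rw [hA.rev_right j hj]
        omega
    · refine hcases (P := fun j => s'.arr 3 (s'.arr 3 j) = j) (fun j hj => ?_) fun j hj => ?_
      · rw [hA.rev_left j hj, hA.rev_right j hj]
      · rw [hA.rev_right j hj, hA.rev_left j hj]
    · refine hcases (P := fun j => s'.arr 0 (s'.arr 3 j) = s'.arr 1 j) (fun j hj => ?_)
        fun j hj => ?_
      · rw [hA.rev_left j hj, hA.T_right j hj, hA.H_left j hj]
      · rw [hA.rev_right j hj, hA.T_left j hj, hA.H_right j hj]
    · refine hcases (P := fun j => s'.arr 1 (s'.arr 3 j) = s'.arr 0 j) (fun j hj => ?_)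
        fun j hj => ?_
      · rw [hA.rev_left j hj, hA.H_right j hj, hA.T_left j hj]
      · rw [hA.rev_right j hj, hA.H_left j hj, hA.T_right j hj]

end

end ZeroExt

/-! ### Instances and the running time -/

namespace ZeroExt

open RAM RAM.Program

/-- The cost function of the instance on the labels `1, …, d`, extended to all numbers. -/
noncomputable def Instance.code (I : Instance) (a b : ℕ) : ℝ :=
  I.μ ⟨(a - 1) % I.d, Nat.mod_lt _ I.d_pos⟩ ⟨(b - 1) % I.d, Nat.mod_lt _ I.d_pos⟩

theorem Instance.isMetricCost_code {I : Instance} (h : IsMetricCost I.μ) :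
    IsMetricCost I.code where
  nonneg _ _ := h.nonneg _ _
  symm _ _ := h.symm _ _
  diag _ := h.diag _
  triangle _ _ _ := h.triangle _ _ _

theorem Instance.code_succ (I : Instance) (a b : Fin I.d) : I.code (a + 1) (b + 1) = I.μ a b := by
  simp [Instance.code, Nat.mod_eq_of_lt]

theorem Instance.costs_input (I : Instance) (k : ℕ) :
    Costs I.d I.code (I.q + I.q) (I.input k) where
  table a b ha had hb hbd := by
    have h1 : ((a - 1) * I.d + (b - 1)) / I.d = a - 1 := by
      rw [Nat.mul_comm, Nat.mul_add_div I.d_pos, Nat.div_eq_of_lt (by omega), add_zero]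
    have h2 : ((a - 1) * I.d + (b - 1)) % I.d = b - 1 := by
      rw [Nat.mul_comm, Nat.mul_add_mod, Nat.mod_eq_of_lt (by omega)]
    have h3 : a - 1 < I.d := by omega
    simp only [Instance.input, Instance.code, h1, h2, Nat.mod_eq_of_lt h3,
      Nat.mod_eq_of_lt (show b - 1 < I.d by omega)]
    rw [dif_pos h3]
  threshold := rfl

theorem Arcs.sum_eq {R : Type*} [AddCommMonoid R] {m : ℕ} {S D T H rev : ℕ → ℕ}
    (h : Arcs m S D T H rev) (F : ℕ → ℕ → R) (hF : ∀ a b, F a b = F b a) :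
    ∑ j ∈ Finset.range (m + m), F (T j) (H j) =
      ∑ j ∈ Finset.range m, F (S j) (D j) + ∑ j ∈ Finset.range m, F (S j) (D j) := by
  rw [Finset.sum_range_add]
  congr 1 <;> refine Finset.sum_congr rfl fun j hj => ?_ <;> rw [Finset.mem_range] at hj
  · rw [h.T_left j hj, h.H_left j hj]
  · rw [h.T_right j hj, h.H_right j hj, hF]

/-- The instance has a solution if and only if the graph in memory has one. -/
theorem Instance.hasSolution_iff {I : Instance} {k : ℕ} (hμ : IsMetricCost I.μ) {G : Net}
    (hn : G.n = I.n) (hM : G.M = I.m + I.m)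
    (hA : Arcs I.m ((I.input k).arr 0) ((I.input k).arr 1) G.T G.H G.rev) :
    (∃ lab, G.Sol I.d I.code (k + k) (I.q + I.q) lab ∧ G.Ext ((I.input k).arr 2) lab) ↔
      I.HasSolution k := by
  have hS : ∀ e : Fin I.m, (I.input k).arr 0 e = I.src e := fun e => by simp [Instance.input]
  have hD : ∀ e : Fin I.m, (I.input k).arr 1 e = I.tgt e := fun e => by simp [Instance.input]
  have hcode := Instance.isMetricCost_code hμ
  have hcross : ∀ lab : ℕ → ℕ, ∑ j ∈ Finset.range G.M,
      (if lab (G.T j) = lab (G.H j) then 0 else 1) =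
      ∑ e, (if lab (I.src e) = lab (I.tgt e) then 0 else 1) +
        ∑ e, (if lab (I.src e) = lab (I.tgt e) then 0 else 1) := by
    intro lab
    rw [hM, hA.sum_eq (fun a b => if lab a = lab b then 0 else 1) (fun a b => by simp [eq_comm]),
      Finset.sum_range]
    simp only [hS, hD]
  have hcost : ∀ lab : ℕ → ℕ, ∑ j ∈ Finset.range G.M, I.code (lab (G.T j)) (lab (G.H j)) =
      ∑ e, I.code (lab (I.src e)) (lab (I.tgt e)) +
        ∑ e, I.code (lab (I.src e)) (lab (I.tgt e)) := by
    intro lab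
    rw [hM, hA.sum_eq (fun a b => I.code (lab a) (lab b)) (fun a b => hcode.symm _ _),
      Finset.sum_range]
    simp only [hS, hD]
  have hτ : ∀ v : Fin I.n, (I.input k).arr 2 v =
      match I.τ v with
      | none => 0
      | some a => (a : ℕ) + 1 := fun v => by
    cases h : I.τ v <;> simp [Instance.input, h]
  have hcrossing : ∀ lab : Fin I.n → Fin I.d, crossing I.src I.tgt lab =
      ∑ e, if lab (I.src e) = lab (I.tgt e) then 0 else 1 := by
    intro lab
    rw [crossing, Finset.card_filter]
    exact Finset.sum_congr rfl fun e _ => by simp [ite_not]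
  have hvert : ∀ e, G.Vert (I.src e) ∧ G.Vert (I.tgt e) := by
    intro e
    have h1 : (e : ℕ) < G.M := by
      have := e.2
      omega
    refine ⟨⟨e, h1, ?_⟩, ?_⟩
    · rw [hA.T_left e e.2, hS]
    · have := Net.vert_H h1
      rwa [hA.H_left e e.2, hD] at this
  constructor
  · rintro ⟨lab, h, hL⟩
    have hlt : ∀ v, lab v - 1 < I.d := fun v => by
      have := h.range v
      omega
    -- Vertices without edges keep the label that they have in the input.
    let lab' : Fin I.n → Fin I.d := fun v => (I.τ v).getD ⟨lab v - 1, hlt v⟩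
    have hlab' : ∀ v : Fin I.n, G.Vert v → (lab' v : ℕ) + 1 = lab v := by
      intro v hv
      have h1 := h.range v
      have h2 := hL v hv
      rw [hτ v] at h2
      cases h3 : I.τ v with
      | none =>
        simp only [lab', h3, Option.getD_none]
        omega
      | some a =>
        rw [h3] at h2
        simp only [lab', h3, Option.getD_some]
        exact (h2 (Nat.succ_ne_zero _)).symm
    refine ⟨lab', fun v a hv => by simp [lab', hv], ?_, ?_⟩
    · have h1 := h.crossing
      rw [hcross] at h1
      rw [hcrossing]
      have h2 : ∑ e, (if lab' (I.src e) = lab' (I.tgt e) then 0 else 1) =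
          ∑ e, if lab (I.src e) = lab (I.tgt e) then 0 else 1 := by
        refine Finset.sum_congr rfl fun e _ => ?_
        rw [← hlab' _ (hvert e).1, ← hlab' _ (hvert e).2]
        simp [Fin.ext_iff]
      omega
    · have h1 := h.cost
      rw [hcost] at h1
      have h2 : cost I.src I.tgt I.μ lab' = ∑ e, I.code (lab (I.src e)) (lab (I.tgt e)) :=
        Finset.sum_congr rfl fun e _ => by
          rw [← hlab' _ (hvert e).1, ← hlab' _ (hvert e).2, I.code_succ]
      linarith
  · rintro ⟨lab, h1, h2, h3⟩
    let lab' : ℕ → ℕ := fun v => if hv : v < I.n then (lab ⟨v, hv⟩ : ℕ) + 1 else 1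
    have hlab' : ∀ v : Fin I.n, lab' v = lab v + 1 := fun v => by simp [lab']
    refine ⟨lab', ⟨fun v => ?_, ?_, ?_⟩, fun v hv hv0 => ?_⟩
    · simp only [lab']
      split_ifs with hv
      · have := (lab ⟨v, hv⟩).2
        omega
      · exact ⟨le_rfl, I.d_pos⟩
    · rw [hcross]
      rw [hcrossing] at h2
      have h4 : ∑ e, (if lab' (I.src e) = lab' (I.tgt e) then 0 else 1) =
          ∑ e, if lab (I.src e) = lab (I.tgt e) then 0 else 1 := by
        refine Finset.sum_congr rfl fun e _ => ?_
        rw [hlab', hlab']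
        simp [Fin.ext_iff]
      omega
    · rw [hcost]
      have h4 : cost I.src I.tgt I.μ lab = ∑ e, I.code (lab' (I.src e)) (lab' (I.tgt e)) :=
        Finset.sum_congr rfl fun e _ => by rw [hlab', hlab', I.code_succ]
      linarith
    · obtain ⟨v, rfl⟩ : ∃ w : Fin I.n, (w : ℕ) = v := ⟨⟨v, hn ▸ hv.lt⟩, rfl⟩
      rw [hlab']
      rw [hτ v] at hv0 ⊢
      cases h4 : I.τ v with
      | none => simp [h4] at hv0
      | some a => simp [h1 v a h4]

theorem fit_pow {n m d k c : ℕ} (hc : 4 ≤ c) {G : Net} (hn : G.n = n) (hM : G.M = m + m) :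
    Fit ((n + m + d + k + 2) ^ c) G d (k + k) := by
  have h2 : 2 ≤ n + m + d + k + 2 := by omega
  set B := n + m + d + k + 2 with hB
  have h4 : B ^ 4 ≤ B ^ c := Nat.pow_le_pow_right (by omega) hc
  have h3 : 2 * (B * B) ≤ B ^ 4 := by
    have h5 : 2 * 1 ≤ B * B := Nat.mul_le_mul h2 (by omega)
    calc 2 * (B * B) ≤ B * B * (B * B) := Nat.mul_le_mul_right _ (by omega)
      _ = B ^ 4 := by ring
  have h5 : 2 * B ≤ B * B := Nat.mul_le_mul_right _ h2
  refine ⟨?_, ?_, ?_, ?_⟩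
  · omega
  · have h6 : (d + 2) * (d + 2) ≤ B * B := Nat.mul_le_mul (by omega) (by omega)
    have h7 : (d + 2) * (d + 2) = d * d + 4 * d + 4 := by ring
    omega
  · omega
  · have h6 : (k + 1) * n ≤ B * B := Nat.mul_le_mul (by omega) (by omega)
    have h7 : (k + k + 1) * n + n = 2 * ((k + 1) * n) := by ring
    rw [hn, h7]
    omega

/-- The bound on the running time of the tree search has the required form. -/
theorem branch_time_le {d k m c : ℕ} (hd : 2 ≤ d) (hk : 1 ≤ k) (hc : 6 ≤ c) :
    (k + k + 1) * (1100 * (m + m) + 500) * d * (budget d (k + k) + 2) ≤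
      8800 * (d ^ (c * k) * (m + 1)) := by
  have h1 : k + k + 1 ≤ 2 * d ^ k := by
    have h2 : k + 1 ≤ 2 ^ k := Nat.lt_two_pow_self
    have h3 : 2 ^ k ≤ d ^ k := Nat.pow_le_pow_left hd k
    omega
  have h2 : d ≤ d ^ k := Nat.le_self_pow (by omega) d
  have h3 : budget d (k + k) + 2 ≤ 2 * d ^ (4 * k) := by
    refine (budget_le (by omega) _).trans (Nat.mul_le_mul_left _ ?_)
    calc (2 * d) ^ (k + k) ≤ (d ^ 2) ^ (k + k) :=
          Nat.pow_le_pow_left (by rw [pow_two]; exact Nat.mul_le_mul_right _ hd) _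
      _ = d ^ (4 * k) := by rw [← pow_mul]; congr 1; ring
  calc (k + k + 1) * (1100 * (m + m) + 500) * d * (budget d (k + k) + 2)
      ≤ 2 * d ^ k * (2200 * (m + 1)) * d ^ k * (2 * d ^ (4 * k)) := by
        gcongr
        omega
    _ = 8800 * (d ^ (6 * k) * (m + 1)) := by ring
    _ ≤ 8800 * (d ^ (c * k) * (m + 1)) := by
        gcongr
        omega

/-- The solver is correct and fast enough, for every sufficiently large constant. -/
theorem solver_runs {c : ℕ} (hc : 20000 ≤ c) (I : Instance) (k : ℕ) (hμ : IsMetricCost I.μ) :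
    Runs ((I.n + I.m + I.d + k + 2) ^ c) solver (I.input k) (c * I.d ^ (c * k) * (I.m + 1))
      (fun s' => (I.HasSolution k → s'.var 4 = 1) ∧ (¬ I.HasSolution k → s'.var 4 = 0)) := by
  set W := (I.n + I.m + I.d + k + 2) ^ c with hWdef
  have hBW : (I.n + I.m + I.d + k + 2) ^ 2 ≤ W := Nat.pow_le_pow_right (by omega) (by omega)
  have hB2 : 2 * (I.n + I.m + I.d + k + 2) ≤ (I.n + I.m + I.d + k + 2) ^ 2 := by
    rw [pow_two]
    exact Nat.mul_le_mul_right _ (by omega)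
  have hpow : 1 ≤ I.d ^ (c * k) := Nat.one_le_pow _ _ I.d_pos
  have hP : 1 * (I.m + 1) ≤ I.d ^ (c * k) * (I.m + 1) := Nat.mul_le_mul_right _ hpow
  have hcP : 20000 * (I.d ^ (c * k) * (I.m + 1)) ≤ c * I.d ^ (c * k) * (I.m + 1) := by
    rw [Nat.mul_assoc]
    exact Nat.mul_le_mul_right _ hc
  refine ((setup_runs (W := W) (s := I.input k) (n := I.n) (m := I.m) (d := I.d) (k := k)
    rfl rfl rfl rfl ?_ ?_ (fun _ => rfl) (by omega) (by omega) (by omega)).seq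
    (T' := 4 + (4 + 10000 * (I.d ^ (c * k) * (I.m + 1)))) ?_).conseq (by omega) fun _ _ h => h
  · intro j hj
    simp [Instance.input, hj]
  · intro j hj
    simp [Instance.input, hj]
  rintro s1 hf1 ⟨G, hn, hM, hR, hA⟩
  have hW : Fit W G I.d (k + k) := fit_pow (by omega) hn hM
  have hcosts : Costs I.d I.code (I.q + I.q) s1 := (I.costs_input k).frame hf1
  have h2 : s1.arr 2 = (I.input k).arr 2 := hf1.arr (by decide)
  have h3 : s1.var 3 = k := hf1.var (by decide)
  have h4 : s1.var 4 = 0 := hf1.var (by decide)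
  have h6 : s1.var 6 = 0 := hf1.var (by decide)
  have h15 : s1.var 15 = 0 := hf1.var (by decide)
  have hτ : ∀ v, G.Vert v → s1.arr 2 v ≤ I.d := by
    intro v _
    rw [h2]
    simp only [Instance.input]
    split_ifs with hv
    · cases I.τ ⟨v, hv⟩ with
      | none => exact Nat.zero_le _
      | some a => exact a.2
    · exact Nat.zero_le _
  have hcode := Instance.isMetricCost_code hμ
  have hiff := Instance.hasSolution_iff (k := k) hμ hn hM hA
  have hW2 : 2 ≤ W := by omega
  have hprop : I.d = 1 ∨ k + k = 0 → Runs W propagate s1 (10000 * (I.d ^ (c * k) * (I.m + 1)))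
      (fun s' => (I.HasSolution k → s'.var 4 = 1) ∧ (¬ I.HasSolution k → s'.var 4 = 0)) := by
    intro h
    refine (propagate_runs hcode I.d_pos h hW hR hcosts hτ h4 h6).conseq ?_ fun s' _ h => ?_
    · rw [hM]
      omega
    · rwa [h2, hiff] at h
  refine Runs.ite ?_ (fun hb => ?_) (fun hb => ?_)
  · simp only [Test.Fits, NExp.Fits, hR.d]
    omega
  · simp only [Test.Holds, NExp.eval, hR.d] at hb
    have := I.d_pos
    exact (hprop (Or.inl (by omega))).conseq (by omega) fun _ _ h => h
  · simp only [Test.Holds, NExp.eval, hR.d] at hb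
    refine Runs.ite ?_ (fun hb' => ?_) (fun hb' => ?_)
    · simp only [Test.Fits, NExp.Fits, h3]
      omega
    · simp only [Test.Holds, NExp.eval, h3] at hb'
      exact hprop (Or.inr (by omega))
    · simp only [Test.Holds, NExp.eval, h3] at hb'
      refine (branch_runs hcode I.d_pos hW hR hcosts hτ h4 h15).conseq ?_ fun s' _ h => ?_
      · rw [hM]
        refine (branch_time_le (c := c) (by omega) (by omega) (by omega)).trans ?_
        exact Nat.mul_le_mul_right _ (by omega)
      · rwa [h2, hiff] at h

end ZeroExt

/-- There are one program and one constant `c` such that, for every instance of Zero Extension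
whose cost function is a metric and every bound `k` on the number of crossing edges, the program
halts within `c * d ^ (c * k) * (m + 1)` steps, using only numbers that are polynomial in the size
of the input (words of logarithmic length), and leaves in variable `4` the number `1` if there is an
extension of cost at most `q` with at most `k` crossing edges, and `0` otherwise. -/
theorem theorem2 :
    ∃ (p : RAM.Program) (c : ℕ), ∀ (I : ZeroExt.Instance) (k : ℕ), ZeroExt.IsMetricCost I.μ →
      ∃ (t : ℕ) (s : RAM.State),
        RAM.Exec ((I.n + I.m + I.d + k + 2) ^ c) p (I.input k) t s ∧
        t ≤ c * I.d ^ (c * k) * (I.m + 1) ∧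
        (I.HasSolution k → s.var 4 = 1) ∧ (¬ I.HasSolution k → s.var 4 = 0) :=
  ⟨ZeroExt.solver, 20000, fun I k hμ => ZeroExt.solver_runs le_rfl I k hμ⟩
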